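/- **Weights and blocks.** A *number line* is a set of consecutive integers (finite or infinite), whose elements are called vertices. A *weight* is a labelling of the vertices of a number line by $\circ,\times,\vee$ (down), $\wedge$ (up) such that outside some finite set of vertices there are no two vertices labelled $\vee\,\wedge$ in that order from left to right. Write $\lambda\sim\mu$ if $\mu$ is obtained from $\lambda$ by a finite permutation of the $\vee$'s and $\wedge$'s (fixing the $\circ$'s and $\times$'s); a *block* $\Lambda$ is a $\sim$-equivalence class. The *Bruhat order* $\le$ is generated by the operation of swapping a $\vee$ and a $\wedge$, weights getting bigger when $\vee$'s move to the right. The cup diagram $\underline\lambda$ is obtained by repeatedly joining by a cup two vertices labelled $\vee\,\wedge$ in that order which have only $\circ$'s, $\times$'s and already joined vertices in between, and then drawing rays down to infinity at the remaining $\vee$'s and $\wedge$'s; $\overline\lambda$ is its mirror image, a cap diagram. Write $\mu\subset\lambda$ if $\mu\sim\lambda$, each cup of $\underline\mu$ joins a $\vee$ and a $\wedge$ of $\lambda$, and no two rays of $\underline\mu$ are at vertices labelled $\vee\,\wedge$ in that order in $\lambda$. The *defect* $\operatorname{def}(\lambda)$ is the number of cups of $\underline\lambda$, $\operatorname{def}(\Lambda)=\sup_{\lambda\in\Lambda}\operatorname{def}(\lambda)$,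 and $\Lambda^\circ=\{\lambda\in\Lambda : \operatorname{def}(\lambda)=\operatorname{def}(\Lambda)\}$. **The algebras.** Let $k$ be a field. $K_\Lambda$ is the $k$-vector space with basis the oriented circle diagrams $(\underline\alpha\lambda\overline\beta)$ with $\alpha,\lambda,\beta\in\Lambda$, $\alpha\subset\lambda\supset\beta$. Its bilinear product is defined as follows. The product $(\underline\alpha\lambda\overline\beta)(\underline\gamma\mu\overline\delta)$ is $0$ if $\beta\ne\gamma$. Suppose $\beta=\gamma$, the number line is finite, and all cup and cap diagrams involved have no rays. Draw the first diagram under the second, and successively replace each symmetric cap--cup pair of the middle section that can be connected without crossings by two vertical segments. Each such surgery merges two circles into one or splits one circle into two; re-orient these circles by the rules $1\otimes1\mapsto1$, $1\otimes x\mapsto x$, $x\otimes1\mapsto x$, $x\otimes x\mapsto0$, $1\mapsto1\otimes x+x\otimes1$, $x\mapsto x\otimes x$. Here a circle has type $1$ (anti-clockwise) if its leftmost vertex is labelled $\vee$ and type $x$ (clockwise) if it is labelled $\wedge$. Finally identify the two number lines and take the sum of the resulting basis vectors $(\underline\alpha\nu\overline\delta)$. In general, if the number line is finite, let $p$ and $q$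 be the numbers of $\wedge$'s and of $\vee$'s in the weights of $\Lambda$. Replace each weight by its *closure*, obtained by adding $p$ vertices labelled $\vee$ at the left end and $q$ vertices labelled $\wedge$ at the right end; multiply the resulting diagrams without rays as above; discard all terms whose weight is not the closure of a weight in $\Lambda$; and replace the closures by the original weights in the remaining terms. If the number line is infinite, truncate: restrict the weights to a finite set $J$ of consecutive vertices, outside of which the weights coincide and have no two labels $\vee\,\wedge$ in that order; compute the product there; and extend the result back to the number line. Put $e_\alpha=(\underline\alpha\alpha\overline\alpha)$. The *generalised Khovanov algebra* is $$H_\Lambda=\bigoplus_{\alpha,\beta\in\Lambda^\circ}e_\alpha K_\Lambda e_\beta\subseteq K_\Lambda .$$ **Cellular algebras.** An associative unital $k$-algebra $H$ is *cellular* (Graham--Lehrer) with cell datum $(\Lambda,M,C,*)$ if 1. $\Lambda$ is a partially ordered set and $M(\lambda)$ is a finite set for each $\lambda\in\Lambda$; 2. $C:\bigsqcup_{\lambda\in\Lambda}M(\lambda)\times M(\lambda)\to H$, $(\alpha,\beta)\mapsto C^\lambda_{\alpha,\beta}$, is injective and its image is a basis of $H$; 3. $*:H\to H$ is an algebra anti-automorphism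 with $(C^\lambda_{\alpha,\beta})^*=C^\lambda_{\beta,\alpha}$; 4. for all $x\in H$ and $\mu\in\Lambda$ there are scalars $r_x(\gamma',\gamma)$ ($\gamma',\gamma\in M(\mu)$) such that for all $\gamma,\delta\in M(\mu)$ $$x\,C^\mu_{\gamma,\delta}\equiv\sum_{\gamma'\in M(\mu)}r_x(\gamma',\gamma)\,C^\mu_{\gamma',\delta}\pmod{H(>\mu)},$$ where $H(>\mu)$ is the span of all $C^\nu_{\gamma'',\delta''}$ with $\nu>\mu$ and $\gamma'',\delta''\in M(\nu)$. **Theorem.** Let $\Lambda$ be a block with $|\Lambda|<\infty$. Then $H_\Lambda$ is closed under the multiplication of $K_\Lambda$, and it is an associative unital algebra which is cellular in the sense of Graham and Lehrer with cell datum $(\Lambda,M,C,*)$, where $\Lambda$ carries the Bruhat order and - $M(\lambda)=\{\alpha\in\Lambda^\circ : \alpha\subset\lambda\}$ for each $\lambda\in\Lambda$; - $C^\lambda_{\alpha,\beta}=(\underline\alpha\lambda\overline\beta)$ for $\lambda\in\Lambda$ and $\alpha,\beta\in M(\lambda)$; - $*$ is the restriction to $H_\Lambda$ of the linear map $K_\Lambda\to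 K_\Lambda$, $(\underline\alpha\lambda\overline\beta)\mapsto(\underline\beta\lambda\overline\alpha)$ (in particular this restriction maps $H_\Lambda$ to itself and is an anti-automorphism). -/

import Mathlib

namespace ArcAlgebra

/-! ## Weights, blocks and the Bruhat order -/

/-- The four labels of the vertices of a number line. -/
inductive Label
  | nought
  | cross
  | down
  | up
  deriving DecidableEq

/-- A vertex labelled by an arrow, i.e. by `down` or `up`. -/
def Label.IsArrow (l : Label) : Prop := l = Label.down ∨ l = Label.up

/-- A labelling of the integers; the integers which are not vertices of the number line
under consideration carry the dummy label `nought`. -/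
abbrev Labelling := ℤ → Label

/-- A weight: a number line (a set of consecutive integers, bounded or not) whose vertices are
labelled in such a way that outside of some finite set of vertices no two vertices are labelled
`down`, `up` in that order from left to right. -/
@[ext]
structure Weight where
  line : Set ℤ
  lab : Labelling
  line_ordConnected : line.OrdConnected
  lab_off_line : ∀ i, i ∉ line → lab i = Label.nought
  eventually_sorted : ∃ S : Set ℤ, S.Finite ∧
    ∀ i j, i ∉ S → j ∉ S → i < j → ¬ (lab i = Label.down ∧ lab j = Label.up)

/-- `mu` is obtained from `lam` by permuting (finitely many) `down`'s and `up`'s, doing nothing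
to the noughts and crosses. -/
def Weight.Equivalent (lam mu : Weight) : Prop :=
  lam.line = mu.line ∧ ∃ s : Equiv.Perm ℤ, {i | s i ≠ i}.Finite ∧
    (∀ i, ¬ (lam.lab i).IsArrow → s i = i) ∧ ∀ i, mu.lab i = lam.lab (s i)

/-- A block is an equivalence class of weights. -/
def IsBlock (L : Set Weight) : Prop := ∃ lam : Weight, L = {mu | lam.Equivalent mu}

/-- The basic operation of the Bruhat order: a `down` at `i` and an `up` at some `j > i` are
swapped, so that a `down` moves to the right. -/
def Weight.BruhatStep (lam mu : Weight) : Prop :=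
  lam.line = mu.line ∧ ∃ i j : ℤ, i < j ∧ lam.lab i = Label.down ∧ lam.lab j = Label.up ∧
    mu.lab = Function.update (Function.update lam.lab i Label.up) j Label.down

/-- The Bruhat order on weights. -/
def Weight.BruhatLE : Weight → Weight → Prop := Relation.ReflTransGen Weight.BruhatStep

/-! ## Cup diagrams -/

/-- The number of `down`'s minus the number of `up`'s among the vertices of the half-open
interval `(i, m]`. -/
noncomputable def excess (f : Labelling) (i m : ℤ) : ℤ :=
  (((Finset.Ioc i m).filter fun x => f x = Label.down).card : ℤ) -
    (((Finset.Ioc i m).filter fun x => f x = Label.up).card : ℤ)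

/-- `IsCup f i j`: the cup diagram of the labelling `f` has a cup with left end `i` and right
end `j`. This is the matching of `down`'s and `up`'s as opening and closing parentheses: `i` is
labelled `down`, `j` is labelled `up`, and the labels strictly in between form a balanced
sequence of parentheses, so that all vertices in between that are labelled by arrows are joined
among themselves by cups. The cap diagram of `f` is the mirror image. -/
def IsCup (f : Labelling) (i j : ℤ) : Prop :=
  i < j ∧ f i = Label.down ∧ f j = Label.up ∧
    (∀ m, i ≤ m → m < j → 0 ≤ excess f i m) ∧ excess f i (j - 1) = 0

/-- The cup diagram of `f` has a ray at `i`: all arrows which are not at the end of a cup. -/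
def IsRay (f : Labelling) (i : ℤ) : Prop :=
  (f i).IsArrow ∧ ¬ ∃ j, IsCup f i j ∨ IsCup f j i

/-- One of the two labels is `down` and the other one is `up`. -/
def Opposite (l l' : Label) : Prop :=
  (l = Label.down ∧ l' = Label.up) ∨ (l = Label.up ∧ l' = Label.down)

/-- The cup diagram of `f`, glued under the labelling `g`, is an oriented cup diagram. -/
structure CupOriented (f g : Labelling) : Prop where
  free : ∀ i, ¬ (f i).IsArrow → ¬ (g i).IsArrow
  cup : ∀ i j, IsCup f i j → Opposite (g i) (g j)
  ray : ∀ i, IsRay f i → (g i).IsArrow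
  rays_sorted : ∀ i j, IsRay f i → IsRay f j → i < j → ¬ (g i = Label.down ∧ g j = Label.up)

/-- The relation `mu ⊂ lam`: the weights are in the same block and the cup diagram of `mu`
glued under `lam` is oriented. -/
def Weight.Sub (mu lam : Weight) : Prop := mu.Equivalent lam ∧ CupOriented mu.lab lam.lab

theorem excess_self (f : Labelling) (i : ℤ) : excess f i i = 0 := by simp [excess]

theorem excess_add (f : Labelling) {i l m : ℤ} (h1 : i ≤ l) (h2 : l ≤ m) :
    excess f i m = excess f i l + excess f l m := by
  have hd : ∀ c : Label, ((Finset.Ioc i m).filter fun x => f x = c).card =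
      ((Finset.Ioc i l).filter fun x => f x = c).card +
        ((Finset.Ioc l m).filter fun x => f x = c).card := by
    intro c
    rw [← Finset.Ioc_union_Ioc_eq_Ioc h1 h2, Finset.filter_union]
    refine Finset.card_union_of_disjoint ?_
    refine Finset.disjoint_filter_filter ?_
    rw [Finset.disjoint_left]
    intro x hx hy
    rw [Finset.mem_Ioc] at hx hy
    omega
  simp only [excess, hd]
  push_cast
  ring

theorem excess_pred (f : Labelling) (l : ℤ) :
    excess f (l - 1) l = if f l = Label.down then 1 else if f l = Label.up then -1 else 0 := by
  have h : Finset.Ioc (l - 1) l = {l} := by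
    ext x
    rw [Finset.mem_Ioc, Finset.mem_singleton]
    omega
  simp only [excess, h, Finset.filter_singleton]
  cases f l <;> simp

/-- In any weight, there are no two rays labelled `down`, `up` in that order. -/
theorem not_rays_down_up (f : Labelling) {i j : ℤ} (hi : IsRay f i) (hj : IsRay f j)
    (hij : i < j) : ¬ (f i = Label.down ∧ f j = Label.up) := by
  rintro ⟨hd, hu⟩
  have h1 : ∀ n : ℕ, ∀ m, i ≤ m → m ≤ i + n → 0 ≤ excess f i m := by
    intro n
    induction n with
    | zero =>
      intro m h h'
      have : m = i := by simp only [Nat.cast_zero] at h'; omega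
      rw [this, excess_self]
    | succ n ih =>
      intro m h h'
      push_cast at h'
      rcases lt_or_ge (i + n : ℤ) m with hm | hm
      · have hm' : m - 1 = i + n := by omega
        have hstep := excess_add f (i := i) (l := m - 1) (m := m) (by omega) (by omega)
        rw [excess_pred] at hstep
        have hprev := ih (m - 1) (by omega) (by omega)
        by_contra hneg
        have hup : f m = Label.up := by
          by_contra hne
          rw [if_neg hne] at hstep
          split_ifs at hstep <;> omega
        rw [hup] at hstep
        simp only [reduceCtorEq, if_false, if_true] at hstep
        refine hi.2 ⟨m, Or.inl ⟨by omega, hd, hup, ?_, by omega⟩⟩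
        intro m' h1 h2
        exact ih m' h1 (by omega)
      · exact ih m h hm
  have h2 : ∀ n : ℕ, ∀ l, l ≤ j - 1 → j - 1 - n ≤ l → excess f l (j - 1) ≤ 0 := by
    intro n
    induction n with
    | zero =>
      intro l h h'
      have : l = j - 1 := by simp only [Nat.cast_zero] at h'; omega
      rw [this, excess_self]
    | succ n ih =>
      intro l h h'
      push_cast at h'
      rcases lt_or_ge l (j - 1 - n : ℤ) with hl | hl
      · have hstep := excess_add f (i := l) (l := l + 1) (m := j - 1) (by omega) (by omega)
        have hp := excess_pred f (l + 1)
        rw [show l + 1 - 1 = l by ring] at hp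
        rw [hp] at hstep
        have hprev := ih (l + 1) (by omega) (by omega)
        by_contra hpos
        have hdown : f (l + 1) = Label.down := by
          by_contra hne
          rw [if_neg hne] at hstep
          split_ifs at hstep <;> omega
        rw [if_pos hdown] at hstep
        refine hj.2 ⟨l + 1, Or.inr ⟨by omega, hdown, hu, ?_, by omega⟩⟩
        intro m h1 h2
        have ha := excess_add f (i := l + 1) (l := m) (m := j - 1) h1 (by omega)
        have hb := ih m (by omega) (by omega)
        omega
      · exact ih l h hl
  refine hi.2 ⟨j, Or.inl ⟨hij, hd, hu, ?_, ?_⟩⟩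
  · intro m h h'
    exact h1 (m - i).toNat m h (by omega)
  · have ha := h1 (j - 1 - i).toNat (j - 1) (by omega) (by omega)
    have hb := h2 (j - 1 - i).toNat i (by omega) (by omega)
    omega

theorem Weight.equivalent_refl (lam : Weight) : lam.Equivalent lam :=
  ⟨rfl, Equiv.refl ℤ, by simp, fun _ _ => rfl, fun _ => rfl⟩

theorem Weight.sub_refl (lam : Weight) : lam.Sub lam :=
  ⟨lam.equivalent_refl, fun _ h => h, fun _ _ h => Or.inl ⟨h.2.1, h.2.2.1⟩, fun _ h => h.1,
    fun _ _ hi hj hij => not_rays_down_up lam.lab hi hj hij⟩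

/-- The defect of a weight: the number of cups in its cup diagram. -/
noncomputable def Weight.defect (lam : Weight) : ℕ∞ :=
  {p : ℤ × ℤ | IsCup lam.lab p.1 p.2}.encard

/-- The defect of a block. -/
noncomputable def blockDefect (L : Set Weight) : ℕ∞ := ⨆ lam ∈ L, lam.defect

/-- The weights of maximal defect in a block. -/
def maxDefect (L : Set Weight) : Set Weight := {lam | lam ∈ L ∧ lam.defect = blockDefect L}

/-! ## The surgery procedure

Two closed oriented circle diagrams `a λ b` and `b* μ d` are drawn one under the other. The cup
diagram `a`, the symmetric middle section and the cap diagram `d` are the diagrams of three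
labellings, which are called `a`, `b`, `d`. The caps and cups of the middle section are cut pair
by pair; `rem` is the list of the left ends of those pairs which have not been cut yet. -/

/-- The vertices of a diagram with two number lines: `(false, i)` is the vertex `i` of the
bottom line and `(true, i)` is the vertex `i` of the top line. -/
abbrev Vertex := Bool × ℤ

/-- A labelling of both number lines. -/
abbrev Orientation := Vertex → Label

/-- The bottom line is labelled by `f`, the top line by `g`. -/
def stack (f g : Labelling) : Orientation := fun v => if v.1 = true then g v.2 else f v.2

/-- Two vertices are joined by a cup of the bottom diagram, a cap of the top diagram, a cap or
cup of the middle section that has not been cut yet, or a vertical line segment. -/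
inductive Joined (a b d : Labelling) (rem : List ℤ) : Vertex → Vertex → Prop
  | bottom (i j : ℤ) : IsCup a i j → Joined a b d rem (false, i) (false, j)
  | top (i j : ℤ) : IsCup d i j → Joined a b d rem (true, i) (true, j)
  | middleCap (i j : ℤ) : i ∈ rem → IsCup b i j → Joined a b d rem (false, i) (false, j)
  | middleCup (i j : ℤ) : i ∈ rem → IsCup b i j → Joined a b d rem (true, i) (true, j)
  | segment (i : ℤ) : (b i).IsArrow → (∀ l, l ∈ rem → l ≠ i ∧ ¬ IsCup b l i) →
      Joined a b d rem (false, i) (true, i)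

/-- Two vertices lie on the same circle. -/
def SameCircle (a b d : Labelling) (rem : List ℤ) : Vertex → Vertex → Prop :=
  Relation.EqvGen (Joined a b d rem)

/-- The diagram is consistently oriented by `o`: every cup and cap has one end labelled `down`
and one end labelled `up`, and both ends of a vertical segment carry the same arrow. -/
def Consistent (a b d : Labelling) (rem : List ℤ) (o : Orientation) : Prop :=
  ∀ u v, Joined a b d rem u v →
    (u.1 = v.1 → Opposite (o u) (o v)) ∧ (u.1 ≠ v.1 → o u = o v ∧ (o u).IsArrow)

/-- The types of oriented circles: `one` is anti-clockwise, `x` is clockwise. -/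
inductive CircleType
  | one
  | x

/-- The label of the leftmost vertex of a circle of the given type. -/
def CircleType.leftLabel : CircleType → Label
  | CircleType.one => Label.down
  | CircleType.x => Label.up

/-- The circle through the vertex `v` has type `t` in the orientation `o`. -/
def HasType (a b d : Labelling) (rem : List ℤ) (o : Orientation) (v : Vertex)
    (t : CircleType) : Prop :=
  ∃ u, SameCircle a b d rem v u ∧ (∀ w, SameCircle a b d rem v w → u.2 ≤ w.2) ∧
    o u = t.leftLabel

/-- The rules `1 ⊗ 1 ↦ 1`, `1 ⊗ x ↦ x`, `x ⊗ 1 ↦ x`, `x ⊗ x ↦ 0`. -/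
inductive MergeRule : CircleType → CircleType → CircleType → Prop
  | one_one : MergeRule CircleType.one CircleType.one CircleType.one
  | one_x : MergeRule CircleType.one CircleType.x CircleType.x
  | x_one : MergeRule CircleType.x CircleType.one CircleType.x

/-- The rules `1 ↦ 1 ⊗ x + x ⊗ 1`, `x ↦ x ⊗ x`. -/
inductive SplitRule : CircleType → CircleType → CircleType → Prop
  | one_left : SplitRule CircleType.one CircleType.one CircleType.x
  | one_right : SplitRule CircleType.one CircleType.x CircleType.one
  | x : SplitRule CircleType.x CircleType.x CircleType.x

/-- `SurgeryStep a b d i rem o o'`: cutting the cap and the cup of the middle section with left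
end `i` (the pairs in `rem` remaining uncut) in the diagram oriented by `o` produces, among
others, the diagram oriented by `o'`. Only circles that meet the cut cap or cup are
re-oriented. If cap and cup lie on different circles, these are merged into one circle;
otherwise their circle is split into the circles through the two new vertical segments. -/
def SurgeryStep (a b d : Labelling) (i : ℤ) (rem : List ℤ) (o o' : Orientation) : Prop :=
  Consistent a b d rem o' ∧
  (∀ v, ¬ SameCircle a b d (i :: rem) (false, i) v → ¬ SameCircle a b d (i :: rem) (true, i) v →
    o' v = o v) ∧
  (¬ SameCircle a b d (i :: rem) (false, i) (true, i) →
    ∃ t₁ t₂ t, MergeRule t₁ t₂ t ∧ HasType a b d (i :: rem) o (false, i) t₁ ∧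
      HasType a b d (i :: rem) o (true, i) t₂ ∧ HasType a b d rem o' (false, i) t) ∧
  (SameCircle a b d (i :: rem) (false, i) (true, i) →
    ∃ t t₁ t₂ j, SplitRule t t₁ t₂ ∧ IsCup b i j ∧ HasType a b d (i :: rem) o (false, i) t ∧
      HasType a b d rem o' (false, i) t₁ ∧ HasType a b d rem o' (false, j) t₂)

/-- The formal sum of the oriented diagrams obtained from `o` by cutting successively all pairs
of the list. -/
noncomputable def surgeries (k : Type*) [Field k] (a b d : Labelling) :
    List ℤ → Orientation → (Orientation →₀ k)
  | [], o => Finsupp.single o 1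
  | i :: rem, o => ∑ᶠ o' ∈ {o' | SurgeryStep a b d i rem o o'}, surgeries k a b d rem o'

open Classical in
/-- The left ends of the cups of the cup diagram of `b` (which has finitely many cups), from left
to right. In this order a pair is cut after all the pairs around it, as it has to be in order
that cap and cup can be connected without crossings. -/
noncomputable def leftEnds (b : Labelling) : List ℤ :=
  if h : {i | ∃ j, IsCup b i j}.Finite then h.toFinset.sort (· ≤ ·) else []

/-- The coefficient of `a ν d` in the product of the closed oriented circle diagrams `a λ b` and
`b* μ d`: cut all pairs of the middle section, and identify the two number lines. -/
noncomputable def closedCoeff (k : Type*) [Field k] (a b d lam mu nu : Labelling) : k :=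
  surgeries k a b d (leftEnds b) (stack lam mu) (stack nu nu)

/-! ## The algebra of all oriented circle diagrams -/

open Classical in
/-- The closure of the weight obtained by restricting `f` to the finite set `J` of consecutive
integers: `p` new vertices labelled `down` are added to the left end of `J`, and `q` new vertices
labelled `up` are added to the right end, where `p` is the number of `up`'s and `q` is the number
of `down`'s in `J`. -/
noncomputable def closureOn (J : Set ℤ) (f : Labelling) : Labelling := fun x =>
  if x ∈ J then f x
  else if (∃ y ∈ J, x < y) ∧ ∃ y ∈ J, y ≤ x + ({i | i ∈ J ∧ f i = Label.up}.ncard : ℤ) then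
    Label.down
  else if (∃ y ∈ J, y < x) ∧ ∃ y ∈ J, x ≤ y + ({i | i ∈ J ∧ f i = Label.down}.ncard : ℤ) then
    Label.up
  else Label.nought

/-- `J` is the number line of a bounded block `Γ` such that all the weights in `S` (a subset of
one block) are extensions of weights in `Γ`: outside of `J` there are no two vertices labelled
`down`, `up` in that order, and the labels there are the same for all weights in `S`. -/
structure IsWindow (S : Set Weight) (J : Set ℤ) : Prop where
  finite : J.Finite
  ordConnected : J.OrdConnected
  subset_line : ∀ lam ∈ S, J ⊆ lam.line
  sorted : ∀ lam ∈ S, ∀ i j, i ∉ J → j ∉ J → i < j →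
    ¬ (lam.lab i = Label.down ∧ lam.lab j = Label.up)
  agree : ∀ lam ∈ S, ∀ mu ∈ S, ∀ i, i ∉ J → lam.lab i = mu.lab i

open Classical in
/-- The number line on which products of diagrams of the block `L` are computed. It is the whole
number line if that is bounded. Otherwise the diagrams are truncated; a truncation that works for
all of `L` is preferred (there is one if and only if `L` is finite), and in general it is some
truncation that works for the given weights `S`. -/
noncomputable def window (L S : Set Weight) (line : Set ℤ) : Set ℤ :=
  if line.Finite then line
  else if h : ∃ J, IsWindow L J then h.choose
  else if h : ∃ J, IsWindow S J then h.choose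
  else ∅

/-- The oriented circle diagrams with weight in the block `L`. The triple stands for the diagram
consisting of the cup diagram of `left`, the weight `mid`, and the cap diagram of `right`. -/
@[ext]
structure CircleDiagram (L : Set Weight) where
  left : Weight
  mid : Weight
  right : Weight
  left_mem : left ∈ L
  mid_mem : mid ∈ L
  right_mem : right ∈ L
  left_sub : left.Sub mid
  right_sub : right.Sub mid

/-- The mirror image in the number line. -/
def CircleDiagram.mirror {L : Set Weight} (s : CircleDiagram L) : CircleDiagram L :=
  ⟨s.right, s.mid, s.left, s.right_mem, s.mid_mem, s.left_mem, s.right_sub, s.left_sub⟩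

/-- The vector space with basis the oriented circle diagrams with weight in `L`. -/
def KAlg (k : Type*) [Field k] (L : Set Weight) : Type _ := CircleDiagram L →₀ k

noncomputable instance (k : Type*) [Field k] (L : Set Weight) : AddCommGroup (KAlg k L) :=
  inferInstanceAs (AddCommGroup (CircleDiagram L →₀ k))

noncomputable instance (k : Type*) [Field k] (L : Set Weight) : Module k (KAlg k L) :=
  inferInstanceAs (Module k (CircleDiagram L →₀ k))

/-- The basis vector given by an oriented circle diagram. -/
noncomputable def basisVec (k : Type*) [Field k] {L : Set Weight} (s : CircleDiagram L) :
    KAlg k L := Finsupp.single s (1 : k)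

open Classical in
/-- The coefficient of the diagram `u` in the product of `s` and `t`, where the right end of `s`
is the mirror image of the left end of `t`, and where `u` has the left end of `s` and the right
end of `t`: truncate, close, and multiply the resulting closed diagrams. All closed diagrams in
the latter product whose weight is not the closure of a weight are discarded. -/
noncomputable def structureCoeff (k : Type*) [Field k] {L : Set Weight}
    (s t u : CircleDiagram L) : k :=
  let S : Set Weight := {s.left, s.mid, s.right, t.mid, t.right}
  let J : Set ℤ := window L S s.mid.line
  if IsWindow (insert u.mid S) J then
    closedCoeff k (closureOn J s.left.lab) (closureOn J s.right.lab) (closureOn J t.right.lab)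
      (closureOn J s.mid.lab) (closureOn J t.mid.lab) (closureOn J u.mid.lab)
  else 0

open Classical in
/-- The product of two basis vectors. -/
noncomputable def mulBasis (k : Type*) [Field k] {L : Set Weight} (s t : CircleDiagram L) :
    KAlg k L :=
  if s.right = t.left then
    ∑ᶠ u ∈ {u : CircleDiagram L | u.left = s.left ∧ u.right = t.right},
      structureCoeff k s t u • basisVec k u
  else 0

/-- The bilinear extension of the product of basis vectors. -/
noncomputable def mulMap (k : Type*) [Field k] (L : Set Weight) :
    KAlg k L →ₗ[k] KAlg k L →ₗ[k] KAlg k L :=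
  Finsupp.lift (KAlg k L →ₗ[k] KAlg k L) k (CircleDiagram L) fun s =>
    Finsupp.lift (KAlg k L) k (CircleDiagram L) fun t => mulBasis k s t

noncomputable instance (k : Type*) [Field k] (L : Set Weight) :
    NonUnitalNonAssocRing (KAlg k L) where
  mul x y := mulMap k L x y
  left_distrib x y z := (mulMap k L x).map_add y z
  right_distrib x y z := by
    change mulMap k L (x + y) z = mulMap k L x z + mulMap k L y z
    rw [map_add, LinearMap.add_apply]
  zero_mul x := by
    change mulMap k L 0 x = 0
    rw [map_zero, LinearMap.zero_apply]
  mul_zero x := (mulMap k L x).map_zero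

/-- The linear map sending every diagram to its mirror image. -/
noncomputable def starMap (k : Type*) [Field k] (L : Set Weight) : KAlg k L →ₗ[k] KAlg k L :=
  Finsupp.lmapDomain k k CircleDiagram.mirror

/-! ## The generalised Khovanov algebra -/

/-- The vector `e_α`, given by the diagram consisting of the cup diagram of `α`, the weight `α`
and the cap diagram of `α`. -/
noncomputable def idem (k : Type*) [Field k] {L : Set Weight} (α : Weight) (hα : α ∈ L) :
    KAlg k L :=
  basisVec k ⟨α, α, α, hα, hα, hα, α.sub_refl, α.sub_refl⟩

/-- The generalised Khovanov algebra of the block `L`, as a subspace of `KAlg k L`: the sum of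
the subspaces `e_α K e_β` for all `α`, `β` of maximal defect. -/
noncomputable def khovanovAlg (k : Type*) [Field k] (L : Set Weight) : Submodule k (KAlg k L) :=
  ⨆ (α : maxDefect L) (β : maxDefect L),
    Submodule.span k (Set.range fun x : KAlg k L =>
      idem k α.1 α.2.1 * x * idem k β.1 β.2.1)

/-- The set `M(λ)`: the weights `α` of maximal defect with `α ⊂ λ`. -/
def CellIndex (L : Set Weight) (lam : L) : Type :=
  {α : Weight // α ∈ maxDefect L ∧ α.Sub lam.1}

/-- The vector `C^λ_{α,β}`, given by the diagram consisting of the cup diagram of `α`, the weight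
`λ` and the cap diagram of `β`. -/
noncomputable def cellVec (k : Type*) [Field k] (L : Set Weight) (lam : L)
    (α β : CellIndex L lam) : KAlg k L :=
  basisVec k ⟨α.1, lam.1, β.1, α.2.1.1, lam.2, β.2.1.1, α.2.2, β.2.2⟩

/-! ## Cellular algebras -/

/-- The algebra `H` over the field `k` (a vector space with a distributive multiplication) is an
associative unital `k`-algebra, and it is cellular in the sense of Graham and Lehrer with cell
datum consisting of the set `Λ` with the relation `le`, the sets `M lam`, the map `C` and the map
`star`. -/
structure IsCellularAlgebra (k : Type*) [Field k] (H : Type*) [NonUnitalNonAssocRing H]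
    [Module k H] {Λ : Type*} (le : Λ → Λ → Prop) (M : Λ → Type*)
    (C : ∀ lam, M lam → M lam → H) (star : H → H) : Prop where
  mul_assoc : ∀ x y z : H, x * y * z = x * (y * z)
  smul_mul : ∀ (c : k) (x y : H), (c • x) * y = c • (x * y)
  mul_smul : ∀ (c : k) (x y : H), x * (c • y) = c • (x * y)
  unital : ∃ e : H, ∀ x : H, e * x = x ∧ x * e = x
  le_refl : ∀ lam, le lam lam
  le_trans : ∀ lam mu nu, le lam mu → le mu nu → le lam nu
  le_antisymm : ∀ lam mu, le lam mu → le mu lam → lam = mu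
  finite : ∀ lam, Finite (M lam)
  injective : Function.Injective fun t : (Σ lam, M lam × M lam) => C t.1 t.2.1 t.2.2
  linearIndependent : LinearIndependent k fun t : (Σ lam, M lam × M lam) => C t.1 t.2.1 t.2.2
  span_eq_top : Submodule.span k
    (Set.range fun t : (Σ lam, M lam × M lam) => C t.1 t.2.1 t.2.2) = ⊤
  star_add : ∀ x y : H, star (x + y) = star x + star y
  star_smul : ∀ (c : k) (x : H), star (c • x) = c • star x
  star_mul : ∀ x y : H, star (x * y) = star y * star x
  star_bijective : Function.Bijective star
  star_C : ∀ lam (α β : M lam), star (C lam α β) = C lam β α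
  mul_C : ∀ (x : H) (mu : Λ), ∃ r : M mu → M mu → k, ∀ γ δ : M mu,
    x * C mu γ δ - ∑ᶠ γ' : M mu, r γ' γ • C mu γ' δ ∈
      Submodule.span k {y | ∃ nu, le mu nu ∧ mu ≠ nu ∧ ∃ γ'' δ'' : M nu, y = C nu γ'' δ''}

end ArcAlgebra

namespace ArcAlgebra

/-! ## Combinatorics of cups -/

/-! The product comes from a two-dimensional field theory. Attach to a collection of circles, given
as the classes of an equivalence relation on vertices, the quotient of a polynomial ring by
`circleIdeal`: one generator of square zero for each circle. A consistent orientation becomes the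
squarefree monomial in its clockwise circles, and for a fixed circle diagram these monomials are
linearly independent modulo the ideal (`lineMonomial_independent`). The merge and split rules then
say exactly that a surgery is multiplication by one element, `surgeryFactor`: it is `1` for a merge
and the sum of the generators of the two new circles for a split (`exists_surgeryStep_sum`). Hence a
product of closed diagrams is the product of their monomials times an element `gluing` that depends
only on the three cup diagrams (`sum_closedCoeff`). Associativity reduces to an identity between
such elements (`gluing_assoc`), which holds because surgeries in two different middle sections of a
diagram with three lines can be interchanged (`surgeryFactor_comm`, `cutProduct_comm`). Units and
the mirror anti-automorphism reduce to `gluing_self` and `gluing_comm`.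

Planarity enters only through parity. The vertices under a cup are matched among themselves, so a
union of circles meets the inside of a cup evenly wherever the cups inside belong to the diagram.
This gives a two-colouring of the graph of arcs, from which every surgery either merges or splits
(`invConn_dichotomy`), and it makes the alternating labelling `stdLabel` the orientation in which
all circles are anti-clockwise.

Triangularity is measured by prefix sums, the number of `down`'s minus the number of `up`'s to the
left of a point. A surgery never raises a prefix sum (`prefixSum_step_le`), and comparing prefix
sums is the Bruhat order (`IsFrame.bruhatLE_iff`). So the weights in a product are at least those of
both factors. The same estimate makes the discarding of terms harmless: a labelling that fits the
cup diagram of a closure and whose prefix sums dominate those of a closure is itself a closure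
(`IsFrame.exists_padded_eq`), so a discarded intermediate term never contributes to a term that is
kept, and associativity passes from closed diagrams to the block.

For cellularity, orienting a middle section `b` by `b` itself is preserved by every surgery, so the
product of the half diagrams (γ μ μ) and (μ μ δ) is (γ μ δ) with coefficient `1`, plus terms of
bigger weight (`half_mul_half`). Left multiplication acts on the first half alone, so its matrix
does not involve δ (`mul_cellVec`). -/

theorem excess_succ (f : Labelling) {i m : ℤ} (h : i ≤ m) :
    excess f i (m + 1) = excess f i m +
      if f (m + 1) = Label.down then 1 else if f (m + 1) = Label.up then -1 else 0 := by
  rw [excess_add f h (by omega : m ≤ m + 1)]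
  have := excess_pred f (m + 1)
  rw [show m + 1 - 1 = m by ring] at this
  rw [this]

theorem excess_last (f : Labelling) {i m : ℤ} (h : i < m) :
    excess f i m = excess f i (m - 1) +
      if f m = Label.down then 1 else if f m = Label.up then -1 else 0 := by
  have := excess_succ f (show i ≤ m - 1 by omega)
  rwa [show m - 1 + 1 = m by ring] at this

theorem excess_congr {f g : Labelling} {i m : ℤ} (h : ∀ x, i < x → x ≤ m → f x = g x) :
    excess f i m = excess g i m := by
  unfold excess
  congr 3 <;>
  · refine Finset.filter_congr fun x hx => ?_
    rw [Finset.mem_Ioc] at hx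
    rw [h x hx.1 hx.2]

theorem IsCup.congr {f g : Labelling} {i j : ℤ} (h : ∀ x, i ≤ x → x ≤ j → f x = g x)
    (hc : IsCup f i j) : IsCup g i j := by
  obtain ⟨h1, h2, h3, h4, h5⟩ := hc
  refine ⟨h1, (h i le_rfl h1.le) ▸ h2, (h j h1.le le_rfl) ▸ h3, fun m hm hm' => ?_, ?_⟩
  · rw [← excess_congr (f := f) fun x hx hx' => h x hx.le (by omega)]
    exact h4 m hm hm'
  · rw [← excess_congr (f := f) fun x hx hx' => h x hx.le (by omega)]
    exact h5

theorem IsCup.excess_eq {f : Labelling} {i j : ℤ} (h : IsCup f i j) : excess f i j = -1 := by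
  rw [excess_last f h.1, h.2.2.2.2, h.2.2.1]
  simp

theorem IsCup.right_unique {f : Labelling} {i j j' : ℤ} (h : IsCup f i j) (h' : IsCup f i j') :
    j = j' := by
  rcases lt_trichotomy j j' with hl | hl | hl
  · have := h'.2.2.2.1 j h.1.le hl
    rw [h.excess_eq] at this
    omega
  · exact hl
  · have := h.2.2.2.1 j' h'.1.le hl
    rw [h'.excess_eq] at this
    omega

/-- Cups do not cross. On reaching `i'` the outer excess is at least one, and it stays so up to the
end of the inner cup, whereas it has to vanish just before `j`. The case `j' = j` is excluded as
well, which is what gives `left_unique`. -/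
theorem IsCup.right_lt_right {f : Labelling} {i j i' j' : ℤ} (h : IsCup f i j)
    (h' : IsCup f i' j') (h1 : i < i') (h2 : i' < j) : j' < j := by
  by_contra hj
  have e1 := excess_last f h1
  rw [h'.2.1, if_pos rfl] at e1
  have e2 := h.2.2.2.1 (i' - 1) (by omega) (by omega)
  rcases (not_lt.mp hj).eq_or_lt with he | hl
  · subst he
    have e3 := excess_add f h1.le (show i' ≤ j - 1 by omega)
    rw [h.2.2.2.2, h'.2.2.2.2] at e3
    omega
  · have e3 := excess_add f h1.le h2.le
    rw [h.excess_eq] at e3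
    have := h'.2.2.2.1 j h2.le hl
    omega

theorem IsCup.left_unique {f : Labelling} {i i' j : ℤ} (h : IsCup f i j) (h' : IsCup f i' j) :
    i = i' := by
  rcases lt_trichotomy i i' with hl | hl | hl
  · exact absurd (h.right_lt_right h' hl h'.1) (lt_irrefl _)
  · exact hl
  · exact absurd (h'.right_lt_right h hl h.1) (lt_irrefl _)

theorem IsCup.not_cup_left {f : Labelling} {i j k : ℤ} (h : IsCup f i j) : ¬ IsCup f j k := by
  intro h'
  have := h.2.2.1.symm.trans h'.2.1
  cases this

/-- The excess changes by at most one at each vertex. The first vertex at which it became negative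
would be an `up` reached with excess zero, that is, the right end of a cup starting at `i`. -/
theorem excess_nonneg_of_unmatched {f : Labelling} {i : ℤ} (hd : f i = Label.down)
    (hi : ¬ ∃ j, IsCup f i j) : ∀ m, i ≤ m → 0 ≤ excess f i m := by
  have h1 : ∀ n : ℕ, ∀ m, i ≤ m → m ≤ i + n → 0 ≤ excess f i m := by
    intro n
    induction n with
    | zero =>
      intro m h h'
      have : m = i := by simp only [Nat.cast_zero] at h'; omega
      rw [this, excess_self]
    | succ n ih =>
      intro m h h'
      push_cast at h'
      rcases lt_or_ge (i + n : ℤ) m with hm | hm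
      · have hstep := excess_last f (show i < m by omega)
        have hprev := ih (m - 1) (by omega) (by omega)
        by_contra hneg
        have hup : f m = Label.up := by
          by_contra hne
          rw [if_neg hne] at hstep
          split_ifs at hstep <;> omega
        rw [hup] at hstep
        simp only [reduceCtorEq, if_false, if_true] at hstep
        exact hi ⟨m, by omega, hd, hup, fun m' h1 h2 => ih m' h1 (by omega), by omega⟩
      · exact ih m h hm
  exact fun m h => h1 (m - i).toNat m h (by omega)

/-- The mirror image of `excess_nonneg_of_unmatched`: going left from `j - 1`, the first place where
the excess became positive would be the left end of a cup ending at `j`. -/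
theorem excess_nonpos_of_unmatched {f : Labelling} {j : ℤ} (hu : f j = Label.up)
    (hj : ¬ ∃ i, IsCup f i j) : ∀ l, l ≤ j - 1 → excess f l (j - 1) ≤ 0 := by
  have h2 : ∀ n : ℕ, ∀ l, l ≤ j - 1 → j - 1 - n ≤ l → excess f l (j - 1) ≤ 0 := by
    intro n
    induction n with
    | zero =>
      intro l h h'
      have : l = j - 1 := by simp only [Nat.cast_zero] at h'; omega
      rw [this, excess_self]
    | succ n ih =>
      intro l h h'
      push_cast at h'
      rcases lt_or_ge l (j - 1 - n : ℤ) with hl | hl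
      · have hstep := excess_add f (i := l) (l := l + 1) (m := j - 1) (by omega) (by omega)
        have hp := excess_pred f (l + 1)
        rw [show l + 1 - 1 = l by ring] at hp
        rw [hp] at hstep
        have hprev := ih (l + 1) (by omega) (by omega)
        by_contra hpos
        have hdown : f (l + 1) = Label.down := by
          by_contra hne
          rw [if_neg hne] at hstep
          split_ifs at hstep <;> omega
        rw [if_pos hdown] at hstep
        refine hj ⟨l + 1, by omega, hdown, hu, ?_, by omega⟩
        intro m h1 h2
        have ha := excess_add f (i := l + 1) (l := m) (m := j - 1) h1 (by omega)
        have hb := ih m (by omega) (by omega)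
        omega
      · exact ih l h hl
  exact fun l h => h2 (j - 1 - l).toNat l h (by omega)

/-- The labelling `f` has arrows exactly on the finite set `A`, and all of them are joined by
cups: its cup diagram has no rays. -/
structure ClosedOn (A : Finset ℤ) (f : Labelling) : Prop where
  arrow : ∀ i, (f i).IsArrow ↔ i ∈ A
  matched : ∀ i ∈ A, ∃ j, IsCup f i j ∨ IsCup f j i

open Classical in
/-- The other end of the cup at a vertex. -/
noncomputable def mate (f : Labelling) (i : ℤ) : ℤ :=
  if h : ∃ j, IsCup f i j ∨ IsCup f j i then h.choose else i

theorem IsCup.mate_left {f : Labelling} {i j : ℤ} (h : IsCup f i j) : mate f i = j := by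
  have hex : ∃ j, IsCup f i j ∨ IsCup f j i := ⟨j, Or.inl h⟩
  rw [mate, dif_pos hex]
  rcases hex.choose_spec with h' | h'
  · exact h'.right_unique h
  · exact absurd h h'.not_cup_left

theorem IsCup.mate_right {f : Labelling} {i j : ℤ} (h : IsCup f i j) : mate f j = i := by
  have hex : ∃ k, IsCup f j k ∨ IsCup f k j := ⟨i, Or.inr h⟩
  rw [mate, dif_pos hex]
  rcases hex.choose_spec with h' | h'
  · exact absurd h' h.not_cup_left
  · exact h'.left_unique h

theorem mate_of_unmatched {f : Labelling} {i : ℤ} (h : ¬ ∃ j, IsCup f i j ∨ IsCup f j i) :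
    mate f i = i := dif_neg h

theorem cup_mate {f : Labelling} {i : ℤ} (h : ∃ j, IsCup f i j ∨ IsCup f j i) :
    IsCup f i (mate f i) ∨ IsCup f (mate f i) i := by
  rw [mate, dif_pos h]
  exact h.choose_spec

theorem mate_mate (f : Labelling) (i : ℤ) : mate f (mate f i) = i := by
  by_cases h : ∃ j, IsCup f i j ∨ IsCup f j i
  · rcases cup_mate h with h' | h'
    · exact h'.mate_right
    · exact h'.mate_left
  · rw [mate_of_unmatched h, mate_of_unmatched h]

theorem IsCup.isArrow_left {f : Labelling} {i j : ℤ} (h : IsCup f i j) : (f i).IsArrow :=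
  Or.inl h.2.1

theorem IsCup.isArrow_right {f : Labelling} {i j : ℤ} (h : IsCup f i j) : (f j).IsArrow :=
  Or.inr h.2.2.1

/-! ### Cup diagrams without rays: nesting and parity. -/

namespace ClosedOn

variable {A : Finset ℤ} {f : Labelling}

theorem left_mem (hf : ClosedOn A f) {i j : ℤ} (h : IsCup f i j) : i ∈ A :=
  (hf.arrow i).1 h.isArrow_left

theorem right_mem (hf : ClosedOn A f) {i j : ℤ} (h : IsCup f i j) : j ∈ A :=
  (hf.arrow j).1 h.isArrow_right

theorem cup_mate (hf : ClosedOn A f) {i : ℤ} (h : i ∈ A) :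
    IsCup f i (mate f i) ∨ IsCup f (mate f i) i := ArcAlgebra.cup_mate (hf.matched i h)

theorem mate_mem (hf : ClosedOn A f) {i : ℤ} (h : i ∈ A) : mate f i ∈ A := by
  rcases hf.cup_mate h with h' | h'
  · exact hf.right_mem h'
  · exact hf.left_mem h'

theorem mate_of_not_mem (hf : ClosedOn A f) {i : ℤ} (h : i ∉ A) : mate f i = i :=
  mate_of_unmatched fun ⟨_, hj⟩ => h <| hj.elim hf.left_mem hf.right_mem

theorem mate_ne (hf : ClosedOn A f) {i : ℤ} (h : i ∈ A) : mate f i ≠ i := by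
  intro he
  rcases hf.cup_mate h with h' | h' <;>
  · have := h'.1
    omega

/-- Vertices under a cup are joined among themselves. -/
theorem mate_mem_Ioo (hf : ClosedOn A f) {i j x : ℤ} (h : IsCup f i j) (hx : x ∈ A)
    (h1 : i < x) (h2 : x < j) : i < mate f x ∧ mate f x < j := by
  rcases hf.cup_mate hx with h' | h'
  · have := h.right_lt_right h' h1 h2
    have := h'.1
    omega
  · have h3 := h'.1
    refine ⟨?_, by omega⟩
    by_contra h4
    rcases (not_lt.mp h4).eq_or_lt with h5 | h5
    · rw [h5] at h'
      have := h.right_unique h'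
      omega
    · have := h'.right_lt_right h h5 h1
      omega

/-- The matching is an involution without fixed points, so the sum of ones over the set cancels in
pairs in `ZMod 2`. -/
theorem even_card (hf : ClosedOn A f) {S : Finset ℤ} (hS : ∀ x ∈ S, x ∈ A ∧ mate f x ∈ S) :
    Even S.card := by
  have h : ∑ _x ∈ S, (1 : ZMod 2) = 0 :=
    Finset.sum_involution (fun x _ => mate f x) (fun _ _ => by decide)
      (fun x hx _ => hf.mate_ne (hS x hx).1) (fun x hx => (hS x hx).2)
      (fun x _ => mate_mate f x)
  rw [Finset.sum_const, nsmul_one] at h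
  exact (ZMod.natCast_eq_zero_iff_even).1 h

/-- A set of vertices closed under the matching meets the inside of a cup evenly. -/
theorem even_inside (hf : ClosedOn A f) {C : ℤ → Prop} [DecidablePred C] {i j : ℤ}
    (h : IsCup f i j) (hC : ∀ x ∈ A, i < x → x < j → C x → C (mate f x)) :
    Even (A.filter fun x => (i < x ∧ x < j) ∧ C x).card := by
  refine hf.even_card fun x hx => ?_
  simp only [Finset.mem_filter] at hx ⊢
  exact ⟨hx.1, hf.mate_mem hx.1, hf.mate_mem_Ioo h hx.1 hx.2.1.1 hx.2.1.2,
    hC x hx.1 hx.2.1.1 hx.2.1.2 hx.2.2⟩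

end ClosedOn


/-! ## Surgeries of equivalence relations -/

/-- The equivalence relation generated by `r` and the pair `(x, y)`. -/
def JoinRel {W : Type*} (r : W → W → Prop) (x y u v : W) : Prop :=
  r u v ∨ (r u x ∧ r v y) ∨ (r u y ∧ r v x)

/-- `r'` arises from `r` by either merging the distinct classes of `x` and `y`, or by splitting
the common class of `x` and `y` into two classes that contain `x` and `y`, respectively. -/
structure IsSurgery {W : Type*} (r r' : W → W → Prop) (x y : W) : Prop where
  equiv : Equivalence r
  equiv' : Equivalence r'
  join : ∀ u v, JoinRel r x y u v ↔ JoinRel r' x y u v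
  dichotomy : r x y ↔ ¬ r' x y

theorem joinRel_of_rel {W : Type*} {r : W → W → Prop} (hr : Equivalence r) {x y : W}
    (h : r x y) (u v : W) : JoinRel r x y u v ↔ r u v := by
  refine ⟨?_, Or.inl⟩
  rintro (h1 | ⟨h1, h2⟩ | ⟨h1, h2⟩)
  · exact h1
  · exact hr.trans h1 (hr.trans h (hr.symm h2))
  · exact hr.trans h1 (hr.trans (hr.symm h) (hr.symm h2))

namespace IsSurgery

variable {W : Type*} {r r' : W → W → Prop} {x y : W}

/-- Once `x` and `y` are joined the two relations coincide, and the dichotomy says that exactly one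
of them relates `x` and `y` already. That one is therefore the join of the other; `split` is the
opposite case. -/
theorem merge (h : IsSurgery r r' x y) (hxy : ¬ r x y) (u v : W) :
    r' u v ↔ JoinRel r x y u v := by
  have : r' x y := by
    by_contra h'
    exact hxy (h.dichotomy.2 h')
  rw [h.join, joinRel_of_rel h.equiv' this]

theorem split (h : IsSurgery r r' x y) (hxy : r x y) (u v : W) :
    r u v ↔ JoinRel r' x y u v := by
  rw [← h.join, joinRel_of_rel h.equiv hxy]

theorem le_of_merge (h : IsSurgery r r' x y) (hxy : ¬ r x y) {u v : W} (huv : r u v) : r' u v :=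
  (h.merge hxy u v).2 (Or.inl huv)

theorem le_of_split (h : IsSurgery r r' x y) (hxy : r x y) {u v : W} (huv : r' u v) : r u v :=
  (h.split hxy u v).2 (Or.inl huv)

end IsSurgery

/-! ### Components of a union of two matchings. -/

section Involutions

variable {W : Type*}

/-- The components of the graph given by two involutions. -/
def InvConn (σ τ : W → W) : W → W → Prop :=
  Relation.EqvGen fun u v => v = σ u ∨ v = τ u

/-- Walking alternately along `σ` and `τ` goes around the whole component of `p`. The points of the
colour of `p` on this cycle are exactly the iterates of `τ ∘ σ`, so a point of that colour that is
not an iterate lies elsewhere. -/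
theorem not_invConn_of_cycle {σ τ : W → W} (hσ : Function.Involutive σ)
    (hτ : Function.Involutive τ) {S : Set W} {χ : W → Bool}
    (hσS : ∀ v ∈ S, σ v ∈ S ∧ χ (σ v) = !χ v) (hτS : ∀ v ∈ S, τ v ∈ S ∧ χ (τ v) = !χ v)
    {p q : W} (hp : p ∈ S) (hpq : χ q = χ p) {n : ℕ} (hn : 0 < n)
    (hper : (τ ∘ σ)^[n] p = p) (hne : ∀ m < n, (τ ∘ σ)^[m] p ≠ q) : ¬ InvConn σ τ p q := by
  set f := τ ∘ σ with hf
  have hmod : ∀ m, f^[m] p ≠ q := by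
    intro m
    have : f^[m % n] p = f^[m] p := Function.IsPeriodicPt.iterate_mod_apply hper m
    rw [← this]
    exact hne _ (Nat.mod_lt _ hn)
  have hS : ∀ m, f^[m] p ∈ S ∧ χ (f^[m] p) = χ p := by
    intro m
    induction m with
    | zero => exact ⟨hp, rfl⟩
    | succ m ih =>
      rw [Function.iterate_succ_apply']
      have h1 := hσS _ ih.1
      have h2 := hτS _ h1.1
      refine ⟨h2.1, ?_⟩
      rw [hf, Function.comp_apply, h2.2, h1.2, Bool.not_not]
      exact ih.2
  let K : W → Prop := fun v => ∃ m, v = f^[m] p ∨ v = σ (f^[m] p)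
  have hKσ : ∀ v, K v → K (σ v) := by
    rintro v ⟨m, rfl | rfl⟩
    · exact ⟨m, Or.inr rfl⟩
    · exact ⟨m, Or.inl (hσ _)⟩
  have hKτ : ∀ v, K v → K (τ v) := by
    rintro v ⟨m, rfl | rfl⟩
    -- Stepping backwards along `τ` uses the period: the predecessor of the iterate `m` is the
    -- iterate `m + n - 1`.
    · obtain ⟨l, rfl⟩ : ∃ l, n = l + 1 := ⟨n - 1, by omega⟩
      refine ⟨m + l, Or.inr ?_⟩
      have : f^[m] p = τ (σ (f^[m + l] p)) := by
        have h1 : f^[m + (l + 1)] p = f^[m] p := by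
          rw [Function.iterate_add_apply, hper]
        rw [← h1, ← add_assoc, Function.iterate_succ_apply']
        rfl
      rw [this, hτ]
    · exact ⟨m + 1, Or.inl (Function.iterate_succ_apply' f m p).symm⟩
  have key : ∀ u v, InvConn σ τ u v → (K u ↔ K v) := by
    intro u v huv
    induction huv with
    | rel u v h =>
      rcases h with rfl | rfl
      · exact ⟨hKσ u, fun h => hσ u ▸ hKσ _ h⟩
      · exact ⟨hKτ u, fun h => hτ u ▸ hKτ _ h⟩
    | refl => exact Iff.rfl
    | symm _ _ _ ih => exact ih.symm
    | trans _ _ _ _ _ ih1 ih2 => exact ih1.trans ih2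
  intro hc
  obtain ⟨m, h | h⟩ := (key p q hc).1 ⟨0, Or.inl rfl⟩
  · exact hmod m h.symm
  -- The second half of `K` has the opposite colour, so it cannot contain `q`.
  · have := (hσS _ (hS m).1).2
    rw [← h, (hS m).2, hpq] at this
    cases hh : χ p <;> simp [hh] at this

/-- In a two-coloured graph which is the union of two matchings, replacing the edges `p p'` and
`q q'` by `p q` and `p' q'` disconnects `p` and `q'` if and only if they were connected. -/
theorem invConn_dichotomy {σ τ τ' : W → W} (hσ : Function.Involutive σ)
    (hτ : Function.Involutive τ) (hτ' : Function.Involutive τ') {S : Set W} (hSf : S.Finite)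
    {χ : W → Bool}
    (hσS : ∀ v ∈ S, σ v ∈ S ∧ χ (σ v) = !χ v) (hτS : ∀ v ∈ S, τ v ∈ S ∧ χ (τ v) = !χ v)
    (hτS' : ∀ v ∈ S, τ' v ∈ S ∧ χ (τ' v) = !χ v) {p p' q q' : W} (hp : p ∈ S)
    (hpq : p ≠ q') (h1 : τ p = p') (h2 : τ q = q') (h3 : τ' p = q) (h4 : τ' p' = q')
    (hχ : χ q' = χ p)
    (hoff : ∀ v, v ≠ p → v ≠ p' → v ≠ q → v ≠ q' → τ' v = τ v) :
    InvConn σ τ p q' ↔ ¬ InvConn σ τ' p q' := by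
  set f := τ ∘ σ with hf
  set f' := τ' ∘ σ with hf'
  have hS : ∀ m, f^[m] p ∈ S ∧ χ (f^[m] p) = χ p := by
    intro m
    induction m with
    | zero => exact ⟨hp, rfl⟩
    | succ m ih =>
      rw [Function.iterate_succ_apply']
      have h1 := hσS _ ih.1
      have h2 := hτS _ h1.1
      refine ⟨h2.1, ?_⟩
      rw [hf, Function.comp_apply, h2.2, h1.2, Bool.not_not]
      exact ih.2
  have hinj : Function.Injective f := hτ.injective.comp hσ.injective
  -- Since `S` is finite and `f` is injective, the walk from `p` comes back to `p`. It is followed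
  -- up to the first return to `p` or the first visit to `q'`, whichever happens earlier.
  have hex : ∃ n, 0 < n ∧ (f^[n] p = p ∨ f^[n] p = q') := by
    obtain ⟨a, -, b, -, hab, he⟩ := Set.infinite_univ.exists_ne_map_eq_of_mapsTo
      (f := fun m : ℕ => f^[m] p) (fun m _ => (hS m).1) hSf
    have hgen : ∀ a b : ℕ, a < b → f^[a] p = f^[b] p → f^[b - a] p = p := by
      intro a b hlt he
      have : f^[a] (f^[b - a] p) = f^[a] p := by
        rw [← Function.iterate_add_apply, he]
        congr 2
        omega
      exact hinj.iterate a this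
    rcases lt_or_gt_of_ne hab with hl | hl
    · exact ⟨b - a, by omega, Or.inl (hgen a b hl he)⟩
    · exact ⟨a - b, by omega, Or.inl (hgen b a hl he.symm)⟩
  classical
  obtain ⟨hn, hfn⟩ := Nat.find_spec hex
  set n := Nat.find hex with hndef
  have hmin : ∀ m < n, 0 < m → f^[m] p ≠ p ∧ f^[m] p ≠ q' := by
    intro m hm hm0
    have := Nat.find_min hex hm
    push Not at this
    exact this hm0
  have hflip : ∀ b : Bool, b = !b → False := by decide
  -- Until the walk stops it does not use the exceptional edges: colours forbid that `σ` leads to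
  -- `p` or `q'`, while from `p'` or `q` the next point would be `p` or `q'`. So both walks agree up
  -- to there.
  have hstep : ∀ m, f (f^[m] p) ≠ p → f (f^[m] p) ≠ q' → f' (f^[m] p) = f (f^[m] p) := by
    intro m h5 h6
    have hc : χ (σ (f^[m] p)) = !χ p := by rw [(hσS _ (hS m).1).2, (hS m).2]
    refine hoff _ ?_ ?_ ?_ ?_
    · intro h
      rw [h] at hc
      exact hflip _ hc
    · intro h
      refine h5 ?_
      change τ (σ _) = p
      rw [h, ← h1, hτ]
    · intro h
      refine h6 ?_
      change τ (σ _) = q'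
      rw [h, h2]
    · intro h
      rw [h, hχ] at hc
      exact hflip _ hc
  have hit : ∀ m < n, f'^[m] p = f^[m] p := by
    intro m
    induction m with
    | zero => exact fun _ => rfl
    | succ m ih =>
      intro hm
      rw [Function.iterate_succ_apply', ih (by omega), Function.iterate_succ_apply']
      have := hmin (m + 1) hm (by omega)
      rw [Function.iterate_succ_apply'] at this
      exact hstep m this.1 this.2
  have hne : ∀ m < n, f^[m] p ≠ q' := by
    intro m hm
    rcases Nat.eq_zero_or_pos m with rfl | h0
    · exact hpq
    · exact (hmin m hm h0).2
  have conn_iter : ∀ (ρ : W → W) (m : ℕ), InvConn σ ρ p ((ρ ∘ σ)^[m] p) := by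
    intro ρ m
    induction m with
    | zero => exact Relation.EqvGen.refl _
    | succ m ih =>
      rw [Function.iterate_succ_apply']
      have h5 : InvConn σ ρ ((ρ ∘ σ)^[m] p) (σ ((ρ ∘ σ)^[m] p)) :=
        Relation.EqvGen.rel _ _ (Or.inl rfl)
      have h6 : InvConn σ ρ (σ ((ρ ∘ σ)^[m] p)) (ρ (σ ((ρ ∘ σ)^[m] p))) :=
        Relation.EqvGen.rel _ _ (Or.inr rfl)
      exact ih.trans _ _ _ (h5.trans _ _ _ h6)
  obtain ⟨l, hl⟩ : ∃ l, n = l + 1 := ⟨n - 1, by omega⟩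
  have hf1 : f^[n] p = τ (σ (f^[l] p)) := by rw [hl, Function.iterate_succ_apply']; rfl
  have hf2 : f'^[n] p = τ' (σ (f^[l] p)) := by
    rw [hl, Function.iterate_succ_apply', hit l (by omega)]; rfl
  -- If the old walk returns to `p`, its last edge is `p' p`, and the new walk goes from `p'` to
  -- `q'` instead. If the old walk reaches `q'`, its last edge is `q q'`, and the new walk closes up
  -- from `q` to `p` without having met `q'`.
  rcases hfn with hfn | hfn
  · have ha : ¬ InvConn σ τ p q' := not_invConn_of_cycle hσ hτ hσS hτS hp hχ hn hfn hne
    have hb : InvConn σ τ' p q' := by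
      have := conn_iter τ' n
      rw [← hf', hf2] at this
      rw [hfn] at hf1
      have h5 : σ (f^[l] p) = p' := by rw [← h1, hf1, hτ, ← hf1]
      rwa [h5, h4] at this
    exact ⟨fun h => absurd h ha, fun h => absurd hb h⟩
  · have hb : InvConn σ τ p q' := by
      have := conn_iter τ n
      rwa [← hf, hfn] at this
    have ha : ¬ InvConn σ τ' p q' := by
      refine not_invConn_of_cycle hσ hτ' hσS hτS' hp hχ hn ?_ fun m hm => ?_
      · rw [hfn] at hf1
        have h5 : σ (f^[l] p) = q := by rw [← hτ (σ (f^[l] p)), ← hf1, ← h2, hτ]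
        rw [← hf', hf2, h5, ← h3, hτ']
      · rw [← hf', hit m hm]
        exact hne m hm
    exact ⟨fun _ => ha, fun _ => hb⟩

end Involutions

/-! ## The rings attached to collections of circles -/

section CircleRing

variable (k : Type*) [Field k] {W : Type*}

/-- The ideal of relations of the ring with one generator of square zero for every class of the
relation `r`. -/
noncomputable def circleIdeal (r : W → W → Prop) : Ideal (MvPolynomial W k) :=
  Ideal.span {g | (∃ u, g = MvPolynomial.X u ^ 2) ∨
    ∃ u v, r u v ∧ g = MvPolynomial.X u - MvPolynomial.X v}

open Classical in
/-- The image of `1` under the linear map attached to a surgery. -/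
noncomputable def surgeryFactor (r : W → W → Prop) (x y : W) : MvPolynomial W k :=
  if r x y then MvPolynomial.X x + MvPolynomial.X y else 1

variable {k}

theorem sq_mem_circleIdeal (r : W → W → Prop) (u : W) :
    (MvPolynomial.X u ^ 2 : MvPolynomial W k) ∈ circleIdeal k r :=
  Ideal.subset_span (Or.inl ⟨u, rfl⟩)

theorem sub_mem_circleIdeal {r : W → W → Prop} {u v : W} (h : r u v) :
    (MvPolynomial.X u - MvPolynomial.X v : MvPolynomial W k) ∈ circleIdeal k r :=
  Ideal.subset_span (Or.inr ⟨u, v, h, rfl⟩)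

theorem map_circleIdeal {W' : Type*} {r : W → W → Prop} {r' : W' → W' → Prop} (φ : W → W')
    (h : ∀ u v, r u v → r' (φ u) (φ v)) {g : MvPolynomial W k} (hg : g ∈ circleIdeal k r) :
    MvPolynomial.rename φ g ∈ circleIdeal k r' := by
  have : circleIdeal k r ≤ (circleIdeal k r').comap (MvPolynomial.rename φ) := by
    refine Ideal.span_le.2 ?_
    rintro g (⟨u, rfl⟩ | ⟨u, v, huv, rfl⟩)
    · rw [SetLike.mem_coe, Ideal.mem_comap, map_pow, MvPolynomial.rename_X]
      exact sq_mem_circleIdeal _ _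
    · rw [SetLike.mem_coe, Ideal.mem_comap, map_sub, MvPolynomial.rename_X,
        MvPolynomial.rename_X]
      exact sub_mem_circleIdeal (h u v huv)
  exact this hg

theorem circleIdeal_mono {r r' : W → W → Prop} (h : ∀ u v, r u v → r' u v) :
    circleIdeal k r ≤ circleIdeal k r' := by
  intro g hg
  have := map_circleIdeal (k := k) (r' := r') id h hg
  rwa [MvPolynomial.rename_id_apply] at this

/-- The linear map attached to a surgery is well defined on the quotients. A merge only enlarges the
ideal. For a split, the one new relation to check is that the difference of the two new generators
kills their sum, and this product is a difference of squares. The colon ideal reduces the claim to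
generators. -/
theorem IsSurgery.mul_factor_mem {r r' : W → W → Prop} {x y : W} (h : IsSurgery r r' x y)
    {g : MvPolynomial W k} (hg : g ∈ circleIdeal k r) :
    g * surgeryFactor k r x y ∈ circleIdeal k r' := by
  by_cases hxy : r x y
  · rw [surgeryFactor, if_pos hxy]
    have key : circleIdeal k r ≤ (circleIdeal k r').colon
        {(MvPolynomial.X x + MvPolynomial.X y : MvPolynomial W k)} := by
      refine Ideal.span_le.2 ?_
      rintro g (⟨u, rfl⟩ | ⟨u, v, huv, rfl⟩)
      · rw [SetLike.mem_coe, Submodule.mem_colon_singleton, smul_eq_mul]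
        exact Ideal.mul_mem_right _ _ (sq_mem_circleIdeal _ _)
      · rw [SetLike.mem_coe, Submodule.mem_colon_singleton, smul_eq_mul]
        have gen : ∀ u v, r' u x → r' v y →
            ((MvPolynomial.X u - MvPolynomial.X v) * (MvPolynomial.X x + MvPolynomial.X y) :
              MvPolynomial W k) ∈ circleIdeal k r' := by
          intro u v h1 h2
          have e : ((MvPolynomial.X u - MvPolynomial.X v) *
              (MvPolynomial.X x + MvPolynomial.X y) : MvPolynomial W k) =
              (MvPolynomial.X u - MvPolynomial.X x) * (MvPolynomial.X x + MvPolynomial.X y) -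
              (MvPolynomial.X v - MvPolynomial.X y) * (MvPolynomial.X x + MvPolynomial.X y) +
              MvPolynomial.X x ^ 2 - MvPolynomial.X y ^ 2 := by ring
          rw [e]
          exact sub_mem (add_mem (sub_mem
            (Ideal.mul_mem_right _ _ (sub_mem_circleIdeal h1))
            (Ideal.mul_mem_right _ _ (sub_mem_circleIdeal h2)))
            (sq_mem_circleIdeal _ _)) (sq_mem_circleIdeal _ _)
        rcases (h.split hxy u v).1 huv with h1 | ⟨h1, h2⟩ | ⟨h1, h2⟩
        · exact Ideal.mul_mem_right _ _ (sub_mem_circleIdeal h1)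
        · exact gen u v h1 h2
        · have := neg_mem (gen v u h2 h1)
          rwa [← neg_mul, neg_sub] at this
    have := key hg
    rwa [Submodule.mem_colon_singleton, smul_eq_mul] at this
  · rw [surgeryFactor, if_neg hxy, mul_one]
    exact circleIdeal_mono (fun u v => h.le_of_merge hxy) hg

/-- Two surgeries can be interchanged. -/
theorem surgeryFactor_comm {r r₁ r₂ r₁₂ : W → W → Prop} {x y z w : W}
    (h1 : IsSurgery r r₁ x y) (h12 : IsSurgery r₁ r₁₂ z w) (h2 : IsSurgery r r₂ z w)
    (h21 : IsSurgery r₂ r₁₂ x y) :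
    surgeryFactor k r x y * surgeryFactor k r₁ z w -
      surgeryFactor k r z w * surgeryFactor k r₂ x y ∈ circleIdeal k r₁₂ := by
  have e := h12.equiv'
  have two : ∀ {x y z w : W}, r₁₂ x z → r₁₂ y w →
      ((MvPolynomial.X x + MvPolynomial.X y) - (MvPolynomial.X z + MvPolynomial.X w) :
        MvPolynomial W k) ∈ circleIdeal k r₁₂ := by
    intro x y z w h1 h2
    rw [add_sub_add_comm]
    exact add_mem (sub_mem_circleIdeal h1) (sub_mem_circleIdeal h2)
  have two' : ∀ {x y z w : W}, r₁₂ x w → r₁₂ y z →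
      ((MvPolynomial.X x + MvPolynomial.X y) - (MvPolynomial.X z + MvPolynomial.X w) :
        MvPolynomial W k) ∈ circleIdeal k r₁₂ := by
    intro x y z w h1 h2
    rw [add_comm (MvPolynomial.X z)]
    exact two h1 h2
  -- a class that is split by the other surgery
  have A : r x y → ¬ r₂ x y → r z w ∧ r₁₂ z w ∧ r₁₂ x z ∧ r₁₂ y z ∧ ¬ r₁ z w := by
    intro a b
    have c : r z w := by
      by_contra c
      exact b (h2.le_of_merge c a)
    have c' := h2.dichotomy.1 c
    have hle : ∀ {u v}, r₂ u v → r₁₂ u v := fun h => h21.le_of_merge b h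
    have hxy : r₁₂ x y := by
      by_contra d
      exact b (h21.dichotomy.2 d)
    have hj := ((h2.split c x y).1 a).resolve_left b
    have hzw : r₁₂ z w := by
      rcases hj with ⟨p, q⟩ | ⟨p, q⟩
      · exact e.trans (e.symm (hle p)) (e.trans hxy (hle q))
      · exact e.trans (e.symm (hle q)) (e.trans (e.symm hxy) (hle p))
    have hxz : r₁₂ x z := by
      rcases hj with ⟨p, q⟩ | ⟨p, q⟩
      · exact hle p
      · exact e.trans (hle p) (e.symm hzw)
    refine ⟨c, hzw, hxz, e.trans (e.symm hxy) hxz, fun d => h12.dichotomy.1 d hzw⟩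
  have A' : r z w → ¬ r₁ z w → r x y ∧ r₁₂ x y ∧ r₁₂ z x ∧ r₁₂ w x ∧ ¬ r₂ x y := by
    intro a b
    have c : r x y := by
      by_contra c
      exact b (h1.le_of_merge c a)
    have hle : ∀ {u v}, r₁ u v → r₁₂ u v := fun h => h12.le_of_merge b h
    have hzw : r₁₂ z w := by
      by_contra d
      exact b (h12.dichotomy.2 d)
    have hj := ((h1.split c z w).1 a).resolve_left b
    have hxy : r₁₂ x y := by
      rcases hj with ⟨p, q⟩ | ⟨p, q⟩
      · exact e.trans (e.symm (hle p)) (e.trans hzw (hle q))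
      · exact e.trans (e.symm (hle q)) (e.trans (e.symm hzw) (hle p))
    have hzx : r₁₂ z x := by
      rcases hj with ⟨p, q⟩ | ⟨p, q⟩
      · exact hle p
      · exact e.trans (hle p) (e.symm hxy)
    exact ⟨c, hxy, hzx, e.trans (e.symm hzw) hzx, fun d => h21.dichotomy.1 d hxy⟩
  -- Here the surgery at `z, w` merges the circles of `x` and `y`, so in either order the first
  -- surgery merges and the second splits. Only the names of the generators in the split factor
  -- differ, and these agree after both surgeries, up to exchanging the two circles.
  have B : ¬ r x y → r₂ x y → ¬ r z w ∧ r₁ z w ∧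
      ((r₁₂ x z ∧ r₁₂ y w) ∨ (r₁₂ x w ∧ r₁₂ y z)) := by
    intro a b
    have c : ¬ r z w := by
      intro c
      exact a (h2.le_of_split c b)
    have d : ¬ r₁₂ x y := h21.dichotomy.1 b
    have hr1 : r₁ x y := by
      by_contra d
      exact a (h1.dichotomy.2 d)
    have f : r₁ z w := by
      by_contra f
      exact d (h12.le_of_merge f hr1)
    have g := ((h12.split f x y).1 hr1).resolve_left d
    exact ⟨c, f, g⟩
  have B' : ¬ r z w → r₁ z w → ¬ r x y ∧ r₂ x y := by
    intro a b
    have c : ¬ r x y := fun c => a (h1.le_of_split c b)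
    have d : ¬ r₁₂ z w := h12.dichotomy.1 b
    have hr2 : r₂ z w := by
      by_contra d
      exact a (h2.dichotomy.2 d)
    refine ⟨c, ?_⟩
    by_contra f
    exact d (h21.le_of_merge f hr2)
  unfold surgeryFactor
  -- If neither surgery influences the type of the other, both products have the same factors.
  -- Otherwise both orders split first and merge afterwards (case `A`), or both merge first and
  -- split afterwards (case `B`). All other combinations are contradictory.
  by_cases a : r x y <;> by_cases b : r₂ x y <;> by_cases c : r z w <;> by_cases d : r₁ z w
  all_goals first
    | exact absurd b (A' c d).2.2.2.2
    | exact absurd a (B' c d).1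
    | exact absurd d (A a b).2.2.2.2
    | exact absurd (A a b).1 c
    | exact absurd c (B a b).1
    | exact absurd (B a b).2.1 d
    | exact absurd (B' c d).2 b
    | exact absurd (A' c d).1 a
    | (rw [if_pos a, if_neg b, if_pos c, if_neg d, mul_one, mul_one]
       obtain ⟨-, h3, h4, h5, -⟩ := A a b
       exact two h4 (e.trans h5 h3))
    | (rw [if_neg a, if_pos b, if_neg c, if_pos d, one_mul, one_mul]
       rcases (B a b).2.2 with ⟨h3, h4⟩ | ⟨h3, h4⟩
       · exact two (e.symm h3) (e.symm h4)
       · exact two' (e.symm h4) (e.symm h3))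
    | (simp only [a, b, c, d, if_true, if_false]
       convert zero_mem (circleIdeal k r₁₂) using 1
       ring)

end CircleRing


/-! ## Sequences of surgeries -/

section CutProduct

variable (k : Type*) [Field k] {W : Type*}

/-- The product of the factors of a sequence of surgeries. -/
noncomputable def cutProduct (E : List ℤ → W → W → Prop) (x y : ℤ → W) :
    List ℤ → MvPolynomial W k
  | [] => 1
  | i :: l => surgeryFactor k (E (i :: l)) (x i) (y i) * cutProduct E x y l

variable {k}

/-- The element `cutProduct` represents the composite of the maps attached to the surgeries. The
property `P` passes to tails and guarantees that every cut of the sequence is a surgery. -/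
theorem mul_cutProduct_mem {E : List ℤ → W → W → Prop} {x y : ℤ → W} {P : List ℤ → Prop}
    (hP : ∀ i l, P (i :: l) → P l)
    (hE : ∀ i l, P (i :: l) → IsSurgery (E (i :: l)) (E l) (x i) (y i)) :
    ∀ l, P l → ∀ g ∈ circleIdeal k (E l), g * cutProduct k E x y l ∈ circleIdeal k (E []) := by
  intro l
  induction l with
  | nil => intro _ g hg; rwa [cutProduct, mul_one]
  | cons i l ih =>
    intro h g hg
    rw [cutProduct, ← mul_assoc]
    exact ih (hP i l h) _ ((hE i l h).mul_factor_mem hg)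

/-- Two families of surgeries can be interchanged. -/
theorem cutProduct_comm {E : List ℤ → List ℤ → W → W → Prop} {x y z w : ℤ → W}
    {P Q : List ℤ → Prop} (hP : ∀ i l, P (i :: l) → P l) (hQ : ∀ i l, Q (i :: l) → Q l)
    (hQ0 : Q [])
    (hb : ∀ i l l', P (i :: l) → Q l' → IsSurgery (E (i :: l) l') (E l l') (x i) (y i))
    (hc : ∀ i l l', P l → Q (i :: l') → IsSurgery (E l (i :: l')) (E l l') (z i) (w i)) :
    ∀ l l', P l → Q l' →
      cutProduct k (fun l => E l l') x y l * cutProduct k (E []) z w l' -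
        cutProduct k (E l) z w l' * cutProduct k (fun l => E l []) x y l ∈
      circleIdeal k (E [] []) := by
  -- One factor of the first family is moved past the whole second family. The error term of each
  -- interchange stays in the ideal when the remaining surgeries are applied to it.
  have one : ∀ i l, P (i :: l) → ∀ l', Q l' →
      surgeryFactor k (E (i :: l) l') (x i) (y i) * cutProduct k (E l) z w l' -
        cutProduct k (E (i :: l)) z w l' * surgeryFactor k (E (i :: l) []) (x i) (y i) ∈
      circleIdeal k (E l []) := by
    intro i l hl l'
    induction l' with
    | nil =>
      intro _
      rw [cutProduct, cutProduct, mul_one, one_mul, sub_self]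
      exact zero_mem _
    | cons n l' ih =>
      intro hl'
      have h1 := ih (hQ n l' hl')
      have h2 := surgeryFactor_comm (k := k) (hb i l (n :: l') hl hl')
        (hc n l l' (hP i l hl) hl') (hc n (i :: l) l' hl hl') (hb i l l' hl (hQ n l' hl'))
      have h3 := mul_cutProduct_mem (E := E l) hQ (fun i' l' h => hc i' l l' (hP i l hl) h) l'
        (hQ n l' hl') _ h2
      have h4 := Ideal.mul_mem_left _ (surgeryFactor k (E (i :: l) (n :: l')) (z n) (w n)) h1
      rw [cutProduct, cutProduct]
      convert add_mem h3 h4 using 1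
      ring
  intro l
  induction l with
  | nil =>
    intro l' _ _
    rw [cutProduct, cutProduct, mul_one, one_mul, sub_self]
    exact zero_mem _
  | cons i l ih =>
    intro l' hl hl'
    have h1 := ih l' (hP i l hl) hl'
    have h2 := one i l hl l' hl'
    have h3 := mul_cutProduct_mem (E := fun l => E l []) hP (fun i l h => hb i l [] h hQ0) l
      (hP i l hl) _ h2
    have h4 := Ideal.mul_mem_left _ (surgeryFactor k (E (i :: l) l') (x i) (y i)) h1
    rw [cutProduct, cutProduct]
    convert add_mem h3 h4 using 1
    ring

end CutProduct

/-! ## Middle sections -/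

theorem eqvGen_le {W : Type*} {r s : W → W → Prop} (h : ∀ u v, r u v → Relation.EqvGen s u v)
    {u v : W} (huv : Relation.EqvGen r u v) : Relation.EqvGen s u v := by
  induction huv with
  | rel u v h' => exact h u v h'
  | refl => exact Relation.EqvGen.refl _
  | symm _ _ _ ih => exact ih.symm
  | trans _ _ _ _ _ ih1 ih2 => exact ih1.trans _ _ _ ih2

/-- A relation between vertices which is generated by edges that a map respects. -/
theorem eqvGen_map {W W' : Type*} {r : W → W → Prop} {s : W' → W' → Prop} (φ : W → W')
    (h : ∀ u v, r u v → Relation.EqvGen s (φ u) (φ v))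
    {u v : W} (huv : Relation.EqvGen r u v) : Relation.EqvGen s (φ u) (φ v) := by
  induction huv with
  | rel u v h' => exact h u v h'
  | refl => exact Relation.EqvGen.refl _
  | symm _ _ _ ih => exact ih.symm
  | trans _ _ _ _ _ ih1 ih2 => exact ih1.trans _ _ _ ih2

/-- The list `rem` of left ends of cups of `b` is sorted and contains the left ends of all cups
to the right of its elements. -/
structure Cuttable (b : Labelling) (rem : List ℤ) : Prop where
  sorted : rem.Pairwise (· < ·)
  left : ∀ i ∈ rem, ∃ j, IsCup b i j
  upward : ∀ i ∈ rem, ∀ i' j', i < i' → IsCup b i' j' → i' ∈ rem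

/-- The vertex `x` is the end of a cup of `b` whose left end is in the list `rem`. -/
def Uncut (b : Labelling) (rem : List ℤ) (x : ℤ) : Prop := ∃ l ∈ rem, l = x ∨ IsCup b l x

theorem Cuttable.nil (b : Labelling) : Cuttable b [] :=
  ⟨List.Pairwise.nil, by simp, by simp⟩

theorem Cuttable.tail {b : Labelling} {i : ℤ} {rem : List ℤ} (h : Cuttable b (i :: rem)) :
    Cuttable b rem := by
  have hs := List.pairwise_cons.1 h.sorted
  refine ⟨hs.2, fun l hl => h.left l (List.mem_cons_of_mem _ hl), ?_⟩
  intro l hl i' j' h1 h2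
  have h3 := h.upward l (List.mem_cons_of_mem _ hl) i' j' h1 h2
  rcases List.mem_cons.1 h3 with rfl | h4
  · have := hs.1 l hl
    omega
  · exact h4

theorem Cuttable.head_lt {b : Labelling} {i : ℤ} {rem : List ℤ} (h : Cuttable b (i :: rem))
    {l : ℤ} (hl : l ∈ rem) : i < l := (List.pairwise_cons.1 h.sorted).1 l hl

theorem Cuttable.cup_head {b : Labelling} {i : ℤ} {rem : List ℤ} (h : Cuttable b (i :: rem)) :
    IsCup b i (mate b i) := by
  obtain ⟨j, hj⟩ := h.left i List.mem_cons_self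
  rwa [hj.mate_left]

theorem uncut_left {b : Labelling} {rem : List ℤ} {i j : ℤ} (h : IsCup b i j) :
    Uncut b rem i ↔ i ∈ rem := by
  constructor
  · rintro ⟨l, hl, rfl | h'⟩
    · exact hl
    · exact absurd h h'.not_cup_left
  · exact fun h => ⟨i, h, Or.inl rfl⟩

theorem Cuttable.uncut_right {b : Labelling} {rem : List ℤ} (hc : Cuttable b rem) {i j : ℤ}
    (h : IsCup b i j) : Uncut b rem j ↔ i ∈ rem := by
  constructor
  · rintro ⟨l, hl, rfl | h'⟩
    · obtain ⟨m, hm⟩ := hc.left l hl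
      exact absurd hm h.not_cup_left
    · rwa [h.left_unique h']
  · exact fun h' => ⟨i, h', Or.inr h⟩

theorem Cuttable.exists_cup {b : Labelling} {rem : List ℤ} (hc : Cuttable b rem) {x : ℤ}
    (h : Uncut b rem x) : ∃ i j, i ∈ rem ∧ IsCup b i j ∧ (x = i ∨ x = j) := by
  obtain ⟨l, hl, rfl | h'⟩ := h
  · obtain ⟨m, hm⟩ := hc.left l hl
    exact ⟨l, m, hl, hm, Or.inl rfl⟩
  · exact ⟨l, x, hl, h', Or.inr rfl⟩

theorem Cuttable.uncut_mate {b : Labelling} {rem : List ℤ} (hc : Cuttable b rem) {x : ℤ}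
    (h : Uncut b rem x) : Uncut b rem (mate b x) := by
  obtain ⟨i, j, hi, hij, rfl | rfl⟩ := hc.exists_cup h
  · rw [hij.mate_left, hc.uncut_right hij]
    exact hi
  · rw [hij.mate_right, uncut_left hij]
    exact hi

theorem Cuttable.mem_of_uncut {A : Finset ℤ} {b : Labelling} (hb : ClosedOn A b) {rem : List ℤ}
    (hc : Cuttable b rem) {x : ℤ} (h : Uncut b rem x) : x ∈ A := by
  obtain ⟨i, j, hi, hij, rfl | rfl⟩ := hc.exists_cup h
  · exact hb.left_mem hij
  · exact hb.right_mem hij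

theorem Cuttable.uncut_tail {b : Labelling} {i : ℤ} {rem : List ℤ} (h : Cuttable b (i :: rem))
    (x : ℤ) : Uncut b rem x ↔ Uncut b (i :: rem) x ∧ x ≠ i ∧ x ≠ mate b i := by
  have hi := h.cup_head
  have hnot : i ∉ rem := fun h' => lt_irrefl _ (h.head_lt h')
  constructor
  · rintro ⟨l, hl, hx⟩
    refine ⟨⟨l, List.mem_cons_of_mem _ hl, hx⟩, ?_, ?_⟩
    · rintro rfl
      exact hnot ((uncut_left hi).1 ⟨l, hl, hx⟩)
    · rintro rfl
      exact hnot ((h.tail.uncut_right hi).1 ⟨l, hl, hx⟩)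
  · rintro ⟨⟨l, hl, hx⟩, h1, h2⟩
    rcases List.mem_cons.1 hl with rfl | hl
    · rcases hx with rfl | hx
      · exact absurd rfl h1
      · exact absurd hx.mate_left.symm h2
    · exact ⟨l, hl, hx⟩

theorem leftEnds_cuttable {A : Finset ℤ} {b : Labelling} (hb : ClosedOn A b) :
    Cuttable b (leftEnds b) ∧ ∀ i j, IsCup b i j → i ∈ leftEnds b := by
  have hfin : {i | ∃ j, IsCup b i j}.Finite :=
    A.finite_toSet.subset fun i ⟨_, hj⟩ => hb.left_mem hj
  have hmem : ∀ i, i ∈ leftEnds b ↔ ∃ j, IsCup b i j := by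
    intro i
    rw [leftEnds, dif_pos hfin, Finset.mem_sort, Set.Finite.mem_toFinset]
    rfl
  refine ⟨⟨?_, fun i hi => (hmem i).1 hi, fun _ _ i' j' _ h => (hmem i').2 ⟨j', h⟩⟩,
    fun i j h => (hmem i).2 ⟨j, h⟩⟩
  rw [leftEnds, dif_pos hfin]
  exact Finset.sortedLT_sort _ |>.pairwise

theorem uncut_leftEnds {A : Finset ℤ} {b : Labelling} (hb : ClosedOn A b) (x : ℤ) :
    Uncut b (leftEnds b) x ↔ x ∈ A := by
  refine ⟨(leftEnds_cuttable hb).1.mem_of_uncut hb, fun hx => ?_⟩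
  rcases hb.cup_mate hx with h | h
  · exact (uncut_left h).2 ((leftEnds_cuttable hb).2 _ _ h)
  · exact ((leftEnds_cuttable hb).1.uncut_right h).2 ((leftEnds_cuttable hb).2 _ _ h)

/-- The parity of the number of elements of `A` to the left of `x`. -/
def leftParity (A : Finset ℤ) (x : ℤ) : Bool := decide (Odd (A.filter (· < x)).card)

/-- An even number of vertices of `A` lies strictly under the cup, so its two ends have opposite
parity. This is the source of the two-colouring of all diagrams. -/
theorem ClosedOn.leftParity_cup {A : Finset ℤ} {f : Labelling} (hf : ClosedOn A f) {i j : ℤ}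
    (h : IsCup f i j) : leftParity A j = !leftParity A i := by
  have hev := hf.even_inside (C := fun _ => True) h (fun _ _ _ _ h => h)
  have hsplit : A.filter (· < j) =
      insert i (A.filter (· < i) ∪ A.filter fun x => (i < x ∧ x < j) ∧ True) := by
    ext x
    have := h.1
    have hi := hf.left_mem h
    simp only [Finset.mem_filter, Finset.mem_insert, Finset.mem_union]
    constructor
    · rintro ⟨h1, h2⟩
      rcases lt_trichotomy x i with h3 | h3 | h3
      · exact Or.inr (Or.inl ⟨h1, h3⟩)
      · exact Or.inl h3
      · exact Or.inr (Or.inr ⟨h1, ⟨h3, h2⟩, trivial⟩)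
    · rintro (rfl | ⟨h1, h2⟩ | ⟨h1, ⟨h2, h3⟩, -⟩)
      · exact ⟨hi, this⟩
      · exact ⟨h1, h2.trans this⟩
      · exact ⟨h1, h3⟩
  have hcard : (A.filter (· < j)).card = (A.filter (· < i)).card +
      (A.filter fun x => (i < x ∧ x < j) ∧ True).card + 1 := by
    rw [hsplit, Finset.card_insert_of_notMem, Finset.card_union_of_disjoint]
    · rw [Finset.disjoint_left]
      intro x h1 h2
      rw [Finset.mem_filter] at h1 h2
      omega
    · simp
  unfold leftParity
  rw [hcard, ← decide_not, decide_eq_decide]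
  simp only [Nat.odd_iff, Nat.even_iff] at hev ⊢
  omega

theorem ClosedOn.leftParity_mate {A : Finset ℤ} {f : Labelling} (hf : ClosedOn A f) {i : ℤ}
    (h : i ∈ A) : leftParity A (mate f i) = !leftParity A i := by
  rcases hf.cup_mate h with h' | h'
  · exact hf.leftParity_cup h'
  · rw [hf.leftParity_cup h', Bool.not_not]

open Classical in
/-- The edges on one side of several number lines: between the lines `s` and `t` there is the
middle section of `b`, and the other lines carry the cups of `d`. -/
noncomputable def side {ι : Type*} (A : Finset ℤ) (s t : ι) (b d : Labelling)
    (rem : List ℤ) (v : ι × ℤ) : ι × ℤ :=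
  if v.1 = s ∨ v.1 = t then
    if Uncut b rem v.2 then (v.1, mate b v.2)
    else if v.2 ∈ A then (Equiv.swap s t v.1, v.2) else v
  else (v.1, mate d v.2)

/-! ### The involution given by a partially cut middle section. -/

section Side

variable {ι : Type*} {A : Finset ℤ} {s t : ι} {b d : Labelling} {rem : List ℤ}

theorem side_other {l : ι} (hs : l ≠ s) (ht : l ≠ t) (x : ℤ) :
    side A s t b d rem (l, x) = (l, mate d x) := by
  rw [side, if_neg]
  rintro (h | h)
  · exact hs h
  · exact ht h

theorem side_uncut {l : ι} (h : l = s ∨ l = t) {x : ℤ} (hx : Uncut b rem x) :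
    side A s t b d rem (l, x) = (l, mate b x) := by
  rw [side, if_pos h, if_pos hx]

theorem side_cut_left {x : ℤ} (hA : x ∈ A) (hx : ¬ Uncut b rem x) :
    side A s t b d rem (s, x) = (t, x) := by
  classical
  rw [side, if_pos (Or.inl rfl), if_neg hx, if_pos hA]
  exact congrArg (fun l => (l, x)) (Equiv.swap_apply_left s t)

theorem side_cut_right {x : ℤ} (hA : x ∈ A) (hx : ¬ Uncut b rem x) :
    side A s t b d rem (t, x) = (s, x) := by
  classical
  rw [side, if_pos (Or.inr rfl), if_neg hx, if_pos hA]
  exact congrArg (fun l => (l, x)) (Equiv.swap_apply_right s t)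

theorem side_not_mem (hb : ClosedOn A b) (hd : ClosedOn A d) (hc : Cuttable b rem)
    {v : ι × ℤ} (hv : v.2 ∉ A) : side A s t b d rem v = v := by
  have : ¬ Uncut b rem v.2 := fun h => hv (hc.mem_of_uncut hb h)
  rw [side, if_neg this, if_neg hv, hd.mate_of_not_mem hv]
  split_ifs <;> rfl

theorem side_mem (hb : ClosedOn A b) (hd : ClosedOn A d) {v : ι × ℤ}
    (hv : v.2 ∈ A) : (side A s t b d rem v).2 ∈ A := by
  rw [side]
  split_ifs
  · exact hb.mate_mem hv
  · exact hv
  · exact hd.mate_mem hv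

theorem side_involutive (hc : Cuttable b rem) :
    Function.Involutive (side A s t b d rem) := by
  rintro ⟨l, x⟩
  by_cases hl : l = s ∨ l = t
  · by_cases hx : Uncut b rem x
    · rw [side_uncut hl hx, side_uncut hl (hc.uncut_mate hx), mate_mate]
    · by_cases hA : x ∈ A
      · rcases hl with rfl | rfl
        · rw [side_cut_left hA hx, side_cut_right hA hx]
        · rw [side_cut_right hA hx, side_cut_left hA hx]
      · have : side A s t b d rem (l, x) = (l, x) := by
          rw [side, if_pos hl, if_neg hx, if_neg hA]
        rw [this, this]
  · push Not at hl
    rw [side_other hl.1 hl.2, side_other hl.1 hl.2, mate_mate]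

/-- A cup flips the parity and fixes the line; a segment fixes the position and exchanges lines on
which `κ` differs. Each edge thus flips the combined colour. -/
theorem side_color (hb : ClosedOn A b) (hd : ClosedOn A d) {κ : ι → Bool}
    (hκ : κ t = !κ s) {v : ι × ℤ} (hv : v.2 ∈ A) :
    (xor (κ (side A s t b d rem v).1) (leftParity A (side A s t b d rem v).2)) =
      !(xor (κ v.1) (leftParity A v.2)) := by
  obtain ⟨l, x⟩ := v
  by_cases hl : l = s ∨ l = t
  · by_cases hx : Uncut b rem x
    · rw [side_uncut hl hx, hb.leftParity_mate hv, Bool.xor_not]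
    · rcases hl with rfl | rfl
      · rw [side_cut_left hv hx, hκ, Bool.not_xor]
      · rw [side_cut_right hv hx, hκ, Bool.not_xor, Bool.not_not]
  · push Not at hl
    rw [side_other hl.1 hl.2, hd.leftParity_mate hv, Bool.xor_not]

/-- Cutting the first pair of the list is a surgery. -/
theorem isSurgery_side [Finite ι] (hb : ClosedOn A b) (hd : ClosedOn A d) (hst : s ≠ t)
    {κ : ι → Bool} (hκ : κ t = !κ s) {σ : ι × ℤ → ι × ℤ} (hσ : Function.Involutive σ)
    (hσS : ∀ v : ι × ℤ, v.2 ∈ A → (σ v).2 ∈ A ∧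
      (xor (κ (σ v).1) (leftParity A (σ v).2)) = !(xor (κ v.1) (leftParity A v.2)))
    {i : ℤ} (hc : Cuttable b (i :: rem)) :
    IsSurgery (InvConn σ (side A s t b d (i :: rem))) (InvConn σ (side A s t b d rem))
      (s, i) (t, mate b i) := by
  have hcup := hc.cup_head
  set j := mate b i with hj
  have hi : i ∈ A := hb.left_mem hcup
  have hjA : j ∈ A := hb.right_mem hcup
  have hui : Uncut b (i :: rem) i := (uncut_left hcup).2 List.mem_cons_self
  have huj : Uncut b (i :: rem) j := (hc.uncut_right hcup).2 List.mem_cons_self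
  have hui' : ¬ Uncut b rem i := fun h => ((hc.uncut_tail i).1 h).2.1 rfl
  have huj' : ¬ Uncut b rem j := fun h => ((hc.uncut_tail j).1 h).2.2 rfl
  have hji : mate b j = i := hcup.mate_right
  have e1 : side A s t b d (i :: rem) (s, i) = (s, j) := side_uncut (Or.inl rfl) hui
  have e2 : side A s t b d (i :: rem) (t, i) = (t, j) := side_uncut (Or.inr rfl) hui
  have e1' : side A s t b d (i :: rem) (s, j) = (s, i) := by
    rw [side_uncut (Or.inl rfl) huj, hji]
  have e2' : side A s t b d (i :: rem) (t, j) = (t, i) := by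
    rw [side_uncut (Or.inr rfl) huj, hji]
  have e3 : side A s t b d rem (s, i) = (t, i) := side_cut_left hi hui'
  have e4 : side A s t b d rem (s, j) = (t, j) := side_cut_left hjA huj'
  have e3' : side A s t b d rem (t, i) = (s, i) := side_cut_right hi hui'
  have e4' : side A s t b d rem (t, j) = (s, j) := side_cut_right hjA huj'
  have hoff : ∀ v : ι × ℤ, v ≠ (s, i) → v ≠ (s, j) → v ≠ (t, i) → v ≠ (t, j) →
      side A s t b d rem v = side A s t b d (i :: rem) v := by
    rintro ⟨l, x⟩ h1 h2 h3 h4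
    by_cases hl : l = s ∨ l = t
    · have hx : Uncut b rem x ↔ Uncut b (i :: rem) x := by
        rw [hc.uncut_tail x, and_iff_left]
        constructor
        · rintro rfl
          rcases hl with rfl | rfl
          · exact h1 rfl
          · exact h3 rfl
        · rintro h
          rw [← hj] at h
          subst h
          rcases hl with rfl | rfl
          · exact h2 rfl
          · exact h4 rfl
      rw [side, side, if_pos hl, if_pos hl]
      by_cases h : Uncut b rem x
      · rw [if_pos h, if_pos (hx.1 h)]
      · rw [if_neg h, if_neg fun h' => h (hx.2 h')]
    · push Not at hl
      rw [side_other hl.1 hl.2, side_other hl.1 hl.2]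
  have hcol := fun (rem : List ℤ) (v : ι × ℤ) (hv : v ∈ {v : ι × ℤ | v.2 ∈ A}) =>
    And.intro (side_mem (s := s) (t := t) (rem := rem) hb hd hv)
      (side_color (rem := rem) hb hd hκ hv)
  have hSf : {v : ι × ℤ | v.2 ∈ A}.Finite := by
    refine (Set.finite_univ.prod A.finite_toSet).subset ?_
    rintro ⟨l, x⟩ hx
    exact ⟨trivial, hx⟩
  -- Cutting replaces the edges inside each of the lines `s` and `t` by two segments. The diagonal
  -- pair `(s, i)`, `(t, j)` is used because its members have equal colours, as the dichotomy
  -- demands.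
  have hdich := invConn_dichotomy hσ (side_involutive hc) (side_involutive hc.tail) hSf
    (χ := fun v : ι × ℤ => xor (κ v.1) (leftParity A v.2)) hσS
    (hcol (i :: rem)) (hcol rem) (p := (s, i)) (p' := (s, j)) (q := (t, i)) (q' := (t, j)) hi
    (fun h => hst (congrArg Prod.fst h)) e1 e2 e3 e4
    (by simp only [hκ, hb.leftParity_cup hcup, Bool.not_xor, Bool.xor_not, Bool.not_not]) hoff
  have heq : ∀ rem, Equivalence (InvConn σ (side A s t b d rem)) := fun rem =>
    Relation.EqvGen.is_equivalence _
  refine ⟨heq _, heq _, ?_, hdich⟩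
  have joinEquiv : ∀ (r : ι × ℤ → ι × ℤ → Prop), Equivalence r → ∀ (x y : ι × ℤ),
      Equivalence (JoinRel r x y) := by
    intro r hr x y
    refine ⟨fun u => Or.inl (hr.refl u), ?_, ?_⟩
    · rintro u v (h | ⟨h1, h2⟩ | ⟨h1, h2⟩)
      · exact Or.inl (hr.symm h)
      · exact Or.inr (Or.inr ⟨h2, h1⟩)
      · exact Or.inr (Or.inl ⟨h2, h1⟩)
    · rintro u v w h h'
      have T := @hr.trans
      have S := @hr.symm
      unfold JoinRel at *
      grind
  -- To include one join in the other, it suffices to treat single edges. Only the edges at the four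
  -- ends change, and gluing the diagonal pair puts all four ends into one class, both before and
  -- after the cut.
  have sub : ∀ (r r' : ι × ℤ → ι × ℤ → Prop) (ρ : ι × ℤ → ι × ℤ), Equivalence r' →
      r = InvConn σ ρ → (∀ v, r' v (σ v)) →
      (∀ v, v ≠ (s, i) → v ≠ (s, j) → v ≠ (t, i) → v ≠ (t, j) → r' v (ρ v)) →
      JoinRel r' (s, i) (t, j) (s, i) (ρ (s, i)) → JoinRel r' (s, i) (t, j) (s, j) (ρ (s, j)) →
      JoinRel r' (s, i) (t, j) (t, i) (ρ (t, i)) → JoinRel r' (s, i) (t, j) (t, j) (ρ (t, j)) →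
      ∀ u v, JoinRel r (s, i) (t, j) u v → JoinRel r' (s, i) (t, j) u v := by
    intro r r' ρ hr' hr h0 h1 h2 h3 h4 h5 u v huv
    have hJ := joinEquiv r' hr' (s, i) (t, j)
    have hle : ∀ u v, r u v → JoinRel r' (s, i) (t, j) u v := by
      intro u v huv
      rw [hr] at huv
      induction huv with
      | rel u v h =>
        rcases h with rfl | rfl
        · exact Or.inl (h0 u)
        · by_cases a1 : u = (s, i)
          · rwa [a1]
          by_cases a2 : u = (s, j)
          · rwa [a2]
          by_cases a3 : u = (t, i)
          · rwa [a3]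
          by_cases a4 : u = (t, j)
          · rwa [a4]
          exact Or.inl (h1 u a1 a2 a3 a4)
      | refl => exact hJ.refl _
      | symm _ _ _ ih => exact hJ.symm ih
      | trans _ _ _ _ _ ih1 ih2 => exact hJ.trans ih1 ih2
    have hxy : JoinRel r' (s, i) (t, j) (s, i) (t, j) :=
      Or.inr (Or.inl ⟨hr'.refl _, hr'.refl _⟩)
    rcases huv with h | ⟨h, h'⟩ | ⟨h, h'⟩
    · exact hle u v h
    · exact hJ.trans (hle _ _ h) (hJ.trans hxy (hJ.symm (hle _ _ h')))
    · exact hJ.trans (hle _ _ h) (hJ.trans (hJ.symm hxy) (hJ.symm (hle _ _ h')))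
  have conσ : ∀ (ρ : ι × ℤ → ι × ℤ) v, InvConn σ ρ v (σ v) := fun ρ v =>
    Relation.EqvGen.rel _ _ (Or.inl rfl)
  have conρ : ∀ (ρ : ι × ℤ → ι × ℤ) v, InvConn σ ρ v (ρ v) := fun ρ v =>
    Relation.EqvGen.rel _ _ (Or.inr rfl)
  intro u v
  constructor
  · have E := heq rem
    have c1 : InvConn σ (side A s t b d rem) (s, i) (t, i) := by
      have := conρ (side A s t b d rem) (s, i)
      rwa [e3] at this
    have c2 : InvConn σ (side A s t b d rem) (s, j) (t, j) := by
      have := conρ (side A s t b d rem) (s, j)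
      rwa [e4] at this
    refine sub _ _ _ E rfl (conσ _) (fun v a1 a2 a3 a4 => ?_) ?_ ?_ ?_ ?_ u v
    · rw [← hoff v a1 a2 a3 a4]
      exact conρ _ v
    · rw [e1]
      exact Or.inr (Or.inl ⟨E.refl _, c2⟩)
    · rw [e1']
      exact Or.inr (Or.inr ⟨c2, E.refl _⟩)
    · rw [e2]
      exact Or.inr (Or.inl ⟨E.symm c1, E.refl _⟩)
    · rw [e2']
      exact Or.inr (Or.inr ⟨E.refl _, E.symm c1⟩)
  · have E := heq (i :: rem)
    have c1 : InvConn σ (side A s t b d (i :: rem)) (s, i) (s, j) := by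
      have := conρ (side A s t b d (i :: rem)) (s, i)
      rwa [e1] at this
    have c2 : InvConn σ (side A s t b d (i :: rem)) (t, i) (t, j) := by
      have := conρ (side A s t b d (i :: rem)) (t, i)
      rwa [e2] at this
    refine sub _ _ _ E rfl (conσ _) (fun v a1 a2 a3 a4 => ?_) ?_ ?_ ?_ ?_ u v
    · rw [hoff v a1 a2 a3 a4]
      exact conρ _ v
    · rw [e3]
      exact Or.inr (Or.inl ⟨E.refl _, c2⟩)
    · rw [e4]
      exact Or.inr (Or.inl ⟨E.symm c1, E.refl _⟩)
    · rw [e3']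
      exact Or.inr (Or.inr ⟨c2, E.refl _⟩)
    · rw [e4']
      exact Or.inr (Or.inr ⟨E.refl _, E.symm c1⟩)

end Side


/-! ## Circles of diagrams with two and three number lines -/

theorem InvConn.comm {W : Type*} {σ τ : W → W} {u v : W} (h : InvConn σ τ u v) :
    InvConn τ σ u v :=
  eqvGen_le (fun _ _ h => Relation.EqvGen.rel _ _ h.symm) h

theorem invConn_comm {W : Type*} (σ τ : W → W) : InvConn σ τ = InvConn τ σ := by
  funext u v
  exact propext ⟨InvConn.comm, InvConn.comm⟩

theorem invConn_left {W : Type*} (σ τ : W → W) (u : W) : InvConn σ τ u (σ u) :=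
  Relation.EqvGen.rel _ _ (Or.inl rfl)

theorem invConn_right {W : Type*} (σ τ : W → W) (u : W) : InvConn σ τ u (τ u) :=
  Relation.EqvGen.rel _ _ (Or.inr rfl)

/-- As the edges come from involutions, the image of `φ` is closed under edges in both directions,
so a path that starts in the image stays there. This discards the part of a diagram not connected to
the lines of interest. -/
theorem invConn_embed {W W' : Type*} {σ τ : W → W} {σ' τ' : W' → W'}
    (hσ : Function.Involutive σ) (hτ : Function.Involutive τ) {φ : W' → W}
    (hφ : Function.Injective φ) (h1 : ∀ u, σ (φ u) = φ (σ' u)) (h2 : ∀ u, τ (φ u) = φ (τ' u))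
    (u v : W') : InvConn σ τ (φ u) (φ v) ↔ InvConn σ' τ' u v := by
  constructor
  · have key : ∀ x y, InvConn σ τ x y → (∀ u, x = φ u → ∃ v, y = φ v ∧ InvConn σ' τ' u v) ∧
        (∀ v, y = φ v → ∃ u, x = φ u ∧ InvConn σ' τ' u v) := by
      intro x y hxy
      induction hxy with
      | rel x y h =>
        rcases h with rfl | rfl
        · refine ⟨?_, ?_⟩
          · rintro u rfl
            exact ⟨σ' u, h1 u, invConn_left _ _ _⟩
          · intro v hv
            refine ⟨σ' v, ?_, (invConn_left _ _ _).symm⟩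
            rw [← h1, ← hv, hσ]
        · refine ⟨?_, ?_⟩
          · rintro u rfl
            exact ⟨τ' u, h2 u, invConn_right _ _ _⟩
          · intro v hv
            refine ⟨τ' v, ?_, (invConn_right _ _ _).symm⟩
            rw [← h2, ← hv, hτ]
      | refl x =>
        exact ⟨fun u hu => ⟨u, hu, Relation.EqvGen.refl _⟩,
          fun u hu => ⟨u, hu, Relation.EqvGen.refl _⟩⟩
      | symm x y _ ih =>
        refine ⟨fun u hu => ?_, fun v hv => ?_⟩
        · obtain ⟨w, hw, h⟩ := ih.2 u hu
          exact ⟨w, hw, h.symm⟩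
        · obtain ⟨w, hw, h⟩ := ih.1 v hv
          exact ⟨w, hw, h.symm⟩
      | trans x y z _ _ ih1 ih2 =>
        refine ⟨fun u hu => ?_, fun v hv => ?_⟩
        · obtain ⟨w, hw, h⟩ := ih1.1 u hu
          obtain ⟨w', hw', h'⟩ := ih2.1 w hw
          exact ⟨w', hw', h.trans _ _ _ h'⟩
        · obtain ⟨w, hw, h⟩ := ih2.2 v hv
          obtain ⟨w', hw', h'⟩ := ih1.2 w hw
          exact ⟨w', hw', h'.trans _ _ _ h⟩
    intro h
    obtain ⟨w, hw, h'⟩ := (key _ _ h).1 u rfl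
    rwa [hφ hw]
  · refine eqvGen_map φ ?_
    rintro u v (rfl | rfl)
    · rw [← h1]
      exact invConn_left _ _ _
    · rw [← h2]
      exact invConn_right _ _ _

/-- Edges go to connected pairs under both `ψ` and `φ`, and `ψ` retracts `φ`. This is used to
identify two lines that are joined by vertical segments everywhere. -/
theorem invConn_collapse {W W' : Type*} {σ τ : W → W} {σ' τ' : W' → W'} {φ : W' → W}
    {ψ : W → W'} (hψφ : ∀ u, ψ (φ u) = u)
    (h1 : ∀ u, InvConn σ' τ' (ψ u) (ψ (σ u))) (h2 : ∀ u, InvConn σ' τ' (ψ u) (ψ (τ u)))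
    (h3 : ∀ u, InvConn σ τ (φ u) (φ (σ' u))) (h4 : ∀ u, InvConn σ τ (φ u) (φ (τ' u)))
    (u v : W') : InvConn σ τ (φ u) (φ v) ↔ InvConn σ' τ' u v := by
  constructor
  · intro h
    have := eqvGen_map (s := fun u v => v = σ' u ∨ v = τ' u) ψ (by
      rintro u v (rfl | rfl)
      · exact h1 u
      · exact h2 u) h
    rwa [hψφ, hψφ] at this
  · refine eqvGen_map φ ?_
    rintro u v (rfl | rfl)
    · exact h3 u
    · exact h4 u

/-- The cups of `a` on the bottom line and the caps of `d` on the top line. -/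
noncomputable def outer (a d : Labelling) (v : Vertex) : Vertex :=
  (v.1, if v.1 = true then mate d v.2 else mate a v.2)

theorem outer_false (a d : Labelling) (x : ℤ) : outer a d (false, x) = (false, mate a x) := rfl

theorem outer_true (a d : Labelling) (x : ℤ) : outer a d (true, x) = (true, mate d x) := rfl

theorem outer_involutive (a d : Labelling) : Function.Involutive (outer a d) := by
  rintro ⟨l, x⟩
  cases l
  · rw [outer_false, outer_false, mate_mate]
  · rw [outer_true, outer_true, mate_mate]

section TwoLines

variable {A : Finset ℤ} {a b d : Labelling} {rem : List ℤ}

/-- Circles are rewritten as components of two matchings, the outer arcs and the middle section, so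
that the dichotomy for involutions applies. -/
theorem sameCircle_iff (ha : ClosedOn A a) (hb : ClosedOn A b) (hd : ClosedOn A d)
    (hc : Cuttable b rem) (u v : Vertex) :
    SameCircle a b d rem u v ↔
      InvConn (outer a d) (side A false true b d rem) u v := by
  constructor
  · refine eqvGen_le ?_
    rintro u v (⟨i, j, h⟩ | ⟨i, j, h⟩ | ⟨i, j, hi, h⟩ | ⟨i, j, hi, h⟩ | ⟨i, hi, h⟩)
    · refine Relation.EqvGen.rel _ _ (Or.inl ?_)
      rw [outer_false, h.mate_left]
    · refine Relation.EqvGen.rel _ _ (Or.inl ?_)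
      rw [outer_true, h.mate_left]
    · refine Relation.EqvGen.rel _ _ (Or.inr ?_)
      rw [side_uncut (Or.inl rfl) ((uncut_left h).2 hi), h.mate_left]
    · refine Relation.EqvGen.rel _ _ (Or.inr ?_)
      rw [side_uncut (Or.inr rfl) ((uncut_left h).2 hi), h.mate_left]
    · refine Relation.EqvGen.rel _ _ (Or.inr ?_)
      rw [side_cut_left ((hb.arrow i).1 hi)]
      rintro ⟨l, hl, h'⟩
      exact h'.elim (h l hl).1 (h l hl).2
  · refine eqvGen_le ?_
    have hmid : ∀ l : Bool, ∀ i j, i ∈ rem → IsCup b i j →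
        Relation.EqvGen (Joined a b d rem) (l, i) (l, j) := by
      intro l i j hi h
      cases l
      · exact Relation.EqvGen.rel _ _ (Joined.middleCap i j hi h)
      · exact Relation.EqvGen.rel _ _ (Joined.middleCup i j hi h)
    rintro ⟨l, x⟩ v (rfl | rfl)
    · by_cases hx : x ∈ A
      · cases l
        · rw [outer_false]
          rcases ha.cup_mate hx with h | h
          · exact Relation.EqvGen.rel _ _ (Joined.bottom _ _ h)
          · exact (Relation.EqvGen.rel _ _ (Joined.bottom _ _ h)).symm
        · rw [outer_true]
          rcases hd.cup_mate hx with h | h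
          · exact Relation.EqvGen.rel _ _ (Joined.top _ _ h)
          · exact (Relation.EqvGen.rel _ _ (Joined.top _ _ h)).symm
      · have : outer a d (l, x) = (l, x) := by
          rw [outer, ha.mate_of_not_mem hx, hd.mate_of_not_mem hx, ite_self]
        rw [this]
        exact Relation.EqvGen.refl _
    · by_cases hu : Uncut b rem x
      · rw [side_uncut (by cases l <;> simp) hu]
        obtain ⟨i, j, hi, hij, rfl | rfl⟩ := hc.exists_cup hu
        · rw [hij.mate_left]
          exact hmid l _ _ hi hij
        · rw [hij.mate_right]
          exact (hmid l _ _ hi hij).symm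
      · by_cases hx : x ∈ A
        · have hs : Joined a b d rem (false, x) (true, x) :=
            Joined.segment x ((hb.arrow x).2 hx) fun l hl =>
              ⟨fun h => hu ⟨l, hl, Or.inl h⟩, fun h => hu ⟨l, hl, Or.inr h⟩⟩
          cases l
          · rw [side_cut_left hx hu]
            exact Relation.EqvGen.rel _ _ hs
          · rw [side_cut_right hx hu]
            exact (Relation.EqvGen.rel _ _ hs).symm
        · rw [side_not_mem hb hd hc hx]
          exact Relation.EqvGen.refl _

theorem sameCircle_eq (ha : ClosedOn A a) (hb : ClosedOn A b) (hd : ClosedOn A d)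
    (hc : Cuttable b rem) :
    SameCircle a b d rem = InvConn (outer a d) (side A false true b d rem) := by
  funext u v
  exact propext (sameCircle_iff ha hb hd hc u v)

/-- Cutting the first pair of the list is a surgery. -/
theorem isSurgery_sameCircle (ha : ClosedOn A a) (hb : ClosedOn A b) (hd : ClosedOn A d) {i : ℤ}
    (hc : Cuttable b (i :: rem)) :
    IsSurgery (SameCircle a b d (i :: rem)) (SameCircle a b d rem) (false, i)
      (true, mate b i) := by
  rw [sameCircle_eq ha hb hd hc, sameCircle_eq ha hb hd hc.tail]
  refine isSurgery_side hb hd (by simp) (κ := id) rfl (outer_involutive a d) ?_ hc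
  rintro ⟨l, x⟩ hx
  cases l
  · exact ⟨ha.mate_mem hx, by rw [outer_false, ha.leftParity_mate hx, Bool.xor_not]⟩
  · exact ⟨hd.mate_mem hx, by rw [outer_true, hd.leftParity_mate hx, Bool.xor_not]⟩

end TwoLines

theorem side_map {ι ι' : Type*} {A : Finset ℤ} {s t : ι} {s' t' : ι'} {b d d' : Labelling}
    {rem : List ℤ} {φ : ι → ι'} (hs : φ s = s') (ht : φ t = t') {l : ι} (hl : l = s ∨ l = t)
    (x : ℤ) : side A s' t' b d' rem (φ l, x) = Prod.map φ id (side A s t b d rem (l, x)) := by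
  subst hs ht
  have hl' : φ l = φ s ∨ φ l = φ t := hl.imp (congrArg φ) (congrArg φ)
  by_cases hx : Uncut b rem x
  · rw [side_uncut hl hx, side_uncut hl' hx]
    rfl
  · by_cases hA : x ∈ A
    · rcases hl with rfl | rfl
      · rw [side_cut_left hA hx, side_cut_left hA hx]
        rfl
      · rw [side_cut_right hA hx, side_cut_right hA hx]
        rfl
    · have h1 : side A s t b d rem (l, x) = (l, x) := by
        rw [side, if_pos hl, if_neg hx, if_neg hA]
      have h2 : side A (φ s) (φ t) b d' rem (φ l, x) = (φ l, x) := by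
        rw [side, if_pos hl', if_neg hx, if_neg hA]
      rw [h1, h2]
      rfl

theorem side_full {ι : Type*} {A : Finset ℤ} {s t : ι} {b d : Labelling} (hb : ClosedOn A b)
    {l : ι} (hl : l = s ∨ l = t) (x : ℤ) :
    side A s t b d (leftEnds b) (l, x) = (l, mate b x) := by
  by_cases hx : Uncut b (leftEnds b) x
  · exact side_uncut hl hx
  · have hA : x ∉ A := fun h => hx ((uncut_leftEnds hb x).2 h)
    rw [side, if_pos hl, if_neg hx, if_neg hA, hb.mate_of_not_mem hA]

theorem not_uncut_nil (b : Labelling) (x : ℤ) : ¬ Uncut b [] x := by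
  rintro ⟨l, hl, -⟩
  cases hl

/-! ### Diagrams with three number lines, for associativity. -/

section ThreeLines

/-- Two vertices of a diagram with three number lines, with the cups of `a` at the bottom, middle
sections of `b` and of `c`, and the caps of `d` at the top, lie on the same circle. -/
def ThreeConn (A : Finset ℤ) (a b c d : Labelling) (rb rc : List ℤ) :
    Fin 3 × ℤ → Fin 3 × ℤ → Prop :=
  InvConn (side A 1 2 c a rc) (side A 0 1 b d rb)

variable {A : Finset ℤ} {a b c d : Labelling}

theorem isSurgery_threeConn_left (ha : ClosedOn A a) (hb : ClosedOn A b) (hc : ClosedOn A c)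
    (hd : ClosedOn A d) {i : ℤ} {rb rc : List ℤ} (hrb : Cuttable b (i :: rb))
    (hrc : Cuttable c rc) :
    IsSurgery (ThreeConn A a b c d (i :: rb) rc) (ThreeConn A a b c d rb rc) (0, i)
      (1, mate b i) :=
  isSurgery_side hb hd (by decide) (κ := ![false, true, false]) rfl (side_involutive hrc)
    (fun _ hv => ⟨side_mem hc ha hv, side_color (κ := ![false, true, false]) hc ha rfl hv⟩) hrb

theorem isSurgery_threeConn_right (ha : ClosedOn A a) (hb : ClosedOn A b) (hc : ClosedOn A c)
    (hd : ClosedOn A d) {i : ℤ} {rb rc : List ℤ} (hrb : Cuttable b rb)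
    (hrc : Cuttable c (i :: rc)) :
    IsSurgery (ThreeConn A a b c d rb (i :: rc)) (ThreeConn A a b c d rb rc) (1, i)
      (2, mate c i) := by
  rw [ThreeConn, ThreeConn, invConn_comm, invConn_comm (side A 1 2 c a rc)]
  exact isSurgery_side hc ha (by decide) (κ := ![false, true, false]) rfl (side_involutive hrb)
    (fun _ hv => ⟨side_mem hb hd hv, side_color (κ := ![false, true, false]) hb hd rfl hv⟩) hrc

theorem fin3_cases (l : Fin 3) : l = 0 ∨ l = 1 ∨ l = 2 := by
  fin_cases l <;> simp

/-- While the middle section of `c` is uncut, nothing leads from the lines `0` and `1` to the line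
`2`, and the caps of `c` close the diagram on the two lower lines. -/
theorem threeConn_full_right (ha : ClosedOn A a) (hb : ClosedOn A b) (hc : ClosedOn A c)
    {rb : List ℤ} (hrb : Cuttable b rb) (i j : ℤ) :
    ThreeConn A a b c d rb (leftEnds c) (0, i) (1, j) ↔
      SameCircle a b c rb (false, i) (true, j) := by
  rw [sameCircle_eq ha hb hc hrb]
  let φ : Bool → Fin 3 := fun l => if l = true then 1 else 0
  have hφ : Function.Injective (Prod.map φ (id : ℤ → ℤ)) :=
    Function.Injective.prodMap (by decide) Function.injective_id
  refine invConn_embed (σ' := outer a c) (τ' := side A false true b c rb)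
    (side_involutive (leftEnds_cuttable hc).1) (side_involutive hrb) hφ ?_ ?_ (false, i) (true, j)
  · rintro ⟨l, x⟩
    cases l
    · exact side_other (by decide) (by decide) x
    · exact side_full hc (Or.inl rfl) x
  · rintro ⟨l, x⟩
    exact side_map (φ := φ) (s := false) (t := true) rfl rfl (by cases l <;> decide) x

theorem threeConn_full_left (hb : ClosedOn A b) (hc : ClosedOn A c) (hd : ClosedOn A d)
    {rc : List ℤ} (hrc : Cuttable c rc) (i j : ℤ) :
    ThreeConn A a b c d (leftEnds b) rc (1, i) (2, j) ↔
      SameCircle b c d rc (false, i) (true, j) := by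
  rw [sameCircle_eq hb hc hd hrc, ThreeConn, invConn_comm]
  let φ : Bool → Fin 3 := fun l => if l = true then 2 else 1
  have hφ : Function.Injective (Prod.map φ (id : ℤ → ℤ)) :=
    Function.Injective.prodMap (by decide) Function.injective_id
  refine invConn_embed (σ' := outer b d) (τ' := side A false true c d rc)
    (side_involutive (leftEnds_cuttable hb).1) (side_involutive hrc) hφ ?_ ?_ (false, i) (true, j)
  · rintro ⟨l, x⟩
    cases l
    · exact side_full hb (Or.inr rfl) x
    · exact side_other (by decide) (by decide) x
  · rintro ⟨l, x⟩
    exact side_map (φ := φ) (s := false) (t := true) rfl rfl (by cases l <;> decide) x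

theorem threeConn_nil_left_step {x : ℤ} (hx : x ∈ A) (rc : List ℤ) :
    ThreeConn A a b c d [] rc (1, x) (0, x) := by
  have := invConn_right (side A 1 2 c a rc) (side A 0 1 b d []) ((1 : Fin 3), x)
  rwa [side_cut_right hx (not_uncut_nil b x)] at this

theorem threeConn_nil_right_step {x : ℤ} (hx : x ∈ A) (rb : List ℤ) :
    ThreeConn A a b c d rb [] (1, x) (2, x) := by
  have := invConn_left (side A 1 2 c a []) (side A 0 1 b d rb) ((1 : Fin 3), x)
  rwa [side_cut_left hx (not_uncut_nil c x)] at this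

/-- When the middle section of `b` is cut completely, the lines `0` and `1` are joined at every
vertex. Collapsing them leaves the diagram with two lines for `a`, `c`, `d`. -/
theorem threeConn_nil_left (ha : ClosedOn A a) (hb : ClosedOn A b) (hc : ClosedOn A c)
    (hd : ClosedOn A d) {rc : List ℤ} (hrc : Cuttable c rc) (i j : ℤ) :
    ThreeConn A a b c d [] rc (1, i) (2, j) ↔ SameCircle a c d rc (false, i) (true, j) := by
  rw [sameCircle_eq ha hc hd hrc]
  let φ : Bool → Fin 3 := fun l => if l = true then 2 else 1
  let ψ : Fin 3 → Bool := fun l => decide (l = 2)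
  have hl2 : ∀ l : Bool, l = false ∨ l = true := by decide
  have hside : ∀ (l : Bool) x, side A 1 2 c a rc (Prod.map φ id (l, x)) =
      Prod.map φ id (side A false true c d rc (l, x)) := fun l x =>
    side_map (φ := φ) (s := false) (t := true) rfl rfl (hl2 l) x
  have hψφ : ∀ u : Bool × ℤ, Prod.map ψ id (Prod.map φ (id : ℤ → ℤ) u) = u := by
    rintro ⟨l, x⟩
    cases l <;> rfl
  refine invConn_collapse (σ' := outer a d) (τ' := side A false true c d rc)
    (φ := Prod.map φ id) (ψ := Prod.map ψ id) hψφ ?_ ?_ ?_ ?_ (false, i) (true, j)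
  · rintro ⟨l, x⟩
    have h12 : ∀ l : Bool, InvConn (outer a d) (side A false true c d rc)
        (Prod.map ψ id (Prod.map φ id (l, x)))
        (Prod.map ψ id (side A 1 2 c a rc (Prod.map φ id (l, x)))) := by
      intro l
      rw [hside, hψφ, hψφ]
      exact invConn_right _ _ _
    rcases fin3_cases l with rfl | rfl | rfl
    · rw [side_other (by decide) (by decide)]
      exact invConn_left (outer a d) _ (false, x)
    · exact h12 false
    · exact h12 true
  · rintro ⟨l, x⟩
    by_cases hx : x ∈ A
    · rcases fin3_cases l with rfl | rfl | rfl
      · rw [side_cut_left hx (not_uncut_nil b x)]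
        exact Relation.EqvGen.refl _
      · rw [side_cut_right hx (not_uncut_nil b x)]
        exact Relation.EqvGen.refl _
      · rw [side_other (by decide) (by decide)]
        exact invConn_left (outer a d) _ (true, x)
    · rw [side_not_mem hb hd (Cuttable.nil b) hx]
      exact Relation.EqvGen.refl _
  · rintro ⟨l, x⟩
    by_cases hx : x ∈ A
    · cases l
      -- The cups of `a` sit on the line `0`, whereas the collapsed line is represented by the line
      -- `1`: go down a segment, along the cup, and up again.
      · have h2 := invConn_left (side A 1 2 c a rc) (side A 0 1 b d []) ((0 : Fin 3), x)
        rw [side_other (by decide) (by decide)] at h2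
        exact (threeConn_nil_left_step hx rc).trans _ _ _
          (h2.trans _ _ _ (threeConn_nil_left_step (ha.mate_mem hx) rc).symm)
      · have h2 := invConn_right (side A 1 2 c a rc) (side A 0 1 b d []) ((2 : Fin 3), x)
        rwa [side_other (by decide) (by decide)] at h2
    · have : outer a d (l, x) = (l, x) := by
        rw [outer, ha.mate_of_not_mem hx, hd.mate_of_not_mem hx, ite_self]
      rw [this]
      exact Relation.EqvGen.refl _
  · rintro ⟨l, x⟩
    rw [← hside]
    exact invConn_left _ _ _

theorem threeConn_nil_right (ha : ClosedOn A a) (hb : ClosedOn A b) (hc : ClosedOn A c)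
    (hd : ClosedOn A d) {rb : List ℤ} (hrb : Cuttable b rb) (i j : ℤ) :
    ThreeConn A a b c d rb [] (0, i) (1, j) ↔ SameCircle a b d rb (false, i) (true, j) := by
  rw [sameCircle_eq ha hb hd hrb]
  let φ : Bool → Fin 3 := fun l => if l = true then 1 else 0
  let ψ : Fin 3 → Bool := fun l => decide (l ≠ 0)
  have hl2 : ∀ l : Bool, l = false ∨ l = true := by decide
  have hside : ∀ (l : Bool) x, side A 0 1 b d rb (Prod.map φ id (l, x)) =
      Prod.map φ id (side A false true b d rb (l, x)) := fun l x =>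
    side_map (φ := φ) (s := false) (t := true) rfl rfl (hl2 l) x
  have hψφ : ∀ u : Bool × ℤ, Prod.map ψ id (Prod.map φ (id : ℤ → ℤ) u) = u := by
    rintro ⟨l, x⟩
    cases l <;> rfl
  refine invConn_collapse (σ' := outer a d) (τ' := side A false true b d rb)
    (φ := Prod.map φ id) (ψ := Prod.map ψ id) hψφ ?_ ?_ ?_ ?_ (false, i) (true, j)
  · rintro ⟨l, x⟩
    by_cases hx : x ∈ A
    · rcases fin3_cases l with rfl | rfl | rfl
      · rw [side_other (by decide) (by decide)]
        exact invConn_left (outer a d) _ (false, x)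
      · rw [side_cut_left hx (not_uncut_nil c x)]
        exact Relation.EqvGen.refl _
      · rw [side_cut_right hx (not_uncut_nil c x)]
        exact Relation.EqvGen.refl _
    · rw [side_not_mem hc ha (Cuttable.nil c) hx]
      exact Relation.EqvGen.refl _
  · rintro ⟨l, x⟩
    have h12 : ∀ l : Bool, InvConn (outer a d) (side A false true b d rb)
        (Prod.map ψ id (Prod.map φ id (l, x)))
        (Prod.map ψ id (side A 0 1 b d rb (Prod.map φ id (l, x)))) := by
      intro l
      rw [hside, hψφ, hψφ]
      exact invConn_right _ _ _
    rcases fin3_cases l with rfl | rfl | rfl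
    · exact h12 false
    · exact h12 true
    · rw [side_other (by decide) (by decide)]
      exact invConn_left (outer a d) _ (true, x)
  · rintro ⟨l, x⟩
    by_cases hx : x ∈ A
    · cases l
      · have h2 := invConn_left (side A 1 2 c a []) (side A 0 1 b d rb) ((0 : Fin 3), x)
        rwa [side_other (by decide) (by decide)] at h2
      · have h2 := invConn_right (side A 1 2 c a []) (side A 0 1 b d rb) ((2 : Fin 3), x)
        rw [side_other (by decide) (by decide)] at h2
        exact (threeConn_nil_right_step hx rb).trans _ _ _
          (h2.trans _ _ _ (threeConn_nil_right_step (hd.mate_mem hx) rb).symm)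
    · have : outer a d (l, x) = (l, x) := by
        rw [outer, ha.mate_of_not_mem hx, hd.mate_of_not_mem hx, ite_self]
      rw [this]
      exact Relation.EqvGen.refl _
  · rintro ⟨l, x⟩
    rw [← hside]
    exact invConn_right _ _ _

/-- Two vertices lie on the same circle of the diagram with one number line, the cups of `a`
and the caps of `d`. -/
def LineConn (a d : Labelling) : ℤ → ℤ → Prop :=
  Relation.EqvGen fun i j => IsCup a i j ∨ IsCup d i j

theorem lineConn_mate_left (a d : Labelling) (x : ℤ) : LineConn a d x (mate a x) := by
  by_cases h : ∃ j, IsCup a x j ∨ IsCup a j x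
  · rcases cup_mate h with h' | h'
    · exact Relation.EqvGen.rel _ _ (Or.inl h')
    · exact (Relation.EqvGen.rel (mate a x) x (Or.inl h')).symm
  · rw [mate_of_unmatched h]
    exact Relation.EqvGen.refl _

theorem lineConn_comm {a d : Labelling} {x y : ℤ} (h : LineConn a d x y) : LineConn d a x y :=
  eqvGen_le (fun _ _ h => Relation.EqvGen.rel _ _ h.symm) h

theorem lineConn_mate_right (a d : Labelling) (x : ℤ) : LineConn a d x (mate d x) :=
  lineConn_comm (lineConn_mate_left d a x)

theorem lineConn_of_threeConn (hb : ClosedOn A b) (hc : ClosedOn A c) (ha : ClosedOn A a)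
    (hd : ClosedOn A d) {u v : Fin 3 × ℤ} (h : ThreeConn A a b c d [] [] u v) :
    LineConn a d u.2 v.2 := by
  refine eqvGen_map Prod.snd ?_ h
  rintro ⟨l, x⟩ v (rfl | rfl)
  · by_cases hx : x ∈ A
    · rcases fin3_cases l with rfl | rfl | rfl
      · rw [side_other (by decide) (by decide)]
        exact lineConn_mate_left a d x
      · rw [side_cut_left hx (not_uncut_nil c x)]
        exact Relation.EqvGen.refl _
      · rw [side_cut_right hx (not_uncut_nil c x)]
        exact Relation.EqvGen.refl _
    · rw [side_not_mem hc ha (Cuttable.nil c) hx]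
      exact Relation.EqvGen.refl _
  · by_cases hx : x ∈ A
    · rcases fin3_cases l with rfl | rfl | rfl
      · rw [side_cut_left hx (not_uncut_nil b x)]
        exact Relation.EqvGen.refl _
      · rw [side_cut_right hx (not_uncut_nil b x)]
        exact Relation.EqvGen.refl _
      · rw [side_other (by decide) (by decide)]
        exact lineConn_mate_right a d x
    · rw [side_not_mem hb hd (Cuttable.nil b) hx]
      exact Relation.EqvGen.refl _

theorem lineConn_of_sameCircle {u v : Vertex} (h : SameCircle a b d [] u v) :
    LineConn a d u.2 v.2 := by
  refine eqvGen_map Prod.snd ?_ h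
  rintro u v (⟨i, j, h⟩ | ⟨i, j, h⟩ | ⟨i, j, hi, h⟩ | ⟨i, j, hi, h⟩ | ⟨i, hi, h⟩)
  · exact Relation.EqvGen.rel _ _ (Or.inl h)
  · exact Relation.EqvGen.rel _ _ (Or.inr h)
  · cases hi
  · cases hi
  · exact Relation.EqvGen.refl _

theorem sameCircle_of_lineConn_left (hb : ClosedOn A b) (hd : ClosedOn A d)
    {i j : ℤ} (h : LineConn a d i j) : SameCircle a b d [] (false, i) (false, j) := by
  have seg : ∀ x ∈ A, SameCircle a b d [] (false, x) (true, x) := fun x hx =>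
    Relation.EqvGen.rel _ _ (Joined.segment x ((hb.arrow x).2 hx) (by simp))
  refine eqvGen_map (fun x : ℤ => ((false, x) : Vertex)) ?_ h
  rintro i j (h | h)
  · exact Relation.EqvGen.rel _ _ (Joined.bottom i j h)
  · exact (seg i (hd.left_mem h)).trans _ _ _ ((Relation.EqvGen.rel _ _
      (Joined.top i j h)).trans _ _ _ (seg j (hd.right_mem h)).symm)

end ThreeLines

/-! ## Products of cup diagrams -/

section PathProd

variable (k : Type*) [Field k] {A : Finset ℤ} {a b c d : Labelling}

/-- The element `g` such that the product of the generators of the circle diagrams `a b` and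
`b d` is `g` times the generator of the circle diagram `a d`. -/
noncomputable def gluing (a b d : Labelling) : MvPolynomial ℤ k :=
  MvPolynomial.rename Prod.snd (cutProduct k (SameCircle a b d) (fun i => (false, i))
    (fun i => (true, mate b i)) (leftEnds b))

variable {k}

/-- The product records only which cuts are splits and the names of the generators involved, so it
may be compared across different vertex sets after renaming. -/
theorem cutProduct_rename {W W' : Type*} {E : List ℤ → W → W → Prop}
    {E' : List ℤ → W' → W' → Prop} {x y : ℤ → W} {x' y' : ℤ → W'} {V : Type*} {φ : W → V}
    {φ' : W' → V} {P : List ℤ → Prop} (hP : ∀ i l, P (i :: l) → P l)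
    (h : ∀ i l, P (i :: l) → (E (i :: l) (x i) (y i) ↔ E' (i :: l) (x' i) (y' i)))
    (hx : ∀ i, φ (x i) = φ' (x' i)) (hy : ∀ i, φ (y i) = φ' (y' i)) :
    ∀ l, P l → MvPolynomial.rename φ (cutProduct k E x y l) =
      MvPolynomial.rename φ' (cutProduct k E' x' y' l) := by
  intro l
  induction l with
  | nil => intro _; rw [cutProduct, cutProduct, map_one, map_one]
  | cons i l ih =>
    intro hl
    rw [cutProduct, cutProduct, map_mul, map_mul, ih (hP i l hl), surgeryFactor, surgeryFactor]
    by_cases h' : E (i :: l) (x i) (y i)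
    · rw [if_pos h', if_pos ((h i l hl).1 h')]
      simp only [map_add, MvPolynomial.rename_X, hx, hy]
    · rw [if_neg h', if_neg fun h'' => h' ((h i l hl).2 h''), map_one, map_one]

/-- In the diagram with three lines one may cut all of `b` first and then all of `c`, or the other
way round; the products agree by `cutProduct_comm`. At each of the four stages the circles that
matter are those of a diagram with two lines, which identifies the factors as gluing elements.
Projecting to the position of a vertex identifies the three lines. -/
theorem gluing_assoc (ha : ClosedOn A a) (hb : ClosedOn A b) (hc : ClosedOn A c)
    (hd : ClosedOn A d) :
    gluing k a b c * gluing k a c d - gluing k b c d * gluing k a b d ∈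
      circleIdeal k (LineConn a d) := by
  have hlb := (leftEnds_cuttable hb).1
  have hlc := (leftEnds_cuttable hc).1
  have h := cutProduct_comm (k := k) (E := ThreeConn A a b c d) (x := fun i => (0, i))
    (y := fun i => (1, mate b i)) (z := fun i => (1, i)) (w := fun i => (2, mate c i))
    (P := Cuttable b) (Q := Cuttable c) (fun _ _ h => h.tail) (fun _ _ h => h.tail)
    (Cuttable.nil c)
    (fun i l l' hl hl' => isSurgery_threeConn_left ha hb hc hd hl hl')
    (fun i l l' hl hl' => isSurgery_threeConn_right ha hb hc hd hl hl')
    (leftEnds b) (leftEnds c) hlb hlc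
  have h' := map_circleIdeal (r' := LineConn a d) Prod.snd
    (fun u v huv => lineConn_of_threeConn hb hc ha hd huv) h
  rw [map_sub, map_mul, map_mul] at h'
  unfold gluing
  rw [← cutProduct_rename (E := fun l => ThreeConn A a b c d l (leftEnds c))
      (x := fun i => (0, i)) (y := fun i => (1, mate b i)) (φ := Prod.snd) (P := Cuttable b)
      (fun _ _ h => h.tail) (fun i l hl => threeConn_full_right ha hb hc hl _ _)
      (fun _ => rfl) (fun _ => rfl) _ hlb,
    ← cutProduct_rename (E := ThreeConn A a b c d [])
      (x := fun i => (1, i)) (y := fun i => (2, mate c i)) (φ := Prod.snd) (P := Cuttable c)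
      (fun _ _ h => h.tail) (fun i l hl => threeConn_nil_left ha hb hc hd hl _ _)
      (fun _ => rfl) (fun _ => rfl) _ hlc,
    ← cutProduct_rename (E := ThreeConn A a b c d (leftEnds b))
      (x := fun i => (1, i)) (y := fun i => (2, mate c i)) (φ := Prod.snd) (P := Cuttable c)
      (fun _ _ h => h.tail) (fun i l hl => threeConn_full_left hb hc hd hl _ _)
      (fun _ => rfl) (fun _ => rfl) _ hlc,
    ← cutProduct_rename (E := fun l => ThreeConn A a b c d l [])
      (x := fun i => (0, i)) (y := fun i => (1, mate b i)) (φ := Prod.snd) (P := Cuttable b)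
      (fun _ _ h => h.tail) (fun i l hl => threeConn_nil_right ha hb hc hd hl _ _)
      (fun _ => rfl) (fun _ => rfl) _ hlb]
  exact h'

/-- Multiplication by the gluing element is compatible with the relations on the left. -/
theorem mul_gluing_mem (ha : ClosedOn A a) (hb : ClosedOn A b) (hd : ClosedOn A d)
    {g : MvPolynomial Vertex k} (hg : g ∈ circleIdeal k (SameCircle a b d (leftEnds b))) :
    MvPolynomial.rename Prod.snd g * gluing k a b d ∈ circleIdeal k (LineConn a d) := by
  have h := mul_cutProduct_mem (k := k) (E := SameCircle a b d) (x := fun i => (false, i))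
    (y := fun i => (true, mate b i)) (P := Cuttable b) (fun _ _ h => h.tail)
    (fun i l hl => isSurgery_sameCircle ha hb hd hl) _ (leftEnds_cuttable hb).1 g hg
  have h' := map_circleIdeal (r' := LineConn a d) Prod.snd
    (fun u v huv => lineConn_of_sameCircle huv) h
  rwa [map_mul] at h'

/-- Before any cut, the bottom line of the diagram with two lines carries the circle diagram of `a`
and `b`, so its relations hold there and are transported by the surgeries. -/
theorem mul_gluing_mem_left (ha : ClosedOn A a) (hb : ClosedOn A b) (hd : ClosedOn A d)
    {g : MvPolynomial ℤ k} (hg : g ∈ circleIdeal k (LineConn a b)) :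
    g * gluing k a b d ∈ circleIdeal k (LineConn a d) := by
  have h := map_circleIdeal (r' := SameCircle a b d (leftEnds b)) (fun i : ℤ => ((false, i) : Vertex))
    (fun u v huv => eqvGen_map (fun i : ℤ => ((false, i) : Vertex)) (by
      rintro i j (h | h)
      · exact Relation.EqvGen.rel _ _ (Joined.bottom i j h)
      · exact Relation.EqvGen.rel _ _
          (Joined.middleCap i j ((leftEnds_cuttable hb).2 i j h) h)) huv) hg
  have := mul_gluing_mem ha hb hd h
  rwa [MvPolynomial.rename_rename, show Prod.snd ∘ (fun i : ℤ => ((false, i) : Vertex)) = id from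
    rfl, MvPolynomial.rename_id_apply] at this

theorem mul_gluing_mem_right (ha : ClosedOn A a) (hb : ClosedOn A b) (hd : ClosedOn A d)
    {g : MvPolynomial ℤ k} (hg : g ∈ circleIdeal k (LineConn b d)) :
    g * gluing k a b d ∈ circleIdeal k (LineConn a d) := by
  have h := map_circleIdeal (r' := SameCircle a b d (leftEnds b)) (fun i : ℤ => ((true, i) : Vertex))
    (fun u v huv => eqvGen_map (fun i : ℤ => ((true, i) : Vertex)) (by
      rintro i j (h | h)
      · exact Relation.EqvGen.rel _ _
          (Joined.middleCup i j ((leftEnds_cuttable hb).2 i j h) h)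
      · exact Relation.EqvGen.rel _ _ (Joined.top i j h)) huv) hg
  have := mul_gluing_mem ha hb hd h
  rwa [MvPolynomial.rename_rename, show Prod.snd ∘ (fun i : ℤ => ((true, i) : Vertex)) = id from
    rfl, MvPolynomial.rename_id_apply] at this

end PathProd


/-! ## Standard orientations -/

/-- A diagram with two number lines and no rays at an intermediate stage of the surgery
procedure. -/
structure Diagram (A : Finset ℤ) (a b d : Labelling) (rem : List ℤ) : Prop where
  left : ClosedOn A a
  middle : ClosedOn A b
  right : ClosedOn A d
  cuttable : Cuttable b rem

open Classical in
/-- The number of vertices of `C` on the line `l` to the left of `x`. -/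
noncomputable def lineCount (A : Finset ℤ) (C : Vertex → Prop) (l : Bool) (x : ℤ) : ℕ :=
  (A.filter fun y => y < x ∧ C (l, y)).card

/-- The version of `leftParity_cup` that counts only vertices of `C`: the left end contributes one,
and the inside contributes evenly because `C` respects the matching there. -/
theorem ClosedOn.lineCount_cup {A : Finset ℤ} {f : Labelling} (hf : ClosedOn A f)
    {C : Vertex → Prop} {l : Bool} {i j : ℤ} (h : IsCup f i j) (hi : C (l, i))
    (hC : ∀ x ∈ A, i < x → x < j → C (l, x) → C (l, mate f x)) :
    (Even (lineCount A C l j) ↔ ¬ Even (lineCount A C l i)) := by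
  classical
  have hev := hf.even_inside (C := fun x => C (l, x)) h hC
  have hij := h.1
  have hiA := hf.left_mem h
  have hsplit : (A.filter fun y => y < j ∧ C (l, y)) =
      insert i ((A.filter fun y => y < i ∧ C (l, y)) ∪
        A.filter fun x => (i < x ∧ x < j) ∧ C (l, x)) := by
    ext x
    simp only [Finset.mem_filter, Finset.mem_insert, Finset.mem_union]
    constructor
    · rintro ⟨h1, h2, h4⟩
      rcases lt_trichotomy x i with h3 | h3 | h3
      · exact Or.inr (Or.inl ⟨h1, h3, h4⟩)
      · exact Or.inl h3
      · exact Or.inr (Or.inr ⟨h1, ⟨h3, h2⟩, h4⟩)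
    · rintro (rfl | ⟨h1, h2, h3⟩ | ⟨h1, ⟨h2, h3⟩, h4⟩)
      · exact ⟨hiA, hij, hi⟩
      · exact ⟨h1, h2.trans hij, h3⟩
      · exact ⟨h1, h3, h4⟩
  have hcard : lineCount A C l j = lineCount A C l i +
      (A.filter fun x => (i < x ∧ x < j) ∧ C (l, x)).card + 1 := by
    unfold lineCount
    rw [hsplit, Finset.card_insert_of_notMem, Finset.card_union_of_disjoint]
    · rw [Finset.disjoint_left]
      intro x h1 h2
      rw [Finset.mem_filter] at h1 h2
      omega
    · simp
  rw [hcard]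
  simp only [Nat.even_iff] at hev ⊢
  omega

namespace Diagram

variable {A : Finset ℤ} {a b d : Labelling} {rem : List ℤ}

theorem tail {i : ℤ} (D : Diagram A a b d (i :: rem)) : Diagram A a b d rem :=
  ⟨D.left, D.middle, D.right, D.cuttable.tail⟩

theorem joined_mem (D : Diagram A a b d rem) {u v : Vertex} (h : Joined a b d rem u v) :
    u.2 ∈ A ∧ v.2 ∈ A := by
  rcases h with ⟨i, j, h⟩ | ⟨i, j, h⟩ | ⟨i, j, hi, h⟩ | ⟨i, j, hi, h⟩ | ⟨i, hi, h⟩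
  · exact ⟨D.left.left_mem h, D.left.right_mem h⟩
  · exact ⟨D.right.left_mem h, D.right.right_mem h⟩
  · exact ⟨D.middle.left_mem h, D.middle.right_mem h⟩
  · exact ⟨D.middle.left_mem h, D.middle.right_mem h⟩
  · exact ⟨(D.middle.arrow i).1 hi, (D.middle.arrow i).1 hi⟩

theorem mem_iff (D : Diagram A a b d rem) {u v : Vertex} (h : SameCircle a b d rem u v) :
    u.2 ∈ A ↔ v.2 ∈ A := by
  induction h with
  | rel u v h => exact iff_of_true (D.joined_mem h).1 (D.joined_mem h).2
  | refl => exact Iff.rfl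
  | symm _ _ _ ih => exact ih.symm
  | trans _ _ _ _ _ ih1 ih2 => exact ih1.trans ih2

theorem joined_outer_left (D : Diagram A a b d rem) {x : ℤ} (hx : x ∈ A) :
    SameCircle a b d rem (false, x) (false, mate a x) := by
  rcases D.left.cup_mate hx with h | h
  · exact Relation.EqvGen.rel _ _ (Joined.bottom _ _ h)
  · exact (Relation.EqvGen.rel _ _ (Joined.bottom _ _ h)).symm

theorem joined_outer_right (D : Diagram A a b d rem) {x : ℤ} (hx : x ∈ A) :
    SameCircle a b d rem (true, x) (true, mate d x) := by
  rcases D.right.cup_mate hx with h | h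
  · exact Relation.EqvGen.rel _ _ (Joined.top _ _ h)
  · exact (Relation.EqvGen.rel _ _ (Joined.top _ _ h)).symm

theorem joined_middle (D : Diagram A a b d rem) (l : Bool) {x : ℤ} (hx : Uncut b rem x) :
    SameCircle a b d rem (l, x) (l, mate b x) := by
  have hmid : ∀ i j, i ∈ rem → IsCup b i j → SameCircle a b d rem (l, i) (l, j) := by
    intro i j hi h
    cases l
    · exact Relation.EqvGen.rel _ _ (Joined.middleCap i j hi h)
    · exact Relation.EqvGen.rel _ _ (Joined.middleCup i j hi h)
  obtain ⟨i, j, hi, hij, rfl | rfl⟩ := D.cuttable.exists_cup hx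
  · rw [hij.mate_left]
    exact hmid _ _ hi hij
  · rw [hij.mate_right]
    exact (hmid _ _ hi hij).symm

theorem joined_segment (D : Diagram A a b d rem) {x : ℤ} (hA : x ∈ A) (hx : ¬ Uncut b rem x) :
    SameCircle a b d rem (false, x) (true, x) :=
  Relation.EqvGen.rel _ _ (Joined.segment x ((D.middle.arrow x).2 hA) fun l hl =>
    ⟨fun h => hx ⟨l, hl, Or.inl h⟩, fun h => hx ⟨l, hl, Or.inr h⟩⟩)

theorem uncut_inside (D : Diagram A a b d rem) {i j x : ℤ} (hi : i ∈ rem) (h : IsCup b i j)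
    (hx : x ∈ A) (h1 : i < x) (h2 : x < j) : Uncut b rem x := by
  rcases D.middle.cup_mate hx with h' | h'
  · exact (uncut_left h').2 (D.cuttable.upward i hi _ _ h1 h')
  · exact (D.cuttable.uncut_right h').2
      (D.cuttable.upward i hi _ _ (D.middle.mate_mem_Ioo h hx h1 h2).1 h')

/-- A union of circles has, up to an even number, the same vertices on both number lines to the
left of a vertical segment. -/
theorem even_lineCount_segment (D : Diagram A a b d rem) {C : Vertex → Prop}
    (hC : ∀ u v, SameCircle a b d rem u v → C u → C v) {x : ℤ} (hxA : x ∈ A)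
    (hx : ¬ Uncut b rem x) :
    Even (lineCount A C false x) ↔ Even (lineCount A C true x) := by
  classical
  -- At cut positions to the left of `x` both lines have the same membership in `C`. Uncut positions
  -- come in pairs on each line, since the partner is again to the left of `x`: an uncut cup cannot
  -- surround or end at the cut position `x`.
  have hsplit : ∀ l, lineCount A C l x =
      (A.filter fun y => (y < x ∧ ¬ Uncut b rem y) ∧ C (false, y)).card +
        (A.filter fun y => (y < x ∧ Uncut b rem y) ∧ C (l, y)).card := by
    intro l
    have h1 : (A.filter fun y => (y < x ∧ ¬ Uncut b rem y) ∧ C (false, y)) =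
        A.filter fun y => (y < x ∧ ¬ Uncut b rem y) ∧ C (l, y) := by
      refine Finset.filter_congr fun y hy => and_congr_right fun h => ?_
      cases l
      · exact Iff.rfl
      · have := D.joined_segment hy h.2
        exact ⟨hC _ _ this, hC _ _ this.symm⟩
    rw [h1, lineCount, ← Finset.card_union_of_disjoint]
    · congr 1
      ext y
      simp only [Finset.mem_union, Finset.mem_filter]
      tauto
    · rw [Finset.disjoint_left]
      intro y h1 h2
      rw [Finset.mem_filter] at h1 h2
      exact h1.2.1.2 h2.2.1.2
  have hev : ∀ l, Even (A.filter fun y => (y < x ∧ Uncut b rem y) ∧ C (l, y)).card := by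
    intro l
    refine D.middle.even_card fun y hy => ?_
    rw [Finset.mem_filter] at hy
    obtain ⟨hyA, ⟨hyx, hu⟩, hCy⟩ := hy
    refine ⟨hyA, Finset.mem_filter.2 ⟨D.middle.mate_mem hyA,
      ⟨?_, D.cuttable.uncut_mate hu⟩, hC _ _ (D.joined_middle l hu) hCy⟩⟩
    obtain ⟨i, j, hi, hij, rfl | rfl⟩ := D.cuttable.exists_cup hu
    · rw [hij.mate_left]
      by_contra hlt
      rcases (not_lt.mp hlt).eq_or_lt with he | hl
      · subst he
        exact hx ((D.cuttable.uncut_right hij).2 hi)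
      · exact hx (D.uncut_inside hi hij hxA hyx hl)
    · rw [hij.mate_right]
      exact hij.1.trans hyx
  rw [hsplit, hsplit, Nat.even_add, Nat.even_add]
  simp only [hev]

end Diagram

open Classical in
/-- The orientation of all circles of type `1`. -/
noncomputable def stdLabel (A : Finset ℤ) (r : Vertex → Vertex → Prop) (v : Vertex) : Label :=
  if Even (lineCount A (r v) v.1 v.2) then Label.down else Label.up

theorem stdLabel_eq_down {A : Finset ℤ} {r : Vertex → Vertex → Prop} {v : Vertex} :
    stdLabel A r v = Label.down ↔ Even (lineCount A (r v) v.1 v.2) := by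
  unfold stdLabel
  split_ifs with h <;> simp [h]

theorem stdLabel_eq_up {A : Finset ℤ} {r : Vertex → Vertex → Prop} {v : Vertex} :
    stdLabel A r v = Label.up ↔ ¬ Even (lineCount A (r v) v.1 v.2) := by
  unfold stdLabel
  split_ifs with h <;> simp [h]

theorem stdLabel_isArrow (A : Finset ℤ) (r : Vertex → Vertex → Prop) (v : Vertex) :
    (stdLabel A r v).IsArrow := by
  unfold stdLabel
  split_ifs
  · exact Or.inl rfl
  · exact Or.inr rfl

theorem class_eq {W : Type*} {r : W → W → Prop} (hr : Equivalence r) {u v : W} (h : r u v) :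
    r u = r v := by
  funext w
  exact propext ⟨hr.trans (hr.symm h), hr.trans h⟩

theorem sameCircle_equivalence (a b d : Labelling) (rem : List ℤ) :
    Equivalence (SameCircle a b d rem) := Relation.EqvGen.is_equivalence _

namespace Diagram

variable {A : Finset ℤ} {a b d : Labelling} {rem : List ℤ}

theorem opposite_of_even {r : Vertex → Vertex → Prop} (hr : Equivalence r) {l : Bool} {i j : ℤ}
    (hij : r (l, i) (l, j))
    (h : Even (lineCount A (r (l, i)) l j) ↔ ¬ Even (lineCount A (r (l, i)) l i)) :
    Opposite (stdLabel A r (l, i)) (stdLabel A r (l, j)) := by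
  unfold stdLabel
  rw [← class_eq hr hij]
  by_cases h' : Even (lineCount A (r (l, i)) l i)
  · rw [if_pos h', if_neg fun h'' => h.1 h'' h']
    exact Or.inl ⟨rfl, rfl⟩
  · rw [if_neg h', if_pos (h.2 h')]
    exact Or.inr ⟨rfl, rfl⟩

/-- Parity replaces the Jordan curve theorem. Along a cup the count of vertices of the circle to the
left changes parity by `lineCount_cup`, and along a segment the parities on the two lines agree by
`even_lineCount_segment`. For a middle cup this needs that all cups inside an uncut cup are uncut,
which is why cuts go from left to right. -/
theorem consistent_std (D : Diagram A a b d rem) :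
    Consistent a b d rem (stdLabel A (SameCircle a b d rem)) := by
  have hr := sameCircle_equivalence a b d rem
  intro u v huv
  have huv' : SameCircle a b d rem u v := Relation.EqvGen.rel _ _ huv
  rcases huv with ⟨i, j, h⟩ | ⟨i, j, h⟩ | ⟨i, j, hi, h⟩ | ⟨i, j, hi, h⟩ | ⟨i, hi, h⟩
  · exact ⟨fun _ => opposite_of_even hr huv' (D.left.lineCount_cup h (hr.refl _)
      fun x hx _ _ hC => hr.trans hC (D.joined_outer_left hx)), fun h => absurd rfl h⟩
  · exact ⟨fun _ => opposite_of_even hr huv' (D.right.lineCount_cup h (hr.refl _)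
      fun x hx _ _ hC => hr.trans hC (D.joined_outer_right hx)), fun h => absurd rfl h⟩
  · exact ⟨fun _ => opposite_of_even hr huv' (D.middle.lineCount_cup h (hr.refl _)
      fun x hx h1 h2 hC => hr.trans hC (D.joined_middle _ (D.uncut_inside hi h hx h1 h2))),
      fun h => absurd rfl h⟩
  · exact ⟨fun _ => opposite_of_even hr huv' (D.middle.lineCount_cup h (hr.refl _)
      fun x hx h1 h2 hC => hr.trans hC (D.joined_middle _ (D.uncut_inside hi h hx h1 h2))),
      fun h => absurd rfl h⟩
  · refine ⟨fun h => absurd h Bool.false_ne_true, fun _ => ⟨?_, stdLabel_isArrow _ _ _⟩⟩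
    have hx : ¬ Uncut b rem i := by
      rintro ⟨l, hl, h'⟩
      exact h'.elim (h l hl).1 (h l hl).2
    have := D.even_lineCount_segment (C := SameCircle a b d rem (false, i))
      (fun u v h h' => hr.trans h' h) ((D.middle.arrow i).1 hi) hx
    unfold stdLabel
    rw [← class_eq hr huv']
    exact if_congr this rfl rfl

theorem consistent_isArrow (D : Diagram A a b d rem) {o : Orientation}
    (ho : Consistent a b d rem o) {v : Vertex} (hv : v.2 ∈ A) : (o v).IsArrow := by
  have key : ∀ {l l' : Label}, Opposite l l' → l.IsArrow ∧ l'.IsArrow := by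
    rintro l l' (⟨h, h'⟩ | ⟨h, h'⟩)
    · exact ⟨Or.inl h, Or.inr h'⟩
    · exact ⟨Or.inr h, Or.inl h'⟩
  obtain ⟨l, x⟩ := v
  cases l
  · rcases D.left.cup_mate hv with h | h
    · exact (key ((ho _ _ (Joined.bottom _ _ h)).1 rfl)).1
    · exact (key ((ho _ _ (Joined.bottom _ _ h)).1 rfl)).2
  · rcases D.right.cup_mate hv with h | h
    · exact (key ((ho _ _ (Joined.top _ _ h)).1 rfl)).1
    · exact (key ((ho _ _ (Joined.top _ _ h)).1 rfl)).2

/-- An orientation is consistent if and only if on every circle it either is the standard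
orientation or its opposite. -/
theorem consistent_iff (D : Diagram A a b d rem) {o : Orientation} :
    Consistent a b d rem o ↔ (∀ v : Vertex, v.2 ∈ A → (o v).IsArrow) ∧
      ∀ u v, SameCircle a b d rem u v →
        (o u = stdLabel A (SameCircle a b d rem) u ↔
          o v = stdLabel A (SameCircle a b d rem) v) := by
  have hs := D.consistent_std
  constructor
  · intro ho
    refine ⟨fun v => D.consistent_isArrow ho, fun u v huv => ?_⟩
    induction huv with
    | rel u v h =>
      have h1 := hs u v h
      have h2 := ho u v h
      by_cases hl : u.1 = v.1
      · rcases h1.1 hl with ⟨e1, e2⟩ | ⟨e1, e2⟩ <;> rcases h2.1 hl with ⟨e3, e4⟩ | ⟨e3, e4⟩ <;>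
          simp [e1, e2, e3, e4]
      · rw [(h1.2 hl).1, (h2.2 hl).1]
    | refl => exact Iff.rfl
    | symm _ _ _ ih => exact ih.symm
    | trans _ _ _ _ _ ih1 ih2 => exact ih1.trans ih2
  · rintro ⟨ha, ho⟩ u v huv
    have h1 := hs u v huv
    have h2 := ho u v (Relation.EqvGen.rel _ _ huv)
    have hu := ha u (D.joined_mem huv).1
    have hv := ha v (D.joined_mem huv).2
    refine ⟨fun hl => ?_, fun hl => ⟨?_, hu⟩⟩
    · rcases h1.1 hl with ⟨e1, e2⟩ | ⟨e1, e2⟩ <;> rw [e1, e2] at h2 <;>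
        rcases hu with e3 | e3 <;> rcases hv with e4 | e4 <;> simp [e3, e4] at h2 <;>
        simp [Opposite, e3, e4]
    · rw [(h1.2 hl).1] at h2
      rcases (h1.2 hl).2 with e1 | e1 <;>
        rcases hu with e3 | e3 <;> rcases hv with e4 | e4 <;>
        simp [← (h1.2 hl).1, e1, e3, e4] at h2 ⊢

end Diagram

/-- The vertex `v` is the leftmost one in its class; in case of a tie, the vertex on the bottom
line is chosen. -/
def IsLead (r : Vertex → Vertex → Prop) (v : Vertex) : Prop :=
  ∀ w, r v w → v.2 < w.2 ∨ (v.2 = w.2 ∧ v.1 ≤ w.1)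

theorem IsLead.eq {r : Vertex → Vertex → Prop} (hr : Equivalence r) {u v : Vertex}
    (hu : IsLead r u) (hv : IsLead r v) (h : r u v) : u = v := by
  have h1 := hu v h
  have h2 := hv u (hr.symm h)
  have h3 : u.2 = v.2 := by
    rcases h1 with h1 | h1
    · rcases h2 with h2 | h2
      · omega
      · exact h2.1.symm
    · exact h1.1
  rw [h3] at h1 h2
  exact Prod.ext (le_antisymm (h1.resolve_left (lt_irrefl _)).2
    (h2.resolve_left (lt_irrefl _)).2) h3

theorem IsLead.le {r : Vertex → Vertex → Prop} {u v : Vertex} (hu : IsLead r u) (h : r u v) :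
    u.2 ≤ v.2 := (hu v h).elim le_of_lt fun h => h.1.le

theorem stdLabel_of_leftmost (A : Finset ℤ) {r : Vertex → Vertex → Prop} {v : Vertex}
    (h : ∀ w, r v w → v.2 ≤ w.2) : stdLabel A r v = Label.down := by
  have h0 : lineCount A (r v) v.1 v.2 = 0 := by
    classical
    rw [lineCount, Finset.card_eq_zero, Finset.filter_eq_empty_iff]
    rintro x - ⟨h1, h2⟩
    exact absurd h1 (not_lt.2 (h _ h2))
  rw [stdLabel_eq_down, h0]
  exact Even.zero

theorem IsLead.stdLabel {A : Finset ℤ} {r : Vertex → Vertex → Prop} {v : Vertex}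
    (h : IsLead r v) : stdLabel A r v = Label.down :=
  stdLabel_of_leftmost A fun _ hw => h.le hw

namespace Diagram

variable {A : Finset ℤ} {a b d : Labelling} {rem : List ℤ}

theorem exists_lead (D : Diagram A a b d rem) {v : Vertex} (hv : v.2 ∈ A) :
    ∃ u, SameCircle a b d rem v u ∧ IsLead (SameCircle a b d rem) u := by
  classical
  have hr := sameCircle_equivalence a b d rem
  -- Lexicographic order with the position first and the line second, which is the order in the
  -- definition of `IsLead`.
  let S : Finset (ℤ ×ₗ Bool) := ((Finset.univ ×ˢ A : Finset Vertex).filter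
    (SameCircle a b d rem v)).image fun u => toLex (u.2, u.1)
  have hS : S.Nonempty := ⟨toLex (v.2, v.1), Finset.mem_image.2 ⟨v, by simp [hv, hr.refl v], rfl⟩⟩
  obtain ⟨u, hu, hmin⟩ := Finset.mem_image.1 (S.min'_mem hS)
  rw [Finset.mem_filter] at hu
  refine ⟨u, hu.2, fun w hw => ?_⟩
  have hvw := hr.trans hu.2 hw
  have hwS : toLex (w.2, w.1) ∈ S := Finset.mem_image.2 ⟨w, by
    simp [hvw, (D.mem_iff hvw).1 hv], rfl⟩
  have := S.min'_le _ hwS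
  rw [← hmin, Prod.Lex.toLex_le_toLex] at this
  exact this

/-- The type is defined at a leftmost vertex, where the standard label is `down`. A consistent
orientation agrees with the standard one on all of a circle or nowhere on it, so the type can be
read off at any vertex. -/
theorem hasType_one_iff (D : Diagram A a b d rem) {o : Orientation}
    (ho : Consistent a b d rem o) {v : Vertex} (hv : v.2 ∈ A) :
    HasType a b d rem o v CircleType.one ↔ o v = stdLabel A (SameCircle a b d rem) v := by
  have h := (D.consistent_iff.1 ho).2
  have hr := sameCircle_equivalence a b d rem
  constructor
  · rintro ⟨u, hu, hmin, hou⟩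
    rw [h v u hu, hou]
    exact (stdLabel_of_leftmost A fun w hw => hmin w (hr.trans hu hw)).symm
  · intro hov
    obtain ⟨u, hu, hl⟩ := D.exists_lead hv
    refine ⟨u, hu, fun w hw => hl.le (hr.trans (hr.symm hu) hw), ?_⟩
    rw [(h v u hu).1 hov, hl.stdLabel]
    rfl

theorem hasType_x_iff (D : Diagram A a b d rem) {o : Orientation}
    (ho : Consistent a b d rem o) {v : Vertex} (hv : v.2 ∈ A) :
    HasType a b d rem o v CircleType.x ↔ o v ≠ stdLabel A (SameCircle a b d rem) v := by
  have h := (D.consistent_iff.1 ho).2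
  have hr := sameCircle_equivalence a b d rem
  constructor
  · rintro ⟨u, hu, hmin, hou⟩
    rw [Ne, h v u hu, hou]
    rw [stdLabel_of_leftmost A fun w hw => hmin w (hr.trans hu hw)]
    exact fun h => by cases h
  · intro hov
    obtain ⟨u, hu, hl⟩ := D.exists_lead hv
    refine ⟨u, hu, fun w hw => hl.le (hr.trans (hr.symm hu) hw), ?_⟩
    rw [Ne, h v u hu, hl.stdLabel] at hov
    exact (D.consistent_isArrow ho ((D.mem_iff hu).1 hv)).resolve_left hov

/-- For a consistent orientation, a leftmost vertex is labelled `up` if and only if its circle is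
clockwise. -/
theorem lead_eq_up_iff (D : Diagram A a b d rem) {o : Orientation}
    (ho : Consistent a b d rem o) {u v : Vertex} (hv : v.2 ∈ A)
    (huv : SameCircle a b d rem v u) (hu : IsLead (SameCircle a b d rem) u) :
    o u = Label.up ↔ o v ≠ stdLabel A (SameCircle a b d rem) v := by
  rw [Ne, (D.consistent_iff.1 ho).2 v u huv, hu.stdLabel]
  rcases D.consistent_isArrow ho ((D.mem_iff huv).1 hv) with h | h <;> simp [h]

end Diagram


/-! ## A single surgery -/

namespace Diagram

variable {A : Finset ℤ} {a b d : Labelling} {rem : List ℤ} {i : ℤ}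

theorem isSurgery (D : Diagram A a b d (i :: rem)) :
    IsSurgery (SameCircle a b d (i :: rem)) (SameCircle a b d rem) (false, i)
      (true, mate b i) :=
  isSurgery_sameCircle D.left D.middle D.right D.cuttable

theorem head_mem (D : Diagram A a b d (i :: rem)) : i ∈ A := D.middle.left_mem D.cuttable.cup_head

theorem mate_head_mem (D : Diagram A a b d (i :: rem)) : mate b i ∈ A :=
  D.middle.right_mem D.cuttable.cup_head

theorem head_uncut (D : Diagram A a b d (i :: rem)) (l : Bool) :
    SameCircle a b d (i :: rem) (l, i) (l, mate b i) :=
  D.joined_middle l ((uncut_left D.cuttable.cup_head).2 List.mem_cons_self)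

theorem head_cut_left (D : Diagram A a b d (i :: rem)) :
    SameCircle a b d rem (false, i) (true, i) :=
  D.tail.joined_segment D.head_mem fun h => ((D.cuttable.uncut_tail i).1 h).2.1 rfl

theorem head_cut_right (D : Diagram A a b d (i :: rem)) :
    SameCircle a b d rem (false, mate b i) (true, mate b i) :=
  D.tail.joined_segment D.mate_head_mem fun h => ((D.cuttable.uncut_tail _).1 h).2.2 rfl

/-- Joining the diagonal pair gives the same relation before and after the cut, and the class of
that pair is the union of the circles through the pair in both cases. -/
theorem class_union (D : Diagram A a b d (i :: rem)) (v : Vertex) :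
    (SameCircle a b d (i :: rem) (false, i) v ∨ SameCircle a b d (i :: rem) (true, i) v) ↔
      (SameCircle a b d rem (false, i) v ∨ SameCircle a b d rem (false, mate b i) v) := by
  have hS := D.isSurgery
  have T := @hS.equiv.trans
  have S := @hS.equiv.symm
  have R := hS.equiv.refl
  have T' := @hS.equiv'.trans
  have S' := @hS.equiv'.symm
  have R' := hS.equiv'.refl
  have h1 := D.head_uncut true
  have h2 := D.head_cut_right
  have j1 := hS.join (false, i) v
  have j2 := hS.join (true, mate b i) v
  unfold JoinRel at j1 j2
  constructor
  · rintro (h | h)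
    · rcases j1.1 (Or.inl h) with h | ⟨-, h⟩ | ⟨-, h⟩
      · exact Or.inl h
      · exact Or.inr (T' h2 (S' h))
      · exact Or.inl (S' h)
    · rcases j2.1 (Or.inl (T (S h1) h)) with h | ⟨-, h⟩ | ⟨-, h⟩
      · exact Or.inr (T' h2 h)
      · exact Or.inr (T' h2 (S' h))
      · exact Or.inl (S' h)
  · rintro (h | h)
    · rcases j1.2 (Or.inl h) with h | ⟨-, h⟩ | ⟨-, h⟩
      · exact Or.inl h
      · exact Or.inr (T h1 (S h))
      · exact Or.inl (S h)
    · rcases j2.2 (Or.inl (T' (S' h2) h)) with h | ⟨-, h⟩ | ⟨-, h⟩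
      · exact Or.inr (T h1 h)
      · exact Or.inr (T h1 (S h))
      · exact Or.inl (S h)

/-- Circles away from the surgery do not change. -/
theorem class_off (D : Diagram A a b d (i :: rem)) {v : Vertex}
    (h1 : ¬ SameCircle a b d (i :: rem) (false, i) v)
    (h2 : ¬ SameCircle a b d (i :: rem) (true, i) v) :
    SameCircle a b d (i :: rem) v = SameCircle a b d rem v := by
  have hS := D.isSurgery
  have h3 := mt (D.class_union v).2 (not_or.2 ⟨h1, h2⟩)
  rw [not_or] at h3
  have h4 := D.head_uncut true
  have h5 := D.head_cut_right
  funext w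
  refine propext ⟨fun h => ?_, fun h => ?_⟩
  · rcases (hS.join v w).1 (Or.inl h) with h | ⟨h, -⟩ | ⟨h, -⟩
    · exact h
    · exact absurd (hS.equiv'.symm h) h3.1
    · exact absurd (hS.equiv'.trans h5 (hS.equiv'.symm h)) h3.2
  · rcases (hS.join v w).2 (Or.inl h) with h | ⟨h, -⟩ | ⟨h, -⟩
    · exact h
    · exact absurd (hS.equiv.symm h) h1
    · exact absurd (hS.equiv.trans h4 (hS.equiv.symm h)) h2

theorem stdLabel_off (D : Diagram A a b d (i :: rem)) {v : Vertex}
    (h1 : ¬ SameCircle a b d (i :: rem) (false, i) v)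
    (h2 : ¬ SameCircle a b d (i :: rem) (true, i) v) :
    stdLabel A (SameCircle a b d (i :: rem)) v = stdLabel A (SameCircle a b d rem) v := by
  unfold stdLabel
  rw [D.class_off h1 h2]

end Diagram

/-- The orientation `o'` of the diagram obtained by cutting the first pair arises from `o` by
re-orienting circles that meet this pair. -/
def Reoriented (a b d : Labelling) (i : ℤ) (rem : List ℤ) (o o' : Orientation) : Prop :=
  Consistent a b d rem o' ∧ ∀ v, ¬ SameCircle a b d (i :: rem) (false, i) v →
    ¬ SameCircle a b d (i :: rem) (true, i) v → o' v = o v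

/-- The opposite label. -/
def Label.flip : Label → Label
  | Label.down => Label.up
  | Label.up => Label.down
  | l => l

theorem Label.IsArrow.eq_flip_of_ne {l l' : Label} (h : l.IsArrow) (h' : l'.IsArrow)
    (hne : l ≠ l') : l = l'.flip := by
  rcases h with rfl | rfl <;> rcases h' with rfl | rfl <;> first | rfl | exact absurd rfl hne

theorem Label.IsArrow.flip {l : Label} (h : l.IsArrow) : l.flip.IsArrow := by
  rcases h with rfl | rfl
  · exact Or.inr rfl
  · exact Or.inl rfl

theorem Label.IsArrow.flip_ne {l : Label} (h : l.IsArrow) : l.flip ≠ l := by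
  rcases h with rfl | rfl <;> exact fun h => by cases h

namespace Diagram

variable {A : Finset ℤ} {a b d : Labelling} {rem : List ℤ} {i : ℤ}

/-- Only the circles through the two new segments are free, and each of them has a standard
orientation and its opposite. The propositions `t₁`, `t₂` prescribe the choice; `ht` is the
compatibility needed when both segments lie on one circle. -/
theorem exists_reoriented (D : Diagram A a b d (i :: rem)) {o : Orientation}
    (ho : Consistent a b d (i :: rem) o) {t₁ t₂ : Prop}
    (ht : SameCircle a b d rem (false, i) (false, mate b i) → (t₁ ↔ t₂)) :
    ∃ o₀, ∀ o', (Reoriented a b d i rem o o' ∧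
      (o' (false, i) = stdLabel A (SameCircle a b d rem) (false, i) ↔ t₁) ∧
      (o' (false, mate b i) = stdLabel A (SameCircle a b d rem) (false, mate b i) ↔ t₂)) ↔
        o' = o₀ := by
  classical
  have hr := sameCircle_equivalence a b d rem
  set r' := SameCircle a b d rem with hr'
  let lab : Prop → Vertex → Label := fun t v =>
    if t then stdLabel A r' v else (stdLabel A r' v).flip
  have hlab : ∀ t v, lab t v = stdLabel A r' v ↔ t := by
    intro t v
    by_cases ht : t
    · simp [lab, ht]
    · simp only [lab, ht, if_false, iff_false]
      exact (stdLabel_isArrow A r' v).flip_ne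
  have hlabA : ∀ t v, (lab t v).IsArrow := by
    intro t v
    by_cases ht : t
    · simp only [lab, ht, if_true]
      exact stdLabel_isArrow A r' v
    · simp only [lab, ht, if_false]
      exact (stdLabel_isArrow A r' v).flip
  have huniq : ∀ t v l, l.IsArrow → (l = stdLabel A r' v ↔ t) → l = lab t v := by
    intro t v l hl h
    by_cases ht : t
    · simp only [lab, ht, if_true]
      exact h.2 ht
    · simp only [lab, ht, if_false]
      exact hl.eq_flip_of_ne (stdLabel_isArrow A r' v) fun h' => ht (h.1 h')
  let o₀ : Orientation := fun v =>
    if r' (false, i) v then lab t₁ v else if r' (false, mate b i) v then lab t₂ v else o v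
  have e1 : ∀ v, r' (false, i) v → o₀ v = lab t₁ v := fun v h => if_pos h
  have e2 : ∀ v, r' (false, mate b i) v → o₀ v = lab t₂ v := by
    intro v h
    by_cases h' : r' (false, i) v
    · rw [e1 v h', propext (ht (hr.trans h' (hr.symm h)))]
    · simp only [o₀, h', if_false, h, if_true]
  have e3 : ∀ v, ¬ r' (false, i) v → ¬ r' (false, mate b i) v → o₀ v = o v := by
    intro v h h'
    simp only [o₀, h, h', if_false]
  have hcon : Consistent a b d rem o₀ := by
    rw [D.tail.consistent_iff]
    constructor
    · intro v hv
      by_cases h1 : r' (false, i) v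
      · rw [e1 v h1]
        exact hlabA _ _
      by_cases h2 : r' (false, mate b i) v
      · rw [e2 v h2]
        exact hlabA _ _
      rw [e3 v h1 h2]
      exact D.consistent_isArrow ho hv
    · intro u v huv
      by_cases h1 : r' (false, i) u
      · rw [e1 u h1, e1 v (hr.trans h1 huv), hlab, hlab]
      by_cases h2 : r' (false, mate b i) u
      · rw [e2 u h2, e2 v (hr.trans h2 huv), hlab, hlab]
      have h1' : ¬ r' (false, i) v := fun h => h1 (hr.trans h (hr.symm huv))
      have h2' : ¬ r' (false, mate b i) v := fun h => h2 (hr.trans h (hr.symm huv))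
      have hu := not_or.1 (mt (D.class_union u).1 (not_or.2 ⟨h1, h2⟩))
      have hv := not_or.1 (mt (D.class_union v).1 (not_or.2 ⟨h1', h2'⟩))
      rw [e3 u h1 h2, e3 v h1' h2', ← D.stdLabel_off hu.1 hu.2, ← D.stdLabel_off hv.1 hv.2]
      refine (D.consistent_iff.1 ho).2 u v ?_
      rw [D.class_off hu.1 hu.2]
      exact huv
  refine ⟨o₀, fun o' => ⟨?_, ?_⟩⟩
  · rintro ⟨⟨hc, hoff⟩, hp, hp'⟩
    have hc' := D.tail.consistent_iff.1 hc
    funext v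
    by_cases h1 : r' (false, i) v
    · rw [e1 v h1]
      refine huniq _ _ _ (hc'.1 v ((D.tail.mem_iff h1).1 D.head_mem)) ?_
      rw [← hc'.2 _ _ h1]
      exact hp
    by_cases h2 : r' (false, mate b i) v
    · rw [e2 v h2]
      refine huniq _ _ _ (hc'.1 v ((D.tail.mem_iff h2).1 D.mate_head_mem)) ?_
      rw [← hc'.2 _ _ h2]
      exact hp'
    rw [e3 v h1 h2]
    have hv := not_or.1 (mt (D.class_union v).1 (not_or.2 ⟨h1, h2⟩))
    exact hoff v hv.1 hv.2
  · rintro rfl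
    refine ⟨⟨hcon, fun v h1 h2 => ?_⟩, ?_, ?_⟩
    · have hv := not_or.1 (mt (D.class_union v).2 (not_or.2 ⟨h1, h2⟩))
      exact e3 v hv.1 hv.2
    · rw [e1 _ (hr.refl _), hlab]
    · rw [e2 _ (hr.refl _), hlab]

/-- The merge table read with "anti-clockwise" as a truth value: two clockwise circles give nothing,
and otherwise the result is the conjunction. -/
theorem surgeryStep_merge_iff (D : Diagram A a b d (i :: rem)) {o o' : Orientation}
    (ho : Consistent a b d (i :: rem) o)
    (hm : ¬ SameCircle a b d (i :: rem) (false, i) (true, i)) :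
    SurgeryStep a b d i rem o o' ↔ Reoriented a b d i rem o o' ∧
      ¬ (o (false, i) ≠ stdLabel A (SameCircle a b d (i :: rem)) (false, i) ∧
        o (true, i) ≠ stdLabel A (SameCircle a b d (i :: rem)) (true, i)) ∧
      (o' (false, i) = stdLabel A (SameCircle a b d rem) (false, i) ↔
        (o (false, i) = stdLabel A (SameCircle a b d (i :: rem)) (false, i) ∧
        o (true, i) = stdLabel A (SameCircle a b d (i :: rem)) (true, i))) := by
  have h1 := D.hasType_one_iff ho (v := (false, i)) D.head_mem
  have h2 := D.hasType_one_iff ho (v := (true, i)) D.head_mem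
  have h3 := D.hasType_x_iff ho (v := (false, i)) D.head_mem
  have h4 := D.hasType_x_iff ho (v := (true, i)) D.head_mem
  constructor
  · rintro ⟨hc, hoff, hmr, -⟩
    have h5 := D.tail.hasType_one_iff hc (v := (false, i)) D.head_mem
    have h6 := D.tail.hasType_x_iff hc (v := (false, i)) D.head_mem
    obtain ⟨t₁, t₂, t, hrule, g1, g2, g3⟩ := hmr hm
    refine ⟨⟨hc, hoff⟩, ?_⟩
    cases hrule
    · exact ⟨fun h => h.1 (h1.1 g1), fun _ => ⟨h1.1 g1, h2.1 g2⟩, fun _ => h5.1 g3⟩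
    · exact ⟨fun h => h.1 (h1.1 g1), fun h => absurd h (h6.1 g3), fun h => absurd h.2 (h4.1 g2)⟩
    · exact ⟨fun h => h.2 (h2.1 g2), fun h => absurd h (h6.1 g3), fun h => absurd h.1 (h3.1 g1)⟩
  · rintro ⟨⟨hc, hoff⟩, hne, hiff⟩
    have h5 := D.tail.hasType_one_iff hc (v := (false, i)) D.head_mem
    have h6 := D.tail.hasType_x_iff hc (v := (false, i)) D.head_mem
    refine ⟨hc, hoff, fun _ => ?_, fun h => absurd h hm⟩
    by_cases g1 : o (false, i) = stdLabel A (SameCircle a b d (i :: rem)) (false, i) <;>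
      by_cases g2 : o (true, i) = stdLabel A (SameCircle a b d (i :: rem)) (true, i)
    · exact ⟨_, _, _, MergeRule.one_one, h1.2 g1, h2.2 g2, h5.2 (hiff.2 ⟨g1, g2⟩)⟩
    · exact ⟨_, _, _, MergeRule.one_x, h1.2 g1, h4.2 g2, h6.2 fun h => g2 (hiff.1 h).2⟩
    · exact ⟨_, _, _, MergeRule.x_one, h3.2 g1, h2.2 g2, h6.2 fun h => g1 (hiff.1 h).1⟩
    · exact absurd ⟨g1, g2⟩ hne

/-- The split table read with "anti-clockwise" as a truth value: the new circles are never both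
anti-clockwise, and the old circle is anti-clockwise if and only if one of them is. -/
theorem surgeryStep_split_iff (D : Diagram A a b d (i :: rem)) {o o' : Orientation}
    (ho : Consistent a b d (i :: rem) o)
    (hs : SameCircle a b d (i :: rem) (false, i) (true, i)) :
    SurgeryStep a b d i rem o o' ↔ Reoriented a b d i rem o o' ∧
      ¬ (o' (false, i) = stdLabel A (SameCircle a b d rem) (false, i) ∧
        o' (false, mate b i) = stdLabel A (SameCircle a b d rem) (false, mate b i)) ∧
      (o (false, i) = stdLabel A (SameCircle a b d (i :: rem)) (false, i) ↔
        (o' (false, i) = stdLabel A (SameCircle a b d rem) (false, i) ∨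
        o' (false, mate b i) = stdLabel A (SameCircle a b d rem) (false, mate b i))) := by
  have h1 := D.hasType_one_iff ho (v := (false, i)) D.head_mem
  have h3 := D.hasType_x_iff ho (v := (false, i)) D.head_mem
  have hcup := D.cuttable.cup_head
  constructor
  · rintro ⟨hc, hoff, -, hsr⟩
    have h5 := D.tail.hasType_one_iff hc (v := (false, i)) D.head_mem
    have h6 := D.tail.hasType_x_iff hc (v := (false, i)) D.head_mem
    have h7 := D.tail.hasType_one_iff hc (v := (false, mate b i)) D.mate_head_mem
    have h8 := D.tail.hasType_x_iff hc (v := (false, mate b i)) D.mate_head_mem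
    obtain ⟨t, t₁, t₂, j, hrule, hj, g1, g2, g3⟩ := hsr hs
    rw [← hj.mate_left] at g3
    refine ⟨⟨hc, hoff⟩, ?_⟩
    cases hrule
    · exact ⟨fun h => h8.1 g3 h.2, fun _ => Or.inl (h5.1 g2), fun _ => h1.1 g1⟩
    · exact ⟨fun h => h6.1 g2 h.1, fun _ => Or.inr (h7.1 g3), fun _ => h1.1 g1⟩
    · exact ⟨fun h => h6.1 g2 h.1, fun h => absurd h (h3.1 g1),
        fun h => absurd h (not_or.2 ⟨h6.1 g2, h8.1 g3⟩)⟩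
  · rintro ⟨⟨hc, hoff⟩, hne, hiff⟩
    have h5 := D.tail.hasType_one_iff hc (v := (false, i)) D.head_mem
    have h6 := D.tail.hasType_x_iff hc (v := (false, i)) D.head_mem
    have h7 := D.tail.hasType_one_iff hc (v := (false, mate b i)) D.mate_head_mem
    have h8 := D.tail.hasType_x_iff hc (v := (false, mate b i)) D.mate_head_mem
    refine ⟨hc, hoff, fun h => absurd hs h, fun _ => ?_⟩
    by_cases g1 : o' (false, i) = stdLabel A (SameCircle a b d rem) (false, i) <;>
      by_cases g2 : o' (false, mate b i) = stdLabel A (SameCircle a b d rem) (false, mate b i)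
    · exact absurd ⟨g1, g2⟩ hne
    · exact ⟨_, _, _, _, SplitRule.one_left, hcup, h1.2 (hiff.2 (Or.inl g1)), h5.2 g1, h8.2 g2⟩
    · exact ⟨_, _, _, _, SplitRule.one_right, hcup, h1.2 (hiff.2 (Or.inr g2)), h6.2 g1, h7.2 g2⟩
    · exact ⟨_, _, _, _, SplitRule.x, hcup, h3.2 fun h => (hiff.1 h).elim g1 g2, h6.2 g1,
        h8.2 g2⟩

end Diagram

/-! ## Monomials of orientations -/

open Classical in
/-- The contribution of the vertex `v` to the monomial of an orientation. -/
noncomputable def leadTerm (k : Type*) [Field k] (r : Vertex → Vertex → Prop) (o : Orientation)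
    (v : Vertex) : MvPolynomial Vertex k :=
  if IsLead r v ∧ o v = Label.up then MvPolynomial.X v else 1

/-- The product of the generators of all clockwise circles. -/
noncomputable def circleMonomial (k : Type*) [Field k] (A : Finset ℤ)
    (r : Vertex → Vertex → Prop) (o : Orientation) : MvPolynomial Vertex k :=
  ∏ v ∈ Finset.univ ×ˢ A, leadTerm k r o v

open Classical in
/-- `1` or the generator `X v`, depending on the type of the circle of `v`. -/
noncomputable def typeTerm (k : Type*) [Field k] (A : Finset ℤ) (r : Vertex → Vertex → Prop)
    (o : Orientation) (v : Vertex) : MvPolynomial Vertex k :=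
  if o v = stdLabel A r v then 1 else MvPolynomial.X v

namespace Diagram

variable {k : Type*} [Field k] {A : Finset ℤ} {a b d : Labelling} {rem : List ℤ} {i : ℤ}

open Classical in
-- A circle has exactly one lead vertex, so at most one factor is not `1`, and the generator of the
-- lead equals that of `v` modulo the ideal.
theorem prod_class (D : Diagram A a b d rem) {o : Orientation} (ho : Consistent a b d rem o)
    {v : Vertex} (hv : v.2 ∈ A) :
    Ideal.Quotient.mk (circleIdeal k (SameCircle a b d rem))
      (∏ w ∈ (Finset.univ ×ˢ A).filter (SameCircle a b d rem v),
        leadTerm k (SameCircle a b d rem) o w) =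
    Ideal.Quotient.mk (circleIdeal k (SameCircle a b d rem))
      (typeTerm k A (SameCircle a b d rem) o v) := by
  have hr := sameCircle_equivalence a b d rem
  obtain ⟨u, hu, hl⟩ := D.exists_lead hv
  have hmem : u ∈ (Finset.univ ×ˢ A).filter (SameCircle a b d rem v) := by
    simp [hu, (D.mem_iff hu).1 hv]
  rw [Finset.prod_eq_single_of_mem u hmem]
  · have h := D.lead_eq_up_iff ho hv hu hl
    unfold leadTerm typeTerm
    by_cases h' : o v = stdLabel A (SameCircle a b d rem) v
    · rw [if_pos h', if_neg fun h'' => h.1 h''.2 h']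
    · rw [if_neg h', if_pos ⟨hl, h.2 h'⟩, Ideal.Quotient.eq]
      exact sub_mem_circleIdeal (hr.symm hu)
  · intro w hw hne
    rw [Finset.mem_filter] at hw
    rw [leadTerm, if_neg]
    rintro ⟨h, -⟩
    exact hne (h.eq hr hl (hr.trans (hr.symm hw.2) hu))

open Classical in
/-- The contribution of the circles away from the surgery. -/
noncomputable def offTerm (k : Type*) [Field k] (A : Finset ℤ) (a b d : Labelling) (i : ℤ)
    (rem : List ℤ) (o : Orientation) : MvPolynomial Vertex k :=
  ∏ v ∈ (Finset.univ ×ˢ A).filter fun v => ¬ (SameCircle a b d (i :: rem) (false, i) v ∨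
    SameCircle a b d (i :: rem) (true, i) v), leadTerm k (SameCircle a b d (i :: rem)) o v

theorem monomial_before_merge (D : Diagram A a b d (i :: rem)) {o : Orientation}
    (ho : Consistent a b d (i :: rem) o)
    (hm : ¬ SameCircle a b d (i :: rem) (false, i) (true, i)) :
    Ideal.Quotient.mk (circleIdeal k (SameCircle a b d (i :: rem)))
      (circleMonomial k A (SameCircle a b d (i :: rem)) o) =
    Ideal.Quotient.mk (circleIdeal k (SameCircle a b d (i :: rem)))
      (typeTerm k A (SameCircle a b d (i :: rem)) o (false, i) *
        typeTerm k A (SameCircle a b d (i :: rem)) o (true, i) * offTerm k A a b d i rem o) := by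
  classical
  have hr := sameCircle_equivalence a b d (i :: rem)
  have hdisj : Disjoint
      ((Finset.univ ×ˢ A).filter (SameCircle a b d (i :: rem) (false, i)))
      ((Finset.univ ×ˢ A).filter (SameCircle a b d (i :: rem) (true, i))) := by
    rw [Finset.disjoint_left]
    intro v h1 h2
    rw [Finset.mem_filter] at h1 h2
    exact hm (hr.trans h1.2 (hr.symm h2.2))
  rw [circleMonomial, ← Finset.prod_filter_mul_prod_filter_not _ (fun v =>
    SameCircle a b d (i :: rem) (false, i) v ∨ SameCircle a b d (i :: rem) (true, i) v),
    Finset.filter_or, Finset.prod_union hdisj, map_mul, map_mul, D.prod_class ho D.head_mem,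
    D.prod_class ho D.head_mem, map_mul, map_mul, offTerm]

theorem monomial_before_split (D : Diagram A a b d (i :: rem)) {o : Orientation}
    (ho : Consistent a b d (i :: rem) o)
    (hs : SameCircle a b d (i :: rem) (false, i) (true, i)) :
    Ideal.Quotient.mk (circleIdeal k (SameCircle a b d (i :: rem)))
      (circleMonomial k A (SameCircle a b d (i :: rem)) o) =
    Ideal.Quotient.mk (circleIdeal k (SameCircle a b d (i :: rem)))
      (typeTerm k A (SameCircle a b d (i :: rem)) o (false, i) * offTerm k A a b d i rem o) := by
  classical
  have hr := sameCircle_equivalence a b d (i :: rem)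
  have hor : ∀ v, (SameCircle a b d (i :: rem) (false, i) v ∨
      SameCircle a b d (i :: rem) (true, i) v) ↔ SameCircle a b d (i :: rem) (false, i) v := by
    intro v
    rw [class_eq hr hs, or_self]
  rw [circleMonomial, ← Finset.prod_filter_mul_prod_filter_not _ (fun v =>
    SameCircle a b d (i :: rem) (false, i) v ∨ SameCircle a b d (i :: rem) (true, i) v),
    Finset.filter_congr (fun v _ => hor v), map_mul, D.prod_class ho D.head_mem, map_mul, offTerm]

open Classical in
theorem offTerm_eq (D : Diagram A a b d (i :: rem)) {o o' : Orientation}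
    (h : Reoriented a b d i rem o o') :
      offTerm k A a b d i rem o = ∏ v ∈ (Finset.univ ×ˢ A).filter
        (fun v => ¬ (SameCircle a b d rem (false, i) v ∨
          SameCircle a b d rem (false, mate b i) v)), leadTerm k (SameCircle a b d rem) o' v := by
  classical
  rw [offTerm]
  refine Finset.prod_congr (Finset.filter_congr fun v _ => not_congr (D.class_union v)) ?_
  intro v hv
  rw [Finset.mem_filter, ← D.class_union, not_or] at hv
  unfold leadTerm IsLead
  rw [D.class_off hv.2.1 hv.2.2, h.2 v hv.2.1 hv.2.2]

theorem monomial_after_split (D : Diagram A a b d (i :: rem)) {o o' : Orientation}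
    (h : Reoriented a b d i rem o o')
    (hs : ¬ SameCircle a b d rem (false, i) (false, mate b i)) :
    Ideal.Quotient.mk (circleIdeal k (SameCircle a b d rem))
      (circleMonomial k A (SameCircle a b d rem) o') =
    Ideal.Quotient.mk (circleIdeal k (SameCircle a b d rem))
      (typeTerm k A (SameCircle a b d rem) o' (false, i) *
        typeTerm k A (SameCircle a b d rem) o' (false, mate b i) *
          offTerm k A a b d i rem o) := by
  classical
  have hr := sameCircle_equivalence a b d rem
  have hdisj : Disjoint
      ((Finset.univ ×ˢ A).filter (SameCircle a b d rem (false, i)))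
      ((Finset.univ ×ˢ A).filter (SameCircle a b d rem (false, mate b i))) := by
    rw [Finset.disjoint_left]
    intro v h1 h2
    rw [Finset.mem_filter] at h1 h2
    exact hs (hr.trans h1.2 (hr.symm h2.2))
  rw [circleMonomial, ← Finset.prod_filter_mul_prod_filter_not _ (fun v =>
    SameCircle a b d rem (false, i) v ∨ SameCircle a b d rem (false, mate b i) v),
    Finset.filter_or, Finset.prod_union hdisj, map_mul, map_mul,
    D.tail.prod_class h.1 D.head_mem, D.tail.prod_class h.1 D.mate_head_mem, map_mul, map_mul,
    D.offTerm_eq h]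

theorem monomial_after_merge (D : Diagram A a b d (i :: rem)) {o o' : Orientation}
    (h : Reoriented a b d i rem o o')
    (hm : SameCircle a b d rem (false, i) (false, mate b i)) :
    Ideal.Quotient.mk (circleIdeal k (SameCircle a b d rem))
      (circleMonomial k A (SameCircle a b d rem) o') =
    Ideal.Quotient.mk (circleIdeal k (SameCircle a b d rem))
      (typeTerm k A (SameCircle a b d rem) o' (false, i) * offTerm k A a b d i rem o) := by
  classical
  have hr := sameCircle_equivalence a b d rem
  have hor : ∀ v, (SameCircle a b d rem (false, i) v ∨
      SameCircle a b d rem (false, mate b i) v) ↔ SameCircle a b d rem (false, i) v := by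
    intro v
    rw [class_eq hr hm, or_self]
  rw [circleMonomial, ← Finset.prod_filter_mul_prod_filter_not _ (fun v =>
    SameCircle a b d rem (false, i) v ∨ SameCircle a b d rem (false, mate b i) v),
    Finset.filter_congr (fun v _ => hor v), map_mul, D.tail.prod_class h.1 D.head_mem, map_mul,
    D.offTerm_eq h]

/-- The effect of a surgery on monomials. -/
theorem exists_surgeryStep_sum (D : Diagram A a b d (i :: rem)) {o : Orientation}
    (ho : Consistent a b d (i :: rem) o) :
    ∃ s : Finset Orientation, (∀ o', o' ∈ s ↔ SurgeryStep a b d i rem o o') ∧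
      ∑ o' ∈ s, circleMonomial k A (SameCircle a b d rem) o' -
        circleMonomial k A (SameCircle a b d (i :: rem)) o *
          surgeryFactor k (SameCircle a b d (i :: rem)) (false, i) (true, mate b i) ∈
        circleIdeal k (SameCircle a b d rem) := by
  classical
  have hS := D.isSurgery
  have hr := hS.equiv
  have hr' := hS.equiv'
  have hiff : SameCircle a b d (i :: rem) (false, i) (true, mate b i) ↔
      SameCircle a b d (i :: rem) (false, i) (true, i) :=
    ⟨fun h => hr.trans h (hr.symm (D.head_uncut true)), fun h => hr.trans h (D.head_uncut true)⟩
  have hiff' : SameCircle a b d rem (false, i) (true, mate b i) ↔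
      SameCircle a b d rem (false, i) (false, mate b i) :=
    ⟨fun h => hr'.trans h (hr'.symm D.head_cut_right), fun h => hr'.trans h D.head_cut_right⟩
  have hdich := hS.dichotomy
  rw [hiff, hiff'] at hdich
  set r := SameCircle a b d (i :: rem) with hrdef
  set r' := SameCircle a b d rem with hrdef'
  -- Monomials are simplified modulo the relations before the cut; multiplying by the factor carries
  -- such a congruence to one modulo the relations after the cut.
  have push : ∀ f g : MvPolynomial Vertex k,
      Ideal.Quotient.mk (circleIdeal k r) f = Ideal.Quotient.mk (circleIdeal k r) g →
      Ideal.Quotient.mk (circleIdeal k r') (f * surgeryFactor k r (false, i) (true, mate b i)) =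
      Ideal.Quotient.mk (circleIdeal k r')
        (g * surgeryFactor k r (false, i) (true, mate b i)) := by
    intro f g hfg
    rw [Ideal.Quotient.eq, ← sub_mul]
    exact hS.mul_factor_mem (Ideal.Quotient.eq.1 hfg)
  by_cases hs : r (false, i) (true, i)
  · have hs' := hdich.1 hs
    have hbefore := push _ _ (D.monomial_before_split ho hs)
    have hfac : surgeryFactor k r (false, i) (true, mate b i) =
        MvPolynomial.X (false, i) + MvPolynomial.X (true, mate b i) :=
      if_pos (hiff.2 hs)
    have hX : Ideal.Quotient.mk (circleIdeal k r') (MvPolynomial.X (true, mate b i)) =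
        Ideal.Quotient.mk (circleIdeal k r') (MvPolynomial.X (false, mate b i)) :=
      Ideal.Quotient.eq.2 (sub_mem_circleIdeal (hr'.symm D.head_cut_right))
    have hsq : Ideal.Quotient.mk (circleIdeal k r') (MvPolynomial.X (false, i) ^ 2) = 0 :=
      Ideal.Quotient.eq_zero_iff_mem.2 (sq_mem_circleIdeal _ _)
    rw [map_pow] at hsq
    by_cases g : o (false, i) = stdLabel A r (false, i)
    -- An anti-clockwise circle splits into two terms, one for each choice of the clockwise new
    -- circle. These are the two summands of the factor.
    · obtain ⟨o₁, h1⟩ := D.exists_reoriented ho (t₁ := True) (t₂ := False)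
        (fun h => absurd h hs')
      obtain ⟨o₂, h2⟩ := D.exists_reoriented ho (t₁ := False) (t₂ := True)
        (fun h => absurd h hs')
      simp only [iff_true, iff_false] at h1 h2
      have h1' := (h1 o₁).2 rfl
      have h2' := (h2 o₂).2 rfl
      have hne : o₁ ≠ o₂ := by
        rintro rfl
        exact h2'.2.1 h1'.2.1
      refine ⟨{o₁, o₂}, fun o' => ?_, ?_⟩
      · rw [D.surgeryStep_split_iff ho hs, Finset.mem_insert, Finset.mem_singleton, ← h1, ← h2]
        tauto
      · rw [← Ideal.Quotient.eq, hbefore, Finset.sum_pair hne, map_add,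
          D.monomial_after_split h1'.1 hs', D.monomial_after_split h2'.1 hs', hfac]
        unfold typeTerm
        rw [if_pos h1'.2.1, if_neg h1'.2.2, if_neg h2'.2.1, if_pos h2'.2.2, if_pos g]
        simp only [map_mul, map_add, map_one, hX]
        ring
    -- A clockwise circle contributes one generator already. Multiplied by the sum of both
    -- generators, its own square vanishes, and only the term with both circles clockwise remains.
    · obtain ⟨o₁, h1⟩ := D.exists_reoriented ho (t₁ := False) (t₂ := False)
        (fun h => absurd h hs')
      simp only [iff_false] at h1
      have h1' := (h1 o₁).2 rfl
      refine ⟨{o₁}, fun o' => ?_, ?_⟩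
      · rw [D.surgeryStep_split_iff ho hs, Finset.mem_singleton, ← h1]
        tauto
      · rw [← Ideal.Quotient.eq, hbefore, Finset.sum_singleton,
          D.monomial_after_split h1'.1 hs', hfac]
        unfold typeTerm
        rw [if_neg h1'.2.1, if_neg h1'.2.2, if_neg g]
        simp only [map_mul, map_add, hX]
        linear_combination (-Ideal.Quotient.mk (circleIdeal k r') (offTerm k A a b d i rem o)) * hsq
  · have hs' : r' (false, i) (false, mate b i) := by
      by_contra h
      exact hs (hdich.2 h)
    have hbefore := push _ _ (D.monomial_before_merge ho hs)
    have hfac : surgeryFactor k r (false, i) (true, mate b i) = 1 :=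
      if_neg fun h => hs (hiff.1 h)
    rw [hfac, mul_one, mul_one] at hbefore
    rw [hfac, mul_one]
    have hX : Ideal.Quotient.mk (circleIdeal k r') (MvPolynomial.X (true, i)) =
        Ideal.Quotient.mk (circleIdeal k r') (MvPolynomial.X (false, i)) :=
      Ideal.Quotient.eq.2 (sub_mem_circleIdeal (hr'.symm D.head_cut_left))
    have hsq : Ideal.Quotient.mk (circleIdeal k r') (MvPolynomial.X (false, i) ^ 2) = 0 :=
      Ideal.Quotient.eq_zero_iff_mem.2 (sq_mem_circleIdeal _ _)
    rw [map_pow] at hsq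
    -- In a merge the two segments lie on one circle, so both truth values coincide and at most one
    -- orientation results.
    have hgen : ∀ t : Prop, ((o (false, i) = stdLabel A r (false, i) ∧
        o (true, i) = stdLabel A r (true, i)) ↔ t) →
        ¬ (o (false, i) ≠ stdLabel A r (false, i) ∧ o (true, i) ≠ stdLabel A r (true, i)) →
        ∃ o₁, (∀ o', SurgeryStep a b d i rem o o' ↔ o' = o₁) ∧ Reoriented a b d i rem o o₁ ∧
          (o₁ (false, i) = stdLabel A r' (false, i) ↔ t) := by
      intro t ht hne
      obtain ⟨o₁, h1⟩ := D.exists_reoriented ho (t₁ := t) (t₂ := t) (fun _ => Iff.rfl)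
      refine ⟨o₁, fun o' => ?_, ((h1 o₁).2 rfl).1, ((h1 o₁).2 rfl).2.1⟩
      rw [← h1, D.surgeryStep_merge_iff ho hs, ht]
      constructor
      · rintro ⟨e1, -, e2⟩
        refine ⟨e1, e2, ?_⟩
        rw [← (D.tail.consistent_iff.1 e1.1).2 _ _ hs']
        exact e2
      · rintro ⟨e1, e2, -⟩
        exact ⟨e1, hne, e2⟩
    by_cases g1 : o (false, i) = stdLabel A r (false, i) <;>
      by_cases g2 : o (true, i) = stdLabel A r (true, i)
    · obtain ⟨o₁, h1, h2, h3⟩ := hgen True (by simp [g1, g2]) (by simp [g1])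
      refine ⟨{o₁}, fun o' => by rw [h1, Finset.mem_singleton], ?_⟩
      rw [← Ideal.Quotient.eq, hbefore, Finset.sum_singleton, D.monomial_after_merge h2 hs']
      unfold typeTerm
      rw [if_pos (h3.2 trivial), if_pos g1, if_pos g2, one_mul, one_mul, one_mul]
    · obtain ⟨o₁, h1, h2, h3⟩ := hgen False (by simp [g2]) (by simp [g1])
      refine ⟨{o₁}, fun o' => by rw [h1, Finset.mem_singleton], ?_⟩
      rw [← Ideal.Quotient.eq, hbefore, Finset.sum_singleton, D.monomial_after_merge h2 hs']
      unfold typeTerm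
      rw [if_neg h3.1, if_pos g1, if_neg g2, one_mul, map_mul, map_mul, hX]
    · obtain ⟨o₁, h1, h2, h3⟩ := hgen False (by simp [g1]) (by simp [g2])
      refine ⟨{o₁}, fun o' => by rw [h1, Finset.mem_singleton], ?_⟩
      rw [← Ideal.Quotient.eq, hbefore, Finset.sum_singleton, D.monomial_after_merge h2 hs']
      unfold typeTerm
      rw [if_neg h3.1, if_neg g1, if_pos g2, mul_one]
    -- Two clockwise circles merge to zero, which matches the square of the common generator.
    · refine ⟨∅, fun o' => ?_, ?_⟩
      · rw [D.surgeryStep_merge_iff ho hs]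
        exact ⟨fun h => absurd h (Finset.notMem_empty _), fun h => absurd ⟨g1, g2⟩ h.2.1⟩
      · rw [← Ideal.Quotient.eq, hbefore, Finset.sum_empty]
        unfold typeTerm
        rw [if_neg g1, if_neg g2, map_mul, map_mul, hX, ← pow_two, hsq, zero_mul, map_zero]

theorem exists_surgeries_sum (D : Diagram A a b d (i :: rem)) {o : Orientation}
    (ho : Consistent a b d (i :: rem) o) :
    ∃ s : Finset Orientation, (∀ o', o' ∈ s ↔ SurgeryStep a b d i rem o o') ∧
      surgeries k a b d (i :: rem) o = ∑ o' ∈ s, surgeries k a b d rem o' ∧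
      ∑ o' ∈ s, circleMonomial k A (SameCircle a b d rem) o' -
        circleMonomial k A (SameCircle a b d (i :: rem)) o *
          surgeryFactor k (SameCircle a b d (i :: rem)) (false, i) (true, mate b i) ∈
        circleIdeal k (SameCircle a b d rem) := by
  obtain ⟨s, h1, h2⟩ := D.exists_surgeryStep_sum (k := k) ho
  refine ⟨s, h1, ?_, h2⟩
  rw [surgeries, ← finsum_mem_coe_finset]
  exact finsum_mem_congr (Set.ext fun o' => (h1 o').symm) fun _ _ => rfl

/-- The result of all surgeries, expressed by monomials. -/
theorem surgeries_monomial : ∀ {rem : List ℤ}, Diagram A a b d rem → ∀ {o : Orientation},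
    Consistent a b d rem o →
    Finsupp.linearCombination k (circleMonomial k A (SameCircle a b d []))
      (surgeries k a b d rem o) -
      circleMonomial k A (SameCircle a b d rem) o *
        cutProduct k (SameCircle a b d) (fun i => (false, i)) (fun i => (true, mate b i)) rem ∈
    circleIdeal k (SameCircle a b d [])
  | [], _, o, _ => by
    rw [surgeries, Finsupp.linearCombination_single, one_smul, cutProduct, mul_one, sub_self]
    exact zero_mem _
  | i :: rem, D, o, ho => by
    obtain ⟨s, h1, h2, h3⟩ := D.exists_surgeries_sum (k := k) ho
    have h4 := mul_cutProduct_mem (k := k) (E := SameCircle a b d) (x := fun i => (false, i))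
      (y := fun i => (true, mate b i)) (P := Cuttable b) (fun _ _ h => h.tail)
      (fun i l hl => isSurgery_sameCircle D.left D.middle D.right hl) _ D.tail.cuttable _ h3
    have h5 : ∑ o' ∈ s, (Finsupp.linearCombination k
        (circleMonomial k A (SameCircle a b d [])) (surgeries k a b d rem o') -
        circleMonomial k A (SameCircle a b d rem) o' * cutProduct k (SameCircle a b d)
          (fun i => (false, i)) (fun i => (true, mate b i)) rem) ∈
        circleIdeal k (SameCircle a b d []) :=
      sum_mem fun o' ho' => surgeries_monomial D.tail ((h1 o').1 ho').1
    rw [Finset.sum_sub_distrib, ← Finset.sum_mul] at h5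
    rw [h2, map_sum, cutProduct]
    convert add_mem h5 h4 using 1
    ring

end Diagram


/-! ## The product of closed diagrams -/

/-- Every cup of `f` has one end labelled `down` and one end labelled `up` in `g`. -/
def Fits (f g : Labelling) : Prop := ∀ i j, IsCup f i j → Opposite (g i) (g j)

theorem fits_self (f : Labelling) : Fits f f := fun _ _ h => Or.inl ⟨h.2.1, h.2.2.1⟩

theorem Opposite.isArrow {l l' : Label} (h : Opposite l l') : l.IsArrow ∧ l'.IsArrow := by
  rcases h with ⟨h, h'⟩ | ⟨h, h'⟩
  · exact ⟨Or.inl h, Or.inr h'⟩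
  · exact ⟨Or.inr h, Or.inl h'⟩

theorem Fits.isArrow {A : Finset ℤ} {f g : Labelling} (hf : ClosedOn A f) (h : Fits f g) {i : ℤ}
    (hi : i ∈ A) : (g i).IsArrow := by
  rcases hf.cup_mate hi with h' | h'
  · exact (h _ _ h').isArrow.1
  · exact (h _ _ h').isArrow.2

/-- The orientations of the closed circle diagram with cups `a` and caps `d` which coincide with
`base` outside of `A`. -/
def Oriented (A : Finset ℤ) (a d base : Labelling) : Set Labelling :=
  {ν | Fits a ν ∧ Fits d ν ∧ ∀ i, i ∉ A → ν i = base i}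

theorem finite_oriented (A : Finset ℤ) (a d base : Labelling) : (Oriented A a d base).Finite := by
  have : Finite Label := Finite.of_injective
    (fun l : Label => match l with
      | Label.nought => (0 : Fin 4) | Label.cross => 1 | Label.down => 2 | Label.up => 3)
    (by intro x y; cases x <;> cases y <;> simp)
  refine Set.Finite.of_injOn (f := fun (ν : Labelling) (i : A) => ν i) (t := Set.univ)
    (fun _ _ => trivial) ?_ Set.finite_univ
  intro ν hν ν' hν' h
  funext i
  by_cases hi : i ∈ A
  · exact congrFun h ⟨i, hi⟩
  · rw [hν.2.2 i hi, hν'.2.2 i hi]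

theorem mem_oriented_comm {A : Finset ℤ} {a d base ν : Labelling} :
    ν ∈ Oriented A a d base ↔ ν ∈ Oriented A d a base :=
  ⟨fun h => ⟨h.2.1, h.1, h.2.2⟩, fun h => ⟨h.2.1, h.1, h.2.2⟩⟩

/-! ### Monomials of circle diagrams with one number line. -/

section LineMonomial

open Classical in
/-- The product of the generators of all clockwise circles. -/
noncomputable def lineMonomial (k : Type*) [Field k] (A : Finset ℤ) (a d ν : Labelling) :
    MvPolynomial ℤ k :=
  ∏ i ∈ A, if (∀ j, LineConn a d i j → i ≤ j) ∧ ν i = Label.up then MvPolynomial.X i else 1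

variable {k : Type*} [Field k] {A : Finset ℤ} {a b d : Labelling}

theorem lineConn_eq_comm (a d : Labelling) : LineConn a d = LineConn d a := by
  funext i j
  exact propext ⟨lineConn_comm, lineConn_comm⟩

theorem lineMonomial_comm (ν : Labelling) :
    lineMonomial k A a d ν = lineMonomial k A d a ν := by
  rw [lineMonomial, lineMonomial, lineConn_eq_comm]

theorem lineConn_equivalence (a d : Labelling) : Equivalence (LineConn a d) :=
  Relation.EqvGen.is_equivalence _

theorem lineConn_mem_iff (ha : ClosedOn A a) (hd : ClosedOn A d) {i j : ℤ}
    (h : LineConn a d i j) : i ∈ A ↔ j ∈ A := by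
  induction h with
  | rel i j h =>
    rcases h with h | h
    · exact iff_of_true (ha.left_mem h) (ha.right_mem h)
    · exact iff_of_true (hd.left_mem h) (hd.right_mem h)
  | refl => exact Iff.rfl
  | symm _ _ _ ih => exact ih.symm
  | trans _ _ _ _ _ ih1 ih2 => exact ih1.trans ih2

theorem exists_lineLead (ha : ClosedOn A a) (hd : ClosedOn A d) {i : ℤ} (hi : i ∈ A) :
    ∃ j, LineConn a d i j ∧ ∀ l, LineConn a d j l → j ≤ l := by
  classical
  have hr := lineConn_equivalence a d
  let S := A.filter (LineConn a d i)
  have hS : S.Nonempty := ⟨i, Finset.mem_filter.2 ⟨hi, hr.refl i⟩⟩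
  have hm := Finset.mem_filter.1 (S.min'_mem hS)
  refine ⟨S.min' hS, hm.2, fun l hl => S.min'_le l (Finset.mem_filter.2 ⟨?_, hr.trans hm.2 hl⟩)⟩
  exact (lineConn_mem_iff ha hd hl).1 hm.1

/-- The orientations of a circle are determined by the label of any of its vertices. -/
theorem fits_eq_iff {ν ν' : Labelling} (h1 : Fits a ν) (h2 : Fits d ν) (h1' : Fits a ν')
    (h2' : Fits d ν') {i j : ℤ} (h : LineConn a d i j) : ν i = ν' i ↔ ν j = ν' j := by
  have key : ∀ {l₁ l₂ l₃ l₄ : Label}, Opposite l₁ l₂ → Opposite l₃ l₄ → (l₁ = l₃ ↔ l₂ = l₄) := by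
    rintro l₁ l₂ l₃ l₄ (⟨rfl, rfl⟩ | ⟨rfl, rfl⟩) (⟨rfl, rfl⟩ | ⟨rfl, rfl⟩) <;> simp
  induction h with
  | rel i j h =>
    rcases h with h | h
    · exact key (h1 i j h) (h1' i j h)
    · exact key (h2 i j h) (h2' i j h)
  | refl => exact Iff.rfl
  | symm _ _ _ ih => exact ih.symm
  | trans _ _ _ _ _ ih1 ih2 => exact ih1.trans ih2

/-- The monomials of the orientations of a circle diagram are linearly independent. -/
theorem lineMonomial_independent (ha : ClosedOn A a) (hd : ClosedOn A d) {base : Labelling}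
    {c : Labelling → k}
    (h : ∑ ν ∈ (finite_oriented A a d base).toFinset, c ν • lineMonomial k A a d ν ∈
      circleIdeal k (LineConn a d)) : ∀ ν ∈ Oriented A a d base, c ν = 0 := by
  classical
  have hr := lineConn_equivalence a d
  -- With one variable for each circle, the relations become the monomial ideal generated by the
  -- squares of the variables, and the monomials of orientations become monomials `e ν` with
  -- exponents at most one.
  let s : Setoid ℤ := ⟨LineConn a d, hr⟩
  let q : ℤ → Quotient s := Quotient.mk s
  let leads : Labelling → Finset ℤ := fun ν =>
    A.filter fun i => (∀ j, LineConn a d i j → i ≤ j) ∧ ν i = Label.up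
  let e : Labelling → (Quotient s →₀ ℕ) := fun ν => ∑ i ∈ leads ν, Finsupp.single (q i) 1
  have hmono : ∀ ν, MvPolynomial.rename q (lineMonomial k A a d ν) =
      MvPolynomial.monomial (e ν) (1 : k) := by
    intro ν
    rw [lineMonomial, ← Finset.prod_filter, map_prod, MvPolynomial.monomial_sum_one]
    exact Finset.prod_congr rfl fun i _ => by rw [MvPolynomial.rename_X]; rfl
  have he : ∀ ν i, i ∈ A → (∀ j, LineConn a d i j → i ≤ j) →
      e ν (q i) = if ν i = Label.up then 1 else 0 := by
    intro ν i hi hl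
    have h1 : ∀ l ∈ leads ν, l ≠ i → (Finsupp.single (q l) 1 : Quotient s →₀ ℕ) (q i) = 0 := by
      intro l hl' hne
      rw [Finsupp.single_apply, if_neg]
      intro heq
      have hli : LineConn a d l i := Quotient.exact heq
      have h2 := (Finset.mem_filter.1 hl').2.1 i hli
      have h3 := hl l (hr.symm hli)
      exact hne (le_antisymm h2 h3)
    simp only [e, Finsupp.finsetSum_apply]
    by_cases hu : ν i = Label.up
    · rw [if_pos hu, Finset.sum_eq_single_of_mem i (Finset.mem_filter.2 ⟨hi, hl, hu⟩) h1,
        Finsupp.single_eq_same]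
    · rw [if_neg hu]
      refine Finset.sum_eq_zero fun l hl' => h1 l hl' ?_
      rintro rfl
      exact hu (Finset.mem_filter.1 hl').2.2
  have he1 : ∀ ν c, e ν c ≤ 1 := by
    intro ν c
    obtain ⟨i, rfl⟩ := Quotient.exists_rep c
    by_cases hi : i ∈ A
    · obtain ⟨j, hj, hl⟩ := exists_lineLead ha hd hi
      have : (Quotient.mk s i) = q j := Quotient.sound hj
      rw [this, he ν j ((lineConn_mem_iff ha hd hj).1 hi) hl]
      split_ifs <;> omega
    · have : e ν (Quotient.mk s i) = 0 := by
        simp only [e, Finsupp.finsetSum_apply]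
        refine Finset.sum_eq_zero fun l hl => ?_
        rw [Finsupp.single_apply, if_neg]
        intro heq
        have hli : LineConn a d l i := Quotient.exact heq
        exact hi ((lineConn_mem_iff ha hd hli).1 (Finset.mem_filter.1 hl).1)
      omega
  -- The exponents give the label at the leftmost vertex of every circle. This determines the labels
  -- on the whole circle, and outside of `A` the labels are those of `base`.
  have hinj : ∀ ν ∈ Oriented A a d base, ∀ ν' ∈ Oriented A a d base, e ν = e ν' → ν = ν' := by
    intro ν hν ν' hν' hee
    funext i
    by_cases hi : i ∈ A
    · obtain ⟨j, hj, hl⟩ := exists_lineLead ha hd hi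
      have hjA := (lineConn_mem_iff ha hd hj).1 hi
      rw [fits_eq_iff hν.1 hν.2.1 hν'.1 hν'.2.1 hj]
      have h1 := he ν j hjA hl
      rw [hee, he ν' j hjA hl] at h1
      rcases hν.1.isArrow ha hjA with h2 | h2 <;> rcases hν'.1.isArrow ha hjA with h3 | h3 <;>
        simp [h2, h3] at h1 ⊢
    · rw [hν.2.2 i hi, hν'.2.2 i hi]
  have himage : ∀ g ∈ circleIdeal k (LineConn a d), MvPolynomial.rename q g ∈
      Ideal.span ((fun m => MvPolynomial.monomial m (1 : k)) ''
        Set.range fun c : Quotient s => Finsupp.single c 2) := by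
    intro g hg
    have : circleIdeal k (LineConn a d) ≤ (Ideal.span ((fun m => MvPolynomial.monomial m (1 : k)) ''
        Set.range fun c : Quotient s => Finsupp.single c 2)).comap (MvPolynomial.rename q) := by
      refine Ideal.span_le.2 ?_
      rintro g (⟨u, rfl⟩ | ⟨u, v, huv, rfl⟩)
      · rw [SetLike.mem_coe, Ideal.mem_comap, map_pow, MvPolynomial.rename_X]
        refine Ideal.subset_span ⟨_, ⟨q u, rfl⟩, ?_⟩
        rw [MvPolynomial.X_pow_eq_monomial]
      · rw [SetLike.mem_coe, Ideal.mem_comap, map_sub, MvPolynomial.rename_X,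
          MvPolynomial.rename_X, show q u = q v from Quotient.sound huv, sub_self]
        exact zero_mem _
    exact this hg
  have h1 := himage _ h
  rw [map_sum] at h1
  simp only [map_smul, hmono] at h1
  rw [MvPolynomial.mem_ideal_span_monomial_image] at h1
  intro ν hν
  by_contra hne
  have hcoeff : MvPolynomial.coeff (e ν) (∑ ν ∈ (finite_oriented A a d base).toFinset,
      c ν • MvPolynomial.monomial (e ν) (1 : k)) = c ν := by
    rw [MvPolynomial.coeff_sum, Finset.sum_eq_single_of_mem ν
      ((finite_oriented A a d base).mem_toFinset.2 hν)]
    · rw [MvPolynomial.coeff_smul, MvPolynomial.coeff_monomial, if_pos rfl, smul_eq_mul, mul_one]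
    · intro ν' hν' hne'
      rw [MvPolynomial.coeff_smul, MvPolynomial.coeff_monomial, if_neg, smul_zero]
      exact fun h => hne' (hinj _ ((finite_oriented A a d base).mem_toFinset.1 hν') _ hν h)
  -- A monomial occurring in an element of the ideal is divisible by a square of a variable, which a
  -- squarefree monomial is not.
  obtain ⟨m, ⟨c', rfl⟩, hm⟩ := h1 (e ν) (by
    rw [MvPolynomial.mem_support_iff, hcoeff]
    exact hne)
  have h2 := hm c'
  have h3 := he1 ν c'
  rw [Finsupp.single_eq_same] at h2
  omega

/-- As long as nothing is cut there are no vertical segments, so the diagram falls apart into the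
two circle diagrams to be multiplied. -/
theorem sameCircle_leftEnds (hb : ClosedOn A b) {u v : Vertex} :
    SameCircle a b d (leftEnds b) u v ↔ u.1 = v.1 ∧
      (if u.1 = true then LineConn b d u.2 v.2 else LineConn a b u.2 v.2) := by
  constructor
  · intro h
    induction h with
    | rel u v h =>
      rcases h with ⟨i, j, h⟩ | ⟨i, j, h⟩ | ⟨i, j, hi, h⟩ | ⟨i, j, hi, h⟩ | ⟨i, hi, h⟩
      · exact ⟨rfl, Relation.EqvGen.rel _ _ (Or.inl h)⟩
      · exact ⟨rfl, Relation.EqvGen.rel _ _ (Or.inr h)⟩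
      · exact ⟨rfl, Relation.EqvGen.rel _ _ (Or.inr h)⟩
      · exact ⟨rfl, Relation.EqvGen.rel _ _ (Or.inl h)⟩
      · obtain ⟨l, hl, h'⟩ := (uncut_leftEnds hb i).2 ((hb.arrow i).1 hi)
        exact absurd h' (not_or.2 (h l hl))
    | refl u =>
      refine ⟨rfl, ?_⟩
      split_ifs
      · exact (lineConn_equivalence _ _).refl _
      · exact (lineConn_equivalence _ _).refl _
    | symm u v _ ih =>
      refine ⟨ih.1.symm, ?_⟩
      rw [← ih.1]
      have := ih.2
      split_ifs at this ⊢
      · exact (lineConn_equivalence _ _).symm this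
      · exact (lineConn_equivalence _ _).symm this
    | trans u v w _ _ ih1 ih2 =>
      refine ⟨ih1.1.trans ih2.1, ?_⟩
      have h1 := ih1.2
      have h2 := ih2.2
      rw [← ih1.1] at h2
      split_ifs at h1 h2 ⊢
      · exact (lineConn_equivalence _ _).trans h1 h2
      · exact (lineConn_equivalence _ _).trans h1 h2
  · obtain ⟨l, i⟩ := u
    obtain ⟨l', j⟩ := v
    rintro ⟨rfl : l = l', h⟩
    cases l
    · refine eqvGen_map (fun x : ℤ => ((false, x) : Vertex)) ?_ h
      rintro i j (h | h)
      · exact Relation.EqvGen.rel _ _ (Joined.bottom i j h)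
      · exact Relation.EqvGen.rel _ _ (Joined.middleCap i j ((leftEnds_cuttable hb).2 i j h) h)
    · refine eqvGen_map (fun x : ℤ => ((true, x) : Vertex)) ?_ h
      rintro i j (h | h)
      · exact Relation.EqvGen.rel _ _ (Joined.middleCup i j ((leftEnds_cuttable hb).2 i j h) h)
      · exact Relation.EqvGen.rel _ _ (Joined.top i j h)

theorem rename_circleMonomial_leftEnds (hb : ClosedOn A b) (lam mu : Labelling) :
    MvPolynomial.rename Prod.snd
      (circleMonomial k A (SameCircle a b d (leftEnds b)) (stack lam mu)) =
      lineMonomial k A a b lam * lineMonomial k A b d mu := by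
  classical
  have hlead : ∀ (l : Bool) x, IsLead (SameCircle a b d (leftEnds b)) (l, x) ↔
      ∀ y, (if l = true then LineConn b d x y else LineConn a b x y) → x ≤ y := by
    intro l x
    constructor
    · intro h y hy
      exact h.le (show SameCircle a b d (leftEnds b) (l, x) (l, y) from
        (sameCircle_leftEnds hb).2 ⟨rfl, hy⟩)
    · rintro h ⟨l', y⟩ hw
      obtain ⟨h1, h2⟩ := (sameCircle_leftEnds hb).1 hw
      have := h y h2
      rcases this.lt_or_eq with h3 | h3
      · exact Or.inl h3
      · exact Or.inr ⟨h3, le_of_eq h1⟩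
  rw [circleMonomial, Finset.prod_product, Fintype.prod_bool, mul_comm, map_mul, map_prod,
    map_prod, lineMonomial, lineMonomial]
  congr 1 <;>
  · refine Finset.prod_congr rfl fun x _ => ?_
    unfold leadTerm
    rw [hlead]
    simp only [stack, if_true, Bool.false_eq_true, if_false]
    split_ifs
    · rw [MvPolynomial.rename_X]
    · rw [map_one]

/-- After all cuts each vertex of the top line is joined to the one below it. By the choice made in
case of a tie, all leads are on the bottom line, so no circle is counted twice. -/
theorem rename_circleMonomial_nil (ha : ClosedOn A a) (hb : ClosedOn A b) (hd : ClosedOn A d)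
    (o : Orientation) :
    MvPolynomial.rename Prod.snd (circleMonomial k A (SameCircle a b d []) o) =
      lineMonomial k A a d fun i => o (false, i) := by
  classical
  have D : Diagram A a b d [] := ⟨ha, hb, hd, Cuttable.nil b⟩
  have hlead : ∀ x ∈ A, IsLead (SameCircle a b d []) (false, x) ↔
      ∀ y, LineConn a d x y → x ≤ y := by
    intro x _
    constructor
    · intro h y hy
      exact h.le (sameCircle_of_lineConn_left hb hd hy)
    · rintro h ⟨l', y⟩ hw
      rcases (h y (lineConn_of_sameCircle hw)).lt_or_eq with h3 | h3
      · exact Or.inl h3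
      · exact Or.inr ⟨h3, Bool.false_le _⟩
  have hnot : ∀ x ∈ A, ¬ IsLead (SameCircle a b d []) (true, x) := by
    intro x hx h
    have := h (false, x) (D.joined_segment hx (not_uncut_nil b x)).symm
    simp at this
    exact absurd this (by decide)
  rw [circleMonomial, Finset.prod_product, Fintype.prod_bool, map_mul, map_prod, map_prod,
    lineMonomial, Finset.prod_eq_one, one_mul]
  · refine Finset.prod_congr rfl fun x hx => ?_
    unfold leadTerm
    rw [hlead x hx]
    split_ifs
    · rw [MvPolynomial.rename_X]
    · rw [map_one]
  · intro x hx
    rw [leadTerm, if_neg fun h => hnot x hx h.1, map_one]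

end LineMonomial

/-! ### Structure constants of closed diagrams. -/

section ClosedCoeff

variable {k : Type*} [Field k] {A : Finset ℤ} {a b c d : Labelling}

theorem consistent_stack (hb : ClosedOn A b)
    {rem : List ℤ} (hrem : ∀ i, ¬ Uncut b rem i → i ∈ A → False) {lam mu : Labelling}
    (h1 : Fits a lam) (h2 : Fits b lam) (h3 : Fits b mu) (h4 : Fits d mu) :
    Consistent a b d rem (stack lam mu) := by
  rintro u v (⟨i, j, h⟩ | ⟨i, j, h⟩ | ⟨i, j, hi, h⟩ | ⟨i, j, hi, h⟩ | ⟨i, hi, h⟩)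
  · exact ⟨fun _ => h1 i j h, fun h => absurd rfl h⟩
  · exact ⟨fun _ => h4 i j h, fun h => absurd rfl h⟩
  · exact ⟨fun _ => h2 i j h, fun h => absurd rfl h⟩
  · exact ⟨fun _ => h3 i j h, fun h => absurd rfl h⟩
  · refine (hrem i ?_ ((hb.arrow i).1 hi)).elim
    rintro ⟨l, hl, h'⟩
    exact h'.elim (h l hl).1 (h l hl).2

theorem consistent_stack_leftEnds (hb : ClosedOn A b)
    {lam mu : Labelling}
    (h1 : Fits a lam) (h2 : Fits b lam) (h3 : Fits b mu) (h4 : Fits d mu) :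
    Consistent a b d (leftEnds b) (stack lam mu) :=
  consistent_stack hb (fun i h hi => h ((uncut_leftEnds hb i).2 hi)) h1 h2 h3 h4

/-- An induction principle for the orientations that occur in the surgery procedure. -/
theorem surgeries_induction (k : Type*) [Field k] {A : Finset ℤ} {a b d : Labelling}
    {P : List ℤ → Orientation → Orientation → Prop} (h0 : ∀ o, P [] o o)
    (h1 : ∀ i rem o o' o'', Diagram A a b d (i :: rem) → Consistent a b d (i :: rem) o →
      SurgeryStep a b d i rem o o' → P rem o' o'' → P (i :: rem) o o'') :
    ∀ {rem : List ℤ}, Diagram A a b d rem → ∀ {o : Orientation}, Consistent a b d rem o →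
      ∀ {o''}, surgeries k a b d rem o o'' ≠ 0 → P rem o o''
  | [], _, o, _, o'', h => by
    classical
    rw [surgeries, Finsupp.single_apply] at h
    have : o = o'' := by
      by_contra hne
      exact h (if_neg hne)
    exact this ▸ h0 o
  | i :: rem, D, o, ho, o'', h => by
    obtain ⟨s, hs1, hs2, -⟩ := D.exists_surgeries_sum (k := k) ho
    rw [hs2, Finsupp.finsetSum_apply] at h
    obtain ⟨o', ho', hne⟩ := Finset.exists_ne_zero_of_sum_ne_zero h
    have hstep := (hs1 o').1 ho'
    exact h1 i rem o o' o'' D ho hstep (surgeries_induction k h0 h1 D.tail hstep.1 hne)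

theorem surgeries_support {rem : List ℤ} (D : Diagram A a b d rem) {o o'' : Orientation}
    (ho : Consistent a b d rem o) (h : surgeries k a b d rem o o'' ≠ 0) :
    Consistent a b d [] o'' ∧ ∀ v : Vertex, v.2 ∉ A → o'' v = o v := by
  refine surgeries_induction k (A := A) (a := a) (b := b) (d := d)
    (P := fun rem o o'' => Consistent a b d rem o → Consistent a b d [] o'' ∧
      ∀ v : Vertex, v.2 ∉ A → o'' v = o v) (fun o ho => ⟨ho, fun _ _ => rfl⟩) ?_ D ho h ho
  intro i rem o o' o'' D ho hstep ih _
  obtain ⟨h1, h2⟩ := ih hstep.1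
  refine ⟨h1, fun v hv => ?_⟩
  rw [h2 v hv]
  refine hstep.2.1 v ?_ ?_
  · exact fun h => hv ((D.mem_iff h).1 D.head_mem)
  · exact fun h => hv ((D.mem_iff h).1 D.head_mem)

/-- The expansion of the product of two closed oriented circle diagrams. -/
theorem sum_closedCoeff (ha : ClosedOn A a) (hb : ClosedOn A b) (hd : ClosedOn A d)
    {base lam mu : Labelling} (hlam : lam ∈ Oriented A a b base) (hmu : mu ∈ Oriented A b d base) :
    ∑ nu ∈ (finite_oriented A a d base).toFinset,
        closedCoeff k a b d lam mu nu • lineMonomial k A a d nu -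
      lineMonomial k A a b lam * lineMonomial k A b d mu * gluing k a b d ∈
      circleIdeal k (LineConn a d) := by
  classical
  have D : Diagram A a b d (leftEnds b) := ⟨ha, hb, hd, (leftEnds_cuttable hb).1⟩
  have ho := consistent_stack_leftEnds hb hlam.1 hlam.2.1 hmu.1 hmu.2.1
  have h := map_circleIdeal (r' := LineConn a d) Prod.snd
    (fun u v huv => lineConn_of_sameCircle huv) (D.surgeries_monomial (k := k) ho)
  rw [map_sub, map_mul, rename_circleMonomial_leftEnds hb] at h
  rw [gluing]
  convert h using 2
  rw [Finsupp.linearCombination_apply, Finsupp.sum, map_sum]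
  simp only [map_smul, rename_circleMonomial_nil ha hb hd]
  symm
  set c := surgeries k a b d (leftEnds b) (stack lam mu) with hc
  -- An orientation that occurs after all cuts has equal labels on both lines: on `A` because of the
  -- segments, elsewhere because surgeries change nothing there and both weights restrict to `base`.
  -- So no term is lost in the passage to a single line.
  have hsupp : ∀ o, c o ≠ 0 → (fun i => o (false, i)) ∈ Oriented A a d base ∧
      o = stack (fun i => o (false, i)) (fun i => o (false, i)) := by
    intro o hne
    obtain ⟨h1, h2⟩ := surgeries_support D ho hne
    have hseg : ∀ i ∈ A, o (false, i) = o (true, i) := fun i hi =>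
      ((h1 _ _ (Joined.segment i ((hb.arrow i).2 hi) (by simp))).2 (by simp)).1
    have heq : o = stack (fun i => o (false, i)) (fun i => o (false, i)) := by
      funext v
      obtain ⟨l, i⟩ := v
      cases l
      · rfl
      · by_cases hi : i ∈ A
        · exact (hseg i hi).symm
        · change o (true, i) = o (false, i)
          rw [h2 (true, i) hi, h2 (false, i) hi]
          change mu i = lam i
          rw [hmu.2.2 i hi, hlam.2.2 i hi]
    refine ⟨⟨fun i j hij => (h1 _ _ (Joined.bottom i j hij)).1 rfl, fun i j hij => ?_,
      fun i hi => ?_⟩, heq⟩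
    · have := (h1 _ _ (Joined.top i j hij)).1 rfl
      rwa [← hseg i (hd.left_mem hij), ← hseg j (hd.right_mem hij)] at this
    · exact (h2 (false, i) hi).trans (hlam.2.2 i hi)
  refine Finset.sum_bij_ne_zero (fun o _ _ i => o (false, i)) ?_ ?_ ?_ ?_
  · intro o ho' _
    exact (finite_oriented A a d base).mem_toFinset.2 (hsupp o (Finsupp.mem_support_iff.1 ho')).1
  · intro o₁ h1 _ o₂ h2 _ h12
    rw [(hsupp o₁ (Finsupp.mem_support_iff.1 h1)).2, (hsupp o₂ (Finsupp.mem_support_iff.1 h2)).2,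
      h12]
  · intro nu _ hne
    have hne' : c (stack nu nu) ≠ 0 := by
      intro h0
      refine hne ?_
      rw [closedCoeff, ← hc, h0, zero_smul]
    exact ⟨stack nu nu, Finsupp.mem_support_iff.2 hne', hne, rfl⟩
  · intro o ho' _
    rw [closedCoeff, ← hc, ← (hsupp o (Finsupp.mem_support_iff.1 ho')).2]

/-- Expanded in the ring of the circle diagram of `a` and `d`, both sides are the product of the
three monomials with a product of two gluing elements. These agree by `gluing_assoc`, and the
independence of the monomials allows the comparison of coefficients. -/
theorem closedCoeff_assoc (ha : ClosedOn A a) (hb : ClosedOn A b) (hc : ClosedOn A c)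
    (hd : ClosedOn A d) {base lam mu nu rho : Labelling} (hlam : lam ∈ Oriented A a b base)
    (hmu : mu ∈ Oriented A b c base) (hnu : nu ∈ Oriented A c d base)
    (hrho : rho ∈ Oriented A a d base) :
    ∑ kap ∈ (finite_oriented A a c base).toFinset,
      closedCoeff k a b c lam mu kap * closedCoeff k a c d kap nu rho =
    ∑ kap ∈ (finite_oriented A b d base).toFinset,
      closedCoeff k b c d mu nu kap * closedCoeff k a b d lam kap rho := by
  have h1 := sum_closedCoeff (k := k) ha hb hc hlam hmu
  have h2 := sum_closedCoeff (k := k) hb hc hd hmu hnu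
  have h3 : ∑ kap ∈ (finite_oriented A a c base).toFinset, closedCoeff k a b c lam mu kap •
      (∑ rho ∈ (finite_oriented A a d base).toFinset,
        closedCoeff k a c d kap nu rho • lineMonomial k A a d rho -
        lineMonomial k A a c kap * lineMonomial k A c d nu * gluing k a c d) ∈
      circleIdeal k (LineConn a d) :=
    sum_mem fun kap hkap => Submodule.smul_of_tower_mem _ _
      (sum_closedCoeff ha hc hd ((finite_oriented A a c base).mem_toFinset.1 hkap) hnu)
  have h4 : ∑ kap ∈ (finite_oriented A b d base).toFinset, closedCoeff k b c d mu nu kap •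
      (∑ rho ∈ (finite_oriented A a d base).toFinset,
        closedCoeff k a b d lam kap rho • lineMonomial k A a d rho -
        lineMonomial k A a b lam * lineMonomial k A b d kap * gluing k a b d) ∈
      circleIdeal k (LineConn a d) :=
    sum_mem fun kap hkap => Submodule.smul_of_tower_mem _ _
      (sum_closedCoeff ha hb hd hlam ((finite_oriented A b d base).mem_toFinset.1 hkap))
  have h5 := mul_gluing_mem_left ha hc hd h1
  have h6 := mul_gluing_mem_right ha hb hd h2
  have h7 := gluing_assoc (k := k) ha hb hc hd
  rw [← sub_eq_zero]
  refine lineMonomial_independent ha hd (c := fun rho =>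
    ∑ kap ∈ (finite_oriented A a c base).toFinset,
      closedCoeff k a b c lam mu kap * closedCoeff k a c d kap nu rho -
    ∑ kap ∈ (finite_oriented A b d base).toFinset,
      closedCoeff k b c d mu nu kap * closedCoeff k a b d lam kap rho) (base := base) ?_ rho hrho
  have e1 : ∀ (S : Finset Labelling) (f : Labelling → k) (g : Labelling → Labelling → k),
      ∑ rho ∈ (finite_oriented A a d base).toFinset, (∑ kap ∈ S, f kap * g kap rho) •
        lineMonomial k A a d rho =
      ∑ kap ∈ S, f kap • ∑ rho ∈ (finite_oriented A a d base).toFinset,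
        g kap rho • lineMonomial k A a d rho := by
    intro S f g
    simp only [Finset.sum_smul, Finset.smul_sum, mul_smul]
    rw [Finset.sum_comm]
  have e2 : ∀ (S : Finset Labelling) (f : Labelling → k) (g : Labelling → MvPolynomial ℤ k)
      (x y : MvPolynomial ℤ k), ∑ kap ∈ S, f kap • (g kap * x * y) =
        (∑ kap ∈ S, f kap • g kap) * x * y := by
    intro S f g x y
    simp only [Finset.sum_mul, smul_mul_assoc]
  have e3 : ∀ (S : Finset Labelling) (f : Labelling → k) (g : Labelling → MvPolynomial ℤ k)
      (x y : MvPolynomial ℤ k), ∑ kap ∈ S, f kap • (x * g kap * y) =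
        x * (∑ kap ∈ S, f kap • g kap) * y := by
    intro S f g x y
    simp only [Finset.mul_sum, Finset.sum_mul, mul_smul_comm, smul_mul_assoc]
  simp only [sub_smul, Finset.sum_sub_distrib]
  rw [e1, e1]
  simp only [smul_sub, Finset.sum_sub_distrib] at h3 h4
  rw [e2] at h3
  rw [e3] at h4
  have h8 := Ideal.mul_mem_left _ (lineMonomial k A c d nu) h5
  have h9 := Ideal.mul_mem_left _ (lineMonomial k A a b lam) h6
  have h10 := Ideal.mul_mem_left _ (lineMonomial k A a b lam * lineMonomial k A b c mu *
    lineMonomial k A c d nu) h7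
  convert add_mem (sub_mem (add_mem h3 h8) (add_mem h4 h9)) h10 using 1
  ring

/-! ### Units -/

/-- When the bottom diagram equals the middle one, an uncut cap together with the cup of `a` below
it forms a whole circle. So cap and cup of each pair lie on different circles when the pair is cut,
and all surgeries are merges. -/
theorem cutProduct_self :
    ∀ rem, Cuttable a rem → cutProduct k (SameCircle a a d) (fun i => (false, i))
      (fun i => (true, mate a i)) rem = 1 := by
  intro rem
  induction rem with
  | nil => intro _; rfl
  | cons i rem ih =>
    intro h
    rw [cutProduct, ih h.tail, mul_one, surgeryFactor, if_neg]
    have hcup := h.cup_head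
    have key : ∀ u v : Vertex, SameCircle a a d (i :: rem) u v →
        ((u = (false, i) ∨ u = (false, mate a i)) ↔ (v = (false, i) ∨ v = (false, mate a i))) := by
      intro u v huv
      have hmate : ∀ x y, IsCup a x y → ((x = i ∨ x = mate a i) ↔ (y = i ∨ y = mate a i)) := by
        intro x y hxy
        constructor
        · rintro (rfl | rfl)
          · exact Or.inr hxy.mate_left.symm
          · exact absurd hxy hcup.not_cup_left
        · rintro (rfl | rfl)
          · exact absurd hcup hxy.not_cup_left
          · exact Or.inl (hxy.left_unique hcup)
      have hpair : ∀ x, (((false, x) : Vertex) = (false, i) ∨ ((false, x) : Vertex) =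
          (false, mate a i)) ↔ (x = i ∨ x = mate a i) := by
        intro x
        simp
      induction huv with
      | rel u v h' =>
        rcases h' with ⟨x, y, hxy⟩ | ⟨x, y, hxy⟩ | ⟨x, y, hx, hxy⟩ | ⟨x, y, hx, hxy⟩ | ⟨x, hx, hxl⟩
        · rw [hpair, hpair]
          exact hmate x y hxy
        · simp
        · rw [hpair, hpair]
          exact hmate x y hxy
        · simp
        · rw [hpair]
          refine iff_of_false ?_ (by simp)
          have := hxl i List.mem_cons_self
          rintro (rfl | rfl)
          · exact this.1 rfl
          · exact this.2 hcup
      | refl => exact Iff.rfl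
      | symm _ _ _ ih => exact ih.symm
      | trans _ _ _ _ _ ih1 ih2 => exact ih1.trans ih2
    intro hc
    have := (key _ _ hc).1 (Or.inl rfl)
    simp at this

theorem gluing_self (ha : ClosedOn A a) : gluing k a a d = 1 := by
  rw [gluing, cutProduct_self _ (leftEnds_cuttable ha).1, map_one]

/-- Every circle is a cup with its own mirror image, and its left end is labelled `down`. -/
theorem lineMonomial_self (ha : ClosedOn A a) : lineMonomial k A a a a = 1 := by
  rw [lineMonomial]
  refine Finset.prod_eq_one fun i hi => if_neg ?_
  rintro ⟨h1, h2⟩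
  rcases ha.cup_mate hi with h | h
  · rw [h.2.1] at h2
    cases h2
  · have := h1 _ (lineConn_mate_left a a i)
    have := h.1
    omega

/-- Both the monomial of the first diagram and the gluing element are `1`, so the product has the
expansion of its second factor. -/
theorem closedCoeff_self (ha : ClosedOn A a) (hd : ClosedOn A d) {base mu nu : Labelling}
    (hbase : ∀ i, i ∉ A → a i = base i)
    (hmu : mu ∈ Oriented A a d base) (hnu : nu ∈ Oriented A a d base) [Decidable (nu = mu)] :
    closedCoeff k a a d a mu nu = if nu = mu then 1 else 0 := by
  classical
  have h := sum_closedCoeff (k := k) ha ha hd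
    (show a ∈ Oriented A a a base from ⟨fits_self a, fits_self a, hbase⟩) hmu
  rw [lineMonomial_self ha, gluing_self ha, one_mul, mul_one] at h
  have h' := lineMonomial_independent ha hd (base := base)
    (c := fun nu => closedCoeff k a a d a mu nu - if nu = mu then 1 else 0) (by
      simp only [sub_smul, Finset.sum_sub_distrib, ite_smul, one_smul, zero_smul]
      rwa [Finset.sum_ite_eq', if_pos ((finite_oriented A a d base).mem_toFinset.2 hmu)]) nu hnu
  rw [sub_eq_zero] at h'
  rw [h']
  split_ifs <;> rfl

/-! ### Mirror images -/

theorem sameCircle_mirror {rem : List ℤ} {u v : Vertex} (h : SameCircle a b d rem u v) :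
    SameCircle d b a rem (!u.1, u.2) (!v.1, v.2) := by
  refine eqvGen_map (fun u : Vertex => ((!u.1, u.2) : Vertex)) ?_ h
  rintro u v (⟨i, j, h⟩ | ⟨i, j, h⟩ | ⟨i, j, hi, h⟩ | ⟨i, j, hi, h⟩ | ⟨i, hi, h⟩)
  · exact Relation.EqvGen.rel _ _ (Joined.top i j h)
  · exact Relation.EqvGen.rel _ _ (Joined.bottom i j h)
  · exact Relation.EqvGen.rel _ _ (Joined.middleCup i j hi h)
  · exact Relation.EqvGen.rel _ _ (Joined.middleCap i j hi h)
  · exact (Relation.EqvGen.rel _ _ (Joined.segment i hi h)).symm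

/-- The reflection exchanges the lines and hence the ends of the diagonal pair. As long as a pair is
uncut, both ends on a line lie on one circle, so the reflection does not affect whether the cut is a
split. -/
theorem gluing_comm (ha : ClosedOn A a) (hb : ClosedOn A b) (hd : ClosedOn A d) :
    gluing k a b d = gluing k d b a := by
  refine cutProduct_rename (P := Cuttable b) (fun _ _ h => h.tail) ?_ (fun _ => rfl)
    (fun _ => rfl) _ (leftEnds_cuttable hb).1
  intro i l hl
  have key : ∀ a d, ClosedOn A a → ClosedOn A d →
      SameCircle a b d (i :: l) (false, i) (true, mate b i) →
      SameCircle d b a (i :: l) (false, i) (true, mate b i) := by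
    intro a d ha hd h
    have D : Diagram A d b a (i :: l) := ⟨hd, hb, ha, hl⟩
    have h1 := sameCircle_mirror h
    exact (D.head_uncut false).trans _ _ _ (h1.symm.trans _ _ _ (D.head_uncut true))
  exact ⟨key a d ha hd, key d a hd ha⟩

theorem closedCoeff_mirror (ha : ClosedOn A a) (hb : ClosedOn A b) (hd : ClosedOn A d)
    {base lam mu nu : Labelling} (hlam : lam ∈ Oriented A a b base)
    (hmu : mu ∈ Oriented A b d base) (hnu : nu ∈ Oriented A a d base) :
    closedCoeff k a b d lam mu nu = closedCoeff k d b a mu lam nu := by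
  have h1 := sum_closedCoeff (k := k) ha hb hd hlam hmu
  have h2 := sum_closedCoeff (k := k) hd hb ha (mem_oriented_comm.1 hmu) (mem_oriented_comm.1 hlam)
  have hset : (finite_oriented A d a base).toFinset = (finite_oriented A a d base).toFinset := by
    ext ν
    rw [Set.Finite.mem_toFinset, Set.Finite.mem_toFinset]
    exact mem_oriented_comm
  rw [hset, lineConn_eq_comm d a, gluing_comm hd hb ha, lineMonomial_comm (a := d) (d := b),
    lineMonomial_comm (a := b) (d := a)] at h2
  simp only [lineMonomial_comm (a := d) (d := a)] at h2
  rw [← sub_eq_zero]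
  refine lineMonomial_independent ha hd (c := fun nu => closedCoeff k a b d lam mu nu -
    closedCoeff k d b a mu lam nu) (base := base) ?_ nu hnu
  simp only [sub_smul, Finset.sum_sub_distrib]
  convert sub_mem h1 h2 using 1
  ring

end ClosedCoeff


/-! ## Monotonicity of the surgery procedure -/

/-- The sign of a label. -/
def Label.sign : Label → ℤ
  | Label.down => 1
  | Label.up => -1
  | _ => 0

theorem Label.IsArrow.sign_inj {l l' : Label} (h : l.IsArrow) (h' : l'.IsArrow)
    (he : l.sign = l'.sign) : l = l' := by
  rcases h with rfl | rfl <;> rcases h' with rfl | rfl <;> first | rfl | simp [Label.sign] at he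

theorem Label.IsArrow.sign_flip {l : Label} (h : l.IsArrow) : l.flip.sign = -l.sign := by
  rcases h with rfl | rfl <;> rfl

/-- The number of `down`'s minus the number of `up`'s among the vertices of `A` to the left
of `m`. -/
def prefixSum (A : Finset ℤ) (f : Labelling) (m : ℤ) : ℤ :=
  ∑ x ∈ A with x < m, (f x).sign

theorem eq_of_prefixSum_eq {A : Finset ℤ} {f g : Labelling} (hf : ∀ x ∈ A, (f x).IsArrow)
    (hg : ∀ x ∈ A, (g x).IsArrow) (h : ∀ m, prefixSum A f m = prefixSum A g m) :
    ∀ x ∈ A, f x = g x := by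
  intro x hx
  have hsplit : (A.filter fun y => y < x + 1) = insert x (A.filter fun y => y < x) := by
    ext y
    simp only [Finset.mem_filter, Finset.mem_insert]
    constructor
    · rintro ⟨h1, h2⟩
      rcases (Int.lt_add_one_iff.1 h2).eq_or_lt with h3 | h3
      · exact Or.inl h3
      · exact Or.inr ⟨h1, h3⟩
    · rintro (rfl | ⟨h1, h2⟩)
      · exact ⟨hx, by omega⟩
      · exact ⟨h1, by omega⟩
  have h1 := h (x + 1)
  have h2 := h x
  unfold prefixSum at h1 h2
  rw [hsplit, Finset.sum_insert (by simp), Finset.sum_insert (by simp), h2] at h1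
  exact (hf x hx).sign_inj (hg x hx) (add_right_cancel h1)

/-- The signs alternate and begin with `1`. Applied to the vertices of one circle on one line, this
computes the prefix sums of the standard orientation. -/
theorem sum_alternating (T : Finset ℤ) :
    ∑ x ∈ T, (if Even (T.filter fun y => y < x).card then (1 : ℤ) else -1) = (T.card % 2 : ℕ) := by
  induction T using Finset.induction_on_max with
  | empty => simp
  | insert a T hT ih =>
    have ha : a ∉ T := fun h => lt_irrefl a (hT a h)
    have h1 : ((insert a T).filter fun y => y < a) = T := by
      rw [Finset.filter_insert, if_neg (lt_irrefl a), Finset.filter_true_of_mem hT]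
    have h2 : ∀ x ∈ T, ((insert a T).filter fun y => y < x) = T.filter fun y => y < x := by
      intro x hx
      rw [Finset.filter_insert, if_neg (hT x hx).le.not_gt]
    rw [Finset.sum_insert ha, h1, Finset.sum_congr rfl fun x hx => by rw [h2 x hx], ih,
      Finset.card_insert_of_notMem ha]
    split_ifs with h
    · rw [Nat.even_iff] at h
      omega
    · rw [Nat.not_even_iff] at h
      omega

open Classical in
/-- The sign of a circle: `1` for type `1` and `-1` for type `x`. -/
noncomputable def typeSign (t : Prop) : ℤ := if t then 1 else -1

open Classical in
/-- The contribution of a set of vertices to the prefix sum of a line. -/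
noncomputable def partialSum (A : Finset ℤ) (o : Orientation) (l : Bool) (m : ℤ)
    (C : Vertex → Prop) : ℤ :=
  ∑ x ∈ A with x < m ∧ C (l, x), (o (l, x)).sign

section PartialSum

variable {A : Finset ℤ} {o : Orientation} {l : Bool} {m : ℤ} {C C' : Vertex → Prop}

theorem partialSum_congr {o' : Orientation} (h : ∀ v, C v → o v = o' v) :
    partialSum A o l m C = partialSum A o' l m C := by
  classical
  unfold partialSum
  exact Finset.sum_congr rfl fun x hx => by rw [h _ (Finset.mem_filter.1 hx).2.2]

theorem partialSum_or (h : ∀ v, C v → ¬ C' v) :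
    partialSum A o l m (fun v => C v ∨ C' v) =
      partialSum A o l m C + partialSum A o l m C' := by
  classical
  unfold partialSum
  rw [← Finset.sum_union]
  · refine Finset.sum_congr ?_ fun _ _ => rfl
    ext x
    simp only [Finset.mem_filter, Finset.mem_union]
    tauto
  · rw [Finset.disjoint_left]
    intro x h1 h2
    exact h _ (Finset.mem_filter.1 h1).2.2 (Finset.mem_filter.1 h2).2.2

theorem lineCount_or (h : ∀ v, C v → ¬ C' v) :
    lineCount A (fun v => C v ∨ C' v) l m = lineCount A C l m + lineCount A C' l m := by
  classical
  unfold lineCount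
  rw [← Finset.card_union_of_disjoint]
  · congr 1
    ext x
    simp only [Finset.mem_filter, Finset.mem_union]
    tauto
  · rw [Finset.disjoint_left]
    intro x h1 h2
    exact h _ (Finset.mem_filter.1 h1).2.2 (Finset.mem_filter.1 h2).2.2

theorem prefixSum_eq_partialSum (C : Vertex → Prop) :
    prefixSum A (fun x => o (l, x)) m =
      partialSum A o l m C + partialSum A o l m fun v => ¬ C v := by
  classical
  rw [← partialSum_or fun _ h h' => h' h]
  unfold prefixSum partialSum
  refine Finset.sum_congr ?_ fun _ _ => rfl
  ext x
  simp [em]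

end PartialSum

namespace Diagram

variable {A : Finset ℤ} {a b d : Labelling} {rem : List ℤ} {i : ℤ}

/-- The contribution of a single circle to the prefix sum of a line. -/
theorem partialSum_class (D : Diagram A a b d rem) {o : Orientation}
    (ho : Consistent a b d rem o) (v : Vertex) (l : Bool) (m : ℤ) :
    partialSum A o l m (SameCircle a b d rem v) =
      typeSign (o v = stdLabel A (SameCircle a b d rem) v) *
        (lineCount A (SameCircle a b d rem v) l m % 2 : ℕ) := by
  classical
  have hr := sameCircle_equivalence a b d rem
  set r := SameCircle a b d rem with hrdef
  have hcount : ∀ x ∈ A.filter fun y => y < m ∧ r v (l, y),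
      (stdLabel A r (l, x)).sign = if Even ((A.filter fun y => y < m ∧ r v (l, y)).filter
        fun y => y < x).card then (1 : ℤ) else -1 := by
    intro x hx
    rw [Finset.mem_filter] at hx
    have hset : ((A.filter fun y => y < m ∧ r v (l, y)).filter fun y => y < x) =
        A.filter fun y => y < x ∧ r (l, x) (l, y) := by
      ext y
      rw [← class_eq hr hx.2.2]
      simp only [Finset.mem_filter]
      constructor
      · rintro ⟨⟨h1, h2, h3⟩, h4⟩
        exact ⟨h1, h4, h3⟩
      · rintro ⟨h1, h2, h3⟩
        exact ⟨⟨h1, h2.trans hx.2.1, h3⟩, h2⟩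
    rw [hset]
    unfold stdLabel lineCount
    split_ifs <;> rfl
  have hsum : ∑ x ∈ A with x < m ∧ r v (l, x), (stdLabel A r (l, x)).sign =
      (lineCount A (r v) l m % 2 : ℕ) := by
    rw [Finset.sum_congr rfl hcount, sum_alternating]
    rfl
  have hc := D.consistent_iff.1 ho
  unfold partialSum typeSign
  split_ifs with h
  · rw [one_mul, ← hsum]
    refine Finset.sum_congr rfl fun x hx => ?_
    rw [Finset.mem_filter] at hx
    rw [(hc.2 _ _ hx.2.2).1 h]
  · rw [neg_one_mul, ← hsum, ← Finset.sum_neg_distrib]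
    refine Finset.sum_congr rfl fun x hx => ?_
    rw [Finset.mem_filter] at hx
    rw [(hc.1 (l, x) hx.1).eq_flip_of_ne (stdLabel_isArrow A r _)
      (mt (hc.2 _ _ hx.2.2).2 h), (stdLabel_isArrow A r _).sign_flip]

/-- By `partialSum_class` a circle contributes the parity of its vertices counted so far, with sign
plus if it is anti-clockwise and minus if not. Counts add up under merging and splitting, so each
line of the tables is an inequality between the parities of `n₁`, `n₂` and `n₁ + n₂`. -/
theorem prefixSum_step_le (D : Diagram A a b d (i :: rem)) {o o' : Orientation}
    (ho : Consistent a b d (i :: rem) o) (h : SurgeryStep a b d i rem o o') (l : Bool) (m : ℤ) :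
    prefixSum A (fun x => o' (l, x)) m ≤ prefixSum A (fun x => o (l, x)) m := by
  classical
  have hS := D.isSurgery
  have hr := hS.equiv
  have hr' := hS.equiv'
  have hiff : SameCircle a b d (i :: rem) (false, i) (true, mate b i) ↔
      SameCircle a b d (i :: rem) (false, i) (true, i) :=
    ⟨fun h => hr.trans h (hr.symm (D.head_uncut true)), fun h => hr.trans h (D.head_uncut true)⟩
  have hiff' : SameCircle a b d rem (false, i) (true, mate b i) ↔
      SameCircle a b d rem (false, i) (false, mate b i) :=
    ⟨fun h => hr'.trans h (hr'.symm D.head_cut_right), fun h => hr'.trans h D.head_cut_right⟩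
  have hdich := hS.dichotomy
  rw [hiff, hiff'] at hdich
  have hU : (fun v => SameCircle a b d (i :: rem) (false, i) v ∨
      SameCircle a b d (i :: rem) (true, i) v) = fun v => SameCircle a b d rem (false, i) v ∨
      SameCircle a b d rem (false, mate b i) v := funext fun v => propext (D.class_union v)
  have hoff : partialSum A o' l m (fun v => ¬ (SameCircle a b d (i :: rem) (false, i) v ∨
      SameCircle a b d (i :: rem) (true, i) v)) = partialSum A o l m
      (fun v => ¬ (SameCircle a b d (i :: rem) (false, i) v ∨
      SameCircle a b d (i :: rem) (true, i) v)) :=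
    partialSum_congr fun v hv => h.2.1 v (not_or.1 hv).1 (not_or.1 hv).2
  rw [prefixSum_eq_partialSum (o := o) (fun v => SameCircle a b d (i :: rem) (false, i) v ∨
      SameCircle a b d (i :: rem) (true, i) v),
    prefixSum_eq_partialSum (o := o') (fun v => SameCircle a b d (i :: rem) (false, i) v ∨
      SameCircle a b d (i :: rem) (true, i) v), hoff]
  refine add_le_add_left ?_ _
  have hcls : ∀ {W : Type} {r : W → W → Prop}, Equivalence r → ∀ {u v : W}, r u v →
      (fun w => r u w ∨ r v w) = r u := by
    intro W r hr u v huv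
    funext w
    rw [class_eq hr huv, or_self]
  have hdis : ∀ {W : Type} {r : W → W → Prop}, Equivalence r → ∀ {u v : W}, ¬ r u v →
      ∀ w, r u w → ¬ r v w := fun hr _ _ h w h1 h2 => h (hr.trans h1 (hr.symm h2))
  by_cases hs : SameCircle a b d (i :: rem) (false, i) (true, i)
  · have hs' := hdich.1 hs
    obtain ⟨-, h1, h2⟩ := (D.surgeryStep_split_iff ho hs).1 h
    have e1 := D.partialSum_class ho (false, i) l m
    have e2 := D.tail.partialSum_class h.1 (false, i) l m
    have e3 := D.tail.partialSum_class h.1 (false, mate b i) l m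
    have e4 : lineCount A (SameCircle a b d (i :: rem) (false, i)) l m =
        lineCount A (SameCircle a b d rem (false, i)) l m +
        lineCount A (SameCircle a b d rem (false, mate b i)) l m := by
      rw [← lineCount_or (hdis hr' hs'), ← hU, hcls hr hs]
    have e5 := partialSum_or (A := A) (o := o') (l := l) (m := m) (hdis hr' hs')
    rw [← hU, e2, e3] at e5
    rw [e5, hcls hr hs, e1, e4]
    unfold typeSign
    split_ifs at * with g1 g2 g3 <;> simp_all <;> omega
  · have hs' : SameCircle a b d rem (false, i) (false, mate b i) := by
      by_contra h
      exact hs (hdich.2 h)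
    obtain ⟨-, h1, h2⟩ := (D.surgeryStep_merge_iff ho hs).1 h
    have e1 := D.tail.partialSum_class h.1 (false, i) l m
    have e2 := D.partialSum_class ho (false, i) l m
    have e3 := D.partialSum_class ho (true, i) l m
    have e4 : lineCount A (SameCircle a b d rem (false, i)) l m =
        lineCount A (SameCircle a b d (i :: rem) (false, i)) l m +
        lineCount A (SameCircle a b d (i :: rem) (true, i)) l m := by
      rw [← lineCount_or (hdis hr hs), hU, hcls hr' hs']
    have e5 := partialSum_or (A := A) (o := o) (l := l) (m := m) (hdis hr hs)
    rw [e2, e3] at e5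
    rw [e5, hU, hcls hr' hs', e1, e4]
    unfold typeSign
    split_ifs at * with g1 g2 g3 <;> simp_all <;> omega

theorem prefixSum_le_of_surgeries_ne_zero {k : Type*} [Field k] (D : Diagram A a b d rem)
    {o o' : Orientation} (ho : Consistent a b d rem o)
    (h : surgeries k a b d rem o o' ≠ 0) (l : Bool) (m : ℤ) :
    prefixSum A (fun x => o' (l, x)) m ≤ prefixSum A (fun x => o (l, x)) m :=
  surgeries_induction k (A := A) (a := a) (b := b) (d := d)
    (P := fun _ o o' => prefixSum A (fun x => o' (l, x)) m ≤ prefixSum A (fun x => o (l, x)) m)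
    (fun _ => le_rfl) (fun _ _ _ _ _ D ho hstep ih => ih.trans (D.prefixSum_step_le ho hstep l m))
    D ho h

/-! ### Diagrams oriented by the weight of the middle section -/

theorem consistent_stack_middle (hl : Fits a b) (hr : Fits d b) (rem : List ℤ) :
    Consistent a b d rem (stack b b) := by
  rintro u v (⟨i, j, h⟩ | ⟨i, j, h⟩ | ⟨i, j, hi, h⟩ | ⟨i, j, hi, h⟩ | ⟨i, hi, h⟩)
  · exact ⟨fun _ => hl i j h, fun h => absurd rfl h⟩
  · exact ⟨fun _ => hr i j h, fun h => absurd rfl h⟩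
  · exact ⟨fun _ => fits_self b i j h, fun h => absurd rfl h⟩
  · exact ⟨fun _ => fits_self b i j h, fun h => absurd rfl h⟩
  · exact ⟨fun h => absurd h Bool.false_ne_true, fun _ => ⟨rfl, hi⟩⟩

theorem not_uncut_of_lt (D : Diagram A a b d (i :: rem)) {y : ℤ} (hy : y < i) :
    ¬ Uncut b (i :: rem) y := by
  intro h
  obtain ⟨l, j, hl, hlj, h⟩ := D.cuttable.exists_cup h
  have hil : i ≤ l := by
    rcases List.mem_cons.1 hl with rfl | hl
    · exact le_rfl
    · exact (D.cuttable.head_lt hl).le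
  rcases h with rfl | rfl
  · omega
  · have := hlj.1
    omega

/-- Pairs are cut from left to right, so all vertices to the left of `i` are joined to their copies
on the other line. -/
theorem lineCount_head (D : Diagram A a b d (i :: rem)) {C : Vertex → Prop}
    (hC : ∀ u v, SameCircle a b d (i :: rem) u v → C u → C v) :
    lineCount A C false i = lineCount A C true i := by
  classical
  unfold lineCount
  congr 1
  refine Finset.filter_congr fun y hy => and_congr_right fun h => ?_
  have := D.joined_segment hy (D.not_uncut_of_lt h)
  exact ⟨hC _ _ this, hC _ _ this.symm⟩

/-- The vertices strictly under the pair being cut are still uncut and matched among themselves, and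
`i` itself is not in `C`. -/
theorem even_lineCount_mate (D : Diagram A a b d (i :: rem)) {C : Vertex → Prop}
    (hC : ∀ u v, SameCircle a b d rem u v → C u → C v) (hi : ¬ C (false, i)) :
    Even (lineCount A C false (mate b i)) ↔ Even (lineCount A C false i) := by
  classical
  have hcup := D.cuttable.cup_head
  have hev := D.middle.even_inside (C := fun x => C (false, x)) hcup (by
    intro x hx h1 h2 h
    have hu := D.uncut_inside List.mem_cons_self hcup hx h1 h2
    have hu' : Uncut b rem x := (D.cuttable.uncut_tail x).2 ⟨hu, by omega, by omega⟩
    exact hC _ _ (D.tail.joined_middle false hu') h)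
  have hij := hcup.1
  have hcard : lineCount A C false (mate b i) = lineCount A C false i +
      (A.filter fun x => (i < x ∧ x < mate b i) ∧ C (false, x)).card := by
    unfold lineCount
    rw [← Finset.card_union_of_disjoint]
    · congr 1
      ext x
      simp only [Finset.mem_filter, Finset.mem_union]
      constructor
      · rintro ⟨h1, h2, h4⟩
        rcases lt_trichotomy x i with h3 | h3 | h3
        · exact Or.inl ⟨h1, h3, h4⟩
        · exact absurd (h3 ▸ h4) hi
        · exact Or.inr ⟨h1, ⟨h3, h2⟩, h4⟩
      · rintro (⟨h1, h2, h3⟩ | ⟨h1, ⟨h2, h3⟩, h4⟩)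
        · exact ⟨h1, h2.trans hij, h3⟩
        · exact ⟨h1, h3, h4⟩
    · rw [Finset.disjoint_left]
      intro x h1 h2
      rw [Finset.mem_filter] at h1 h2
      omega
  rw [hcard, Nat.even_add]
  simp [hev]

/-- With both lines labelled by `b`, the left ends of the cut pair are `down` and the right ends
`up`. The types of the circles involved are then determined by two parities at `i`, and the tables
hold in three of the four cases. The last case is excluded by a leftmost vertex. -/
theorem surgeryStep_stack_middle (D : Diagram A a b d (i :: rem)) (hl : Fits a b)
    (hr : Fits d b) : SurgeryStep a b d i rem (stack b b) (stack b b) := by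
  have hS := D.isSurgery
  have he := hS.equiv
  have he' := hS.equiv'
  have ho := consistent_stack_middle hl hr (i :: rem)
  have ho' := consistent_stack_middle hl hr rem
  have hcup := D.cuttable.cup_head
  have hiff : SameCircle a b d (i :: rem) (false, i) (true, mate b i) ↔
      SameCircle a b d (i :: rem) (false, i) (true, i) :=
    ⟨fun h => he.trans h (he.symm (D.head_uncut true)), fun h => he.trans h (D.head_uncut true)⟩
  have hiff' : SameCircle a b d rem (false, i) (true, mate b i) ↔
      SameCircle a b d rem (false, i) (false, mate b i) :=
    ⟨fun h => he'.trans h (he'.symm D.head_cut_right), fun h => he'.trans h D.head_cut_right⟩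
  have hdich := hS.dichotomy
  rw [hiff, hiff'] at hdich
  have hre : Reoriented a b d i rem (stack b b) (stack b b) := ⟨ho', fun _ _ _ => rfl⟩
  have hdown : ∀ l, stack b b (l, i) = Label.down := by
    intro l
    rw [← hcup.2.1]
    cases l <;> rfl
  have hup : stack b b (false, mate b i) = Label.up := hcup.2.2.1
  have hdis : ∀ {r : Vertex → Vertex → Prop}, Equivalence r → ∀ {u v : Vertex}, ¬ r u v →
      ∀ w, r u w → ¬ r v w := fun hr _ _ h w h1 h2 => h (hr.trans h1 (hr.symm h2))
  by_cases hs : SameCircle a b d (i :: rem) (false, i) (true, i)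
  · have hs' := hdich.1 hs
    rw [D.surgeryStep_split_iff ho hs]
    have hU : SameCircle a b d (i :: rem) (false, i) = fun v =>
        SameCircle a b d rem (false, i) v ∨ SameCircle a b d rem (false, mate b i) v := by
      funext v
      rw [← D.class_union v, class_eq he hs, or_self]
    have hcount := lineCount_or (A := A) (l := false) (m := i) (hdis he' hs')
    rw [← hU] at hcount
    have hC2 := D.even_lineCount_mate (C := SameCircle a b d rem (false, mate b i))
      (fun u v h h' => he'.trans h' h) fun h => hs' (he'.symm h)
    -- The leftmost vertex of the old circle is leftmost on one of the new circles. If both of these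
    -- were anti-clockwise it would be labelled `down`, so the old circle would be anti-clockwise
    -- too.
    have hx : ¬ (stack b b (false, i) = stdLabel A (SameCircle a b d rem) (false, i) ∧
        stack b b (false, mate b i) = stdLabel A (SameCircle a b d rem) (false, mate b i)) ∨
        stack b b (false, i) = stdLabel A (SameCircle a b d (i :: rem)) (false, i) := by
      by_contra hcon
      rw [not_or, not_not] at hcon
      obtain ⟨u, hu, hlead⟩ := D.exists_lead (v := (false, i)) D.head_mem
      have hou := mt ((D.consistent_iff.1 ho).2 _ _ hu).2 hcon.2
      rw [hlead.stdLabel] at hou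
      have hlead' : IsLead (SameCircle a b d rem) u := by
        intro w hw
        refine hlead w (he.trans (he.symm hu) ?_)
        rw [hU] at hu ⊢
        rcases hu with h | h
        · exact Or.inl (he'.trans h hw)
        · exact Or.inr (he'.trans h hw)
      rw [← hlead'.stdLabel (A := A)] at hou
      rw [hU] at hu
      rcases hu with h | h
      · exact hou (((D.tail.consistent_iff.1 ho').2 _ _ h).1 hcon.1.1)
      · exact hou (((D.tail.consistent_iff.1 ho').2 _ _ h).1 hcon.1.2)
    rw [hdown, hup, eq_comm, stdLabel_eq_down, eq_comm, stdLabel_eq_up, eq_comm,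
      stdLabel_eq_down] at hx ⊢
    refine ⟨hre, ?_⟩
    simp only [hC2, hcount, Nat.even_add] at hx ⊢
    tauto
  · have hs' : SameCircle a b d rem (false, i) (false, mate b i) := by
      by_contra h
      exact hs (hdich.2 h)
    rw [D.surgeryStep_merge_iff ho hs]
    have hU : SameCircle a b d rem (false, i) = fun v =>
        SameCircle a b d (i :: rem) (false, i) v ∨ SameCircle a b d (i :: rem) (true, i) v := by
      funext v
      rw [D.class_union v, class_eq he' hs', or_self]
    have hcount := lineCount_or (A := A) (l := false) (m := i) (hdis he hs)
    rw [← hU] at hcount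
    have hC2 := D.lineCount_head (C := SameCircle a b d (i :: rem) (true, i))
      (fun u v h h' => he.trans h' h)
    -- The leftmost vertex of the merged circle is leftmost on one of the old circles, so that one
    -- is anti-clockwise if the merged circle is.
    have hx : stack b b (false, i) = stdLabel A (SameCircle a b d rem) (false, i) →
        stack b b (false, i) = stdLabel A (SameCircle a b d (i :: rem)) (false, i) ∨
        stack b b (true, i) = stdLabel A (SameCircle a b d (i :: rem)) (true, i) := by
      intro hcon
      obtain ⟨u, hu, hlead⟩ := D.tail.exists_lead (v := (false, i)) D.head_mem
      have hou := ((D.tail.consistent_iff.1 ho').2 _ _ hu).1 hcon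
      rw [hlead.stdLabel] at hou
      have hlead' : IsLead (SameCircle a b d (i :: rem)) u := by
        intro w hw
        refine hlead w (he'.trans (he'.symm hu) ?_)
        rw [hU] at hu ⊢
        rcases hu with h | h
        · exact Or.inl (he.trans h hw)
        · exact Or.inr (he.trans h hw)
      rw [← hlead'.stdLabel (A := A)] at hou
      rw [hU] at hu
      rcases hu with h | h
      · exact Or.inl (((D.consistent_iff.1 ho).2 _ _ h).2 hou)
      · exact Or.inr (((D.consistent_iff.1 ho).2 _ _ h).2 hou)
    have hstd : ∀ r v, Label.down = stdLabel A r v ↔ Even (lineCount A (r v) v.1 v.2) :=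
      fun r v => by rw [eq_comm, stdLabel_eq_down]
    refine ⟨hre, ?_⟩
    simp only [hdown, Ne, hstd, hcount, Nat.even_add, hC2] at hx ⊢
    tauto

/-- Prefix sums never increase along a sequence of surgeries. A sequence that starts and ends at
this orientation therefore keeps all of them, which fixes the intermediate orientation: exactly one
sequence contributes, with coefficient `1`. -/
theorem surgeries_stack_middle {k : Type*} [Field k] (hl : Fits a b) (hr : Fits d b) :
    ∀ {rem : List ℤ}, Diagram A a b d rem →
      surgeries k a b d rem (stack b b) (stack b b) = 1
  | [], _ => by rw [surgeries, Finsupp.single_eq_same]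
  | i :: rem, D => by
    classical
    have ho := consistent_stack_middle hl hr (i :: rem)
    have ho' := consistent_stack_middle hl hr rem
    obtain ⟨s, h1, h2, -⟩ := D.exists_surgeries_sum (k := k) ho
    rw [h2, Finsupp.finsetSum_apply, Finset.sum_eq_single_of_mem (stack b b)
      ((h1 _).2 (D.surgeryStep_stack_middle hl hr)), surgeries_stack_middle hl hr D.tail]
    intro o hos hne
    by_contra hne0
    have hstep := (h1 o).1 hos
    refine hne ?_
    funext v
    obtain ⟨l, x⟩ := v
    by_cases hx : x ∈ A
    · refine eq_of_prefixSum_eq (A := A) (f := fun x => o (l, x))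
        (g := fun x => stack b b (l, x))
        (fun x hx => D.tail.consistent_isArrow hstep.1 (v := (l, x)) hx)
        (fun x hx => D.tail.consistent_isArrow ho' (v := (l, x)) hx) (fun m => ?_) x hx
      exact le_antisymm (D.prefixSum_step_le ho hstep l m)
        (D.tail.prefixSum_le_of_surgeries_ne_zero hstep.1 hne0 l m)
    · refine hstep.2.1 _ ?_ ?_
      · exact fun h => hx ((D.mem_iff h).1 D.head_mem)
      · exact fun h => hx ((D.mem_iff h).1 D.head_mem)

end Diagram

section ClosedCoeff

variable {k : Type*} [Field k] {A : Finset ℤ} {a b d : Labelling}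

theorem closedCoeff_middle (ha : ClosedOn A a) (hb : ClosedOn A b) (hd : ClosedOn A d)
    (hl : Fits a b) (hr : Fits d b) : closedCoeff k a b d b b b = 1 :=
  Diagram.surgeries_stack_middle hl hr ⟨ha, hb, hd, (leftEnds_cuttable hb).1⟩

theorem prefixSum_le_of_closedCoeff_ne_zero (ha : ClosedOn A a) (hb : ClosedOn A b)
    (hd : ClosedOn A d) {lam mu nu : Labelling} (h1 : Fits a lam) (h2 : Fits b lam)
    (h3 : Fits b mu) (h4 : Fits d mu) (h : closedCoeff k a b d lam mu nu ≠ 0) (m : ℤ) :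
    prefixSum A nu m ≤ prefixSum A lam m ∧ prefixSum A nu m ≤ prefixSum A mu m := by
  have D : Diagram A a b d (leftEnds b) := ⟨ha, hb, hd, (leftEnds_cuttable hb).1⟩
  have ho := consistent_stack_leftEnds hb h1 h2 h3 h4
  exact ⟨D.prefixSum_le_of_surgeries_ne_zero ho h false m,
    D.prefixSum_le_of_surgeries_ne_zero ho h true m⟩

end ClosedCoeff


/-! ## Blocks -/

namespace Weight

theorem Equivalent.isArrow_iff {lam mu : Weight} (h : lam.Equivalent mu) (i : ℤ) :
    (mu.lab i).IsArrow ↔ (lam.lab i).IsArrow := by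
  obtain ⟨-, s, -, h2, h3⟩ := h
  rw [h3]
  constructor
  · intro h
    by_contra hn
    rw [h2 i hn] at h
    exact hn h
  · intro h
    by_contra hn
    rw [s.injective (h2 _ hn)] at hn
    exact hn h

theorem Equivalent.eq_of_not_isArrow {lam mu : Weight} (h : lam.Equivalent mu) {i : ℤ}
    (hi : ¬ (lam.lab i).IsArrow) : mu.lab i = lam.lab i := by
  obtain ⟨-, s, -, h2, h3⟩ := h
  rw [h3, h2 i hi]

theorem Equivalent.symm {lam mu : Weight} (h : lam.Equivalent mu) : mu.Equivalent lam := by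
  have h0 := h.isArrow_iff
  obtain ⟨h1, s, hs, h2, h3⟩ := h
  refine ⟨h1.symm, s.symm, hs.subset fun i hi => ?_, fun i hi => ?_, fun i => ?_⟩
  · intro h
    exact hi (by rw [Equiv.symm_apply_eq, h])
  · rw [Equiv.symm_apply_eq, h2 i (mt (h0 i).2 hi)]
  · rw [h3, Equiv.apply_symm_apply]

theorem Equivalent.trans {lam mu nu : Weight} (h : lam.Equivalent mu) (h' : mu.Equivalent nu) :
    lam.Equivalent nu := by
  have h0 := h.isArrow_iff
  obtain ⟨h1, s, hs, h2, h3⟩ := h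
  obtain ⟨h1', t, ht, h2', h3'⟩ := h'
  refine ⟨h1.trans h1', t.trans s, (hs.union ht).subset fun i hi => ?_, fun i hi => ?_,
    fun i => ?_⟩
  · by_contra hn
    simp only [Set.mem_union, Set.mem_ofPred_eq, not_or, not_not] at hn
    exact hi (by rw [Equiv.trans_apply, hn.2, hn.1])
  · rw [Equiv.trans_apply, h2' i (mt (h0 i).1 hi), h2 i hi]
  · rw [h3', h3, Equiv.trans_apply]

/-- The weight obtained by permuting finitely many arrows. -/
def permute (lam : Weight) (s : Equiv.Perm ℤ) (hs : {i | s i ≠ i}.Finite)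
    (h : ∀ i, ¬ (lam.lab i).IsArrow → s i = i) : Weight where
  line := lam.line
  lab i := lam.lab (s i)
  line_ordConnected := lam.line_ordConnected
  lab_off_line i hi := by
    have := lam.lab_off_line i hi
    rw [h i, this]
    rw [this]
    rintro (h | h) <;> cases h
  eventually_sorted := by
    obtain ⟨S, hS, h⟩ := lam.eventually_sorted
    refine ⟨S ∪ {i | s i ≠ i}, hS.union hs, fun i j hi hj hij => ?_⟩
    simp only [Set.mem_union, Set.mem_ofPred_eq, not_or, not_not] at hi hj
    rw [hi.2, hj.2]
    exact h i j hi.1 hj.1 hij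

theorem equivalent_permute (lam : Weight) (s : Equiv.Perm ℤ) (hs : {i | s i ≠ i}.Finite)
    (h : ∀ i, ¬ (lam.lab i).IsArrow → s i = i) : lam.Equivalent (lam.permute s hs h) :=
  ⟨rfl, s, hs, h, fun _ => rfl⟩

/-- The weight obtained by swapping two arrows. -/
def swap (lam : Weight) {i j : ℤ} (hi : (lam.lab i).IsArrow) (hj : (lam.lab j).IsArrow) :
    Weight :=
  lam.permute (Equiv.swap i j) ((Set.toFinite {i, j}).subset fun x hx => by
    by_contra hn
    simp only [Set.mem_insert_iff, Set.mem_singleton_iff, not_or] at hn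
    exact hx (Equiv.swap_apply_of_ne_of_ne hn.1 hn.2)) fun x hx =>
      Equiv.swap_apply_of_ne_of_ne (fun h => hx (h ▸ hi)) fun h => hx (h ▸ hj)

theorem equivalent_swap (lam : Weight) {i j : ℤ} (hi : (lam.lab i).IsArrow)
    (hj : (lam.lab j).IsArrow) : lam.Equivalent (lam.swap hi hj) :=
  lam.equivalent_permute _ _ _

end Weight

/-! ### Windows of blocks. -/

section Window

variable {L : Set Weight} {J : Set ℤ}

theorem IsBlock.equivalent (hL : IsBlock L) {lam mu : Weight} (h : lam ∈ L) (h' : mu ∈ L) :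
    lam.Equivalent mu := by
  obtain ⟨lam₀, rfl⟩ := hL
  exact Weight.Equivalent.trans (Weight.Equivalent.symm h) h'

theorem IsBlock.mem_of_equivalent (hL : IsBlock L) {lam mu : Weight} (h : lam ∈ L)
    (h' : lam.Equivalent mu) : mu ∈ L := by
  obtain ⟨lam₀, rfl⟩ := hL
  exact Weight.Equivalent.trans h h'

theorem IsBlock.nonempty (hL : IsBlock L) : L.Nonempty := by
  obtain ⟨lam₀, rfl⟩ := hL
  exact ⟨lam₀, lam₀.equivalent_refl⟩

theorem exists_ne_of_down_up (hL : IsBlock L) {lam : Weight} (h : lam ∈ L) {i j : ℤ}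
    (hi : lam.lab i = Label.down) (hj : lam.lab j = Label.up) :
    ∃ mu ∈ L, mu.lab i ≠ lam.lab i ∧ mu.lab j ≠ lam.lab j := by
  refine ⟨lam.swap (Or.inl hi) (Or.inr hj),
    hL.mem_of_equivalent h (lam.equivalent_swap _ _), ?_, ?_⟩
  · change lam.lab (Equiv.swap i j i) ≠ _
    rw [Equiv.swap_apply_left, hi, hj]
    exact fun h => by cases h
  · change lam.lab (Equiv.swap i j j) ≠ _
    rw [Equiv.swap_apply_right, hi, hj]
    exact fun h => by cases h

/-- Swapping the two arrows gives another weight of the block whose labels differ at both vertices,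
whereas all weights of the block agree outside of the window. -/
theorem IsWindow.mem_of_down_up (hL : IsBlock L) (hJ : IsWindow L J) {lam : Weight}
    (h : lam ∈ L) {i j : ℤ} (hi : lam.lab i = Label.down) (hj : lam.lab j = Label.up) :
    i ∈ J ∧ j ∈ J := by
  obtain ⟨mu, hmu, h1, h2⟩ := exists_ne_of_down_up hL h hi hj
  constructor
  · by_contra hn
    exact h1 (hJ.agree mu hmu lam h i hn)
  · by_contra hn
    exact h2 (hJ.agree mu hmu lam h j hn)

/-- A finite block has a window. -/
theorem exists_isWindow (hL : IsBlock L) (hfin : L.Finite) : ∃ J, IsWindow L J := by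
  -- The vertices at which the label varies within the block. Two equivalent weights differ at
  -- finitely many vertices, so `D` is finite for a finite block, and its convex hull `J` is the
  -- window.
  let D : Set ℤ := {x | ∃ lam ∈ L, ∃ mu ∈ L, lam.lab x ≠ mu.lab x}
  have hD : D.Finite := by
    have : D ⊆ ⋃ lam ∈ L, ⋃ mu ∈ L, {x | lam.lab x ≠ mu.lab x} := by
      rintro x ⟨lam, hl, mu, hm, h⟩
      simp only [Set.mem_iUnion]
      exact ⟨lam, hl, mu, hm, h⟩
    refine Set.Finite.subset (hfin.biUnion fun lam hl => hfin.biUnion fun mu hm => ?_) this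
    obtain ⟨-, s, hs, -, h⟩ := hL.equivalent hl hm
    refine hs.subset fun x hx => ?_
    intro hsx
    exact hx (by rw [h, hsx])
  let J : Set ℤ := {x | ∃ y ∈ D, ∃ z ∈ D, y ≤ x ∧ x ≤ z}
  have hDJ : D ⊆ J := fun x hx => ⟨x, hx, x, hx, le_rfl, le_rfl⟩
  have hDline : ∀ lam ∈ L, D ⊆ lam.line := by
    rintro lam hl x ⟨mu, hm, nu, hn, h⟩
    rw [(hL.equivalent hl hm).1]
    by_contra hx
    have hx' := hx
    rw [(hL.equivalent hm hn).1] at hx'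
    exact h ((mu.lab_off_line x hx).trans (nu.lab_off_line x hx').symm)
  refine ⟨J, ?_, ?_, ?_, ?_, ?_⟩
  · refine Set.Finite.subset (hD.biUnion fun y _ => hD.biUnion fun z _ => Set.finite_Icc y z) ?_
    rintro x ⟨y, hy, z, hz, h⟩
    simp only [Set.mem_iUnion]
    exact ⟨y, hy, z, hz, h⟩
  · refine ⟨?_⟩
    rintro x ⟨y, hy, -, -, hyx, -⟩ x' ⟨-, -, z, hz, -, hz'⟩ w hw
    exact ⟨y, hy, z, hz, hyx.trans hw.1, hw.2.trans hz'⟩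
  · rintro lam hl x ⟨y, hy, z, hz, h⟩
    exact lam.line_ordConnected.out (hDline lam hl hy) (hDline lam hl hz) h
  · rintro lam hl i j hi - - ⟨h1, h2⟩
    obtain ⟨mu, hm, h, -⟩ := exists_ne_of_down_up hL hl h1 h2
    exact hi (hDJ ⟨mu, hm, lam, hl, h⟩)
  · intro lam hl mu hm i hi
    by_contra h
    exact hi (hDJ ⟨lam, hl, mu, hm, h⟩)

theorem IsWindow.mono (hJ : IsWindow L J) {S : Set Weight} (hS : S ⊆ L) : IsWindow S J :=
  ⟨hJ.finite, hJ.ordConnected, fun lam h => hJ.subset_line lam (hS h),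
    fun lam h => hJ.sorted lam (hS h), fun lam h mu h' => hJ.agree lam (hS h) mu (hS h')⟩

/-- The products of diagrams in a finite block are all computed on the same window. -/
theorem exists_window_eq (hL : IsBlock L) (hfin : L.Finite) :
    ∃ J, IsWindow L J ∧ ∀ (S : Set Weight), ∀ lam ∈ L, window L S lam.line = J := by
  classical
  obtain ⟨lam₀, h₀⟩ := hL.nonempty
  have hline : ∀ lam ∈ L, lam.line = lam₀.line := fun lam h => (hL.equivalent h h₀).1
  by_cases hf : lam₀.line.Finite
  · refine ⟨lam₀.line, ⟨hf, lam₀.line_ordConnected, fun lam h => (hline lam h).ge, ?_, ?_⟩, ?_⟩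
    · rintro lam h i j hi - - ⟨h', -⟩
      rw [← hline lam h] at hi
      rw [lam.lab_off_line i hi] at h'
      cases h'
    · intro lam h mu h' i hi
      rw [lam.lab_off_line i (hline lam h ▸ hi), mu.lab_off_line i (hline mu h' ▸ hi)]
    · intro S lam h
      rw [window, hline lam h, if_pos hf]
  · have hex := exists_isWindow hL hfin
    refine ⟨hex.choose, hex.choose_spec, fun S lam h => ?_⟩
    rw [window, hline lam h, if_neg hf, dif_pos hex]

end Window

/-! ## Sums of signs -/

theorem excess_eq_sum (f : Labelling) (i k : ℤ) :
    excess f i k = ∑ x ∈ Finset.Ioc i k, (f x).sign := by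
  rw [excess, Finset.card_filter, Finset.card_filter]
  push_cast
  rw [← Finset.sum_sub_distrib]
  refine Finset.sum_congr rfl fun x _ => ?_
  cases f x <;> simp [Label.sign]

theorem Opposite.sign_add {l l' : Label} (h : Opposite l l') : l.sign + l'.sign = 0 := by
  rcases h with ⟨rfl, rfl⟩ | ⟨rfl, rfl⟩ <;> rfl

theorem Label.sign_le_one (l : Label) : l.sign ≤ 1 := by cases l <;> decide

theorem Label.neg_one_le_sign (l : Label) : -1 ≤ l.sign := by cases l <;> decide

theorem Label.sign_eq_one_iff {l : Label} : l.sign = 1 ↔ l = Label.down := by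
  cases l <;> decide

theorem Label.sign_eq_neg_one_iff {l : Label} : l.sign = -1 ↔ l = Label.up := by
  cases l <;> decide

theorem sign_eq_zero {l : Label} (h : ¬ l.IsArrow) : l.sign = 0 := by
  cases l
  · rfl
  · rfl
  · exact absurd (Or.inl rfl) h
  · exact absurd (Or.inr rfl) h

/-- The contributions of the two ends of a cup cancel. -/
theorem sum_sign_eq_zero {f g : Labelling} {S : Finset ℤ}
    (hS : ∀ x ∈ S, (∃ j, IsCup f x j ∨ IsCup f j x) ∧ mate f x ∈ S) (hg : Fits f g) :
    ∑ x ∈ S, (g x).sign = 0 := by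
  refine Finset.sum_involution (fun x _ => mate f x) ?_ ?_ (fun x hx => (hS x hx).2)
    fun x _ => mate_mate f x
  · intro x hx
    rcases cup_mate (hS x hx).1 with h | h
    · exact (hg _ _ h).sign_add
    · rw [add_comm]
      exact (hg _ _ h).sign_add
  · intro x hx _ he
    rcases cup_mate (hS x hx).1 with h | h
    · have := h.1
      omega
    · have := h.1
      omega

theorem ClosedOn.sum_sign {A : Finset ℤ} {f g : Labelling} (hf : ClosedOn A f) (hg : Fits f g) :
    ∑ x ∈ A, (g x).sign = 0 :=
  sum_sign_eq_zero (fun _ hx => ⟨hf.matched _ hx, hf.mate_mem hx⟩) hg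

/-- A sequence of arrows with all `up`'s before all `down`'s is determined by the numbers of both.
If `f` had an `up` where `g` has a `down`, sortedness would give `f ≤ g` in sign everywhere,
strictly at that vertex, contradicting the equality of sums. -/
theorem eq_on_of_sorted {R : Finset ℤ} {f g : Labelling} (hf : ∀ x ∈ R, (f x).IsArrow)
    (hg : ∀ x ∈ R, (g x).IsArrow)
    (hfs : ∀ x ∈ R, ∀ y ∈ R, x < y → ¬ (f x = Label.down ∧ f y = Label.up))
    (hgs : ∀ x ∈ R, ∀ y ∈ R, x < y → ¬ (g x = Label.down ∧ g y = Label.up))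
    (hsum : ∑ x ∈ R, (f x).sign = ∑ x ∈ R, (g x).sign) : ∀ x ∈ R, f x = g x := by
  have key : ∀ f g : Labelling, (∀ x ∈ R, (f x).IsArrow) → (∀ x ∈ R, (g x).IsArrow) →
      (∀ x ∈ R, ∀ y ∈ R, x < y → ¬ (f x = Label.down ∧ f y = Label.up)) →
      (∀ x ∈ R, ∀ y ∈ R, x < y → ¬ (g x = Label.down ∧ g y = Label.up)) →
      ∑ x ∈ R, (f x).sign = ∑ x ∈ R, (g x).sign → ∀ j ∈ R, f j = Label.up →
      g j = Label.down → False := by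
    intro f g hf hg hfs hgs hsum j hj h1 h2
    refine absurd hsum (ne_of_lt (Finset.sum_lt_sum (fun x hx => ?_) ⟨j, hj, ?_⟩))
    · rcases lt_trichotomy x j with h | rfl | h
      · have : f x = Label.up := (hf x hx).resolve_left fun h' => hfs x hx j hj h ⟨h', h1⟩
        rw [this]
        exact (g x).neg_one_le_sign
      · rw [h1, h2]
        decide
      · have : g x = Label.down := (hg x hx).resolve_right fun h' => hgs j hj x hx h ⟨h2, h'⟩
        rw [this]
        exact (f x).sign_le_one
    · rw [h1, h2]
      decide
  intro x hx
  rcases hf x hx with h | h <;> rcases hg x hx with h' | h'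
  · rw [h, h']
  · exact (key g f hg hf hgs hfs hsum.symm x hx h' h).elim
  · exact (key f g hf hg hfs hgs hsum x hx h h').elim
  · rw [h, h']

theorem exists_perm_of_sum_eq {T : Finset ℤ} {f g : Labelling} (hf : ∀ x ∈ T, (f x).IsArrow)
    (hg : ∀ x ∈ T, (g x).IsArrow) (hsum : ∑ x ∈ T, (f x).sign = ∑ x ∈ T, (g x).sign) :
    ∃ s : Equiv.Perm ℤ, (∀ x, x ∉ T → s x = x) ∧ ∀ x ∈ T, g x = f (s x) := by
  classical
  -- On `T` the number of arrows is `T.card` and their signs add up to the given sum, so twice the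
  -- number of `down`'s or `up`'s is the sum or difference of these two.
  have hcard : ∀ h : Labelling, (∀ x ∈ T, (h x).IsArrow) → ∀ l : Label,
      ((T.filter fun x => h x = l).card : ℤ) * 2 = if l = Label.down then
        T.card + ∑ x ∈ T, (h x).sign else if l = Label.up then T.card - ∑ x ∈ T, (h x).sign
          else 0 := by
    intro h hh l
    rw [Finset.card_filter]
    push_cast
    rw [Finset.sum_mul, Finset.card_eq_sum_ones]
    push_cast
    rw [← Finset.sum_add_distrib, ← Finset.sum_sub_distrib]
    cases l <;> simp only [reduceCtorEq, if_false, if_true]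
    · refine Finset.sum_eq_zero fun x hx => ?_
      rcases hh x hx with e | e <;> simp [e]
    · refine Finset.sum_eq_zero fun x hx => ?_
      rcases hh x hx with e | e <;> simp [e]
    · refine Finset.sum_congr rfl fun x hx => ?_
      rcases hh x hx with e | e <;> simp [e, Label.sign]
    · refine Finset.sum_congr rfl fun x hx => ?_
      rcases hh x hx with e | e <;> simp [e, Label.sign]
  have hfib : ∀ l, Nonempty ({x : T // g x = l} ≃ {x : T // f x = l}) := by
    intro l
    have hsub : ∀ h : Labelling, Fintype.card {x : T // h x = l} =
        (T.filter fun x => h x = l).card := by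
      intro h
      rw [Fintype.card_subtype, ← Finset.card_map (Function.Embedding.subtype _)]
      congr 1
      ext x
      simp [and_comm]
    refine ⟨Fintype.equivOfCardEq ?_⟩
    rw [hsub, hsub]
    have h1 := hcard f hf l
    have h2 := hcard g hg l
    rw [hsum, ← h2] at h1
    omega
  let e : Equiv.Perm T := Equiv.ofFiberEquiv (f := fun x : T => g x) (g := fun x : T => f x)
    fun l => (hfib l).some
  refine ⟨Equiv.Perm.ofSubtype e, fun x hx => Equiv.Perm.ofSubtype_apply_of_not_mem e hx,
    fun x hx => ?_⟩
  rw [Equiv.Perm.ofSubtype_apply_of_mem e hx]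
  exact (Equiv.ofFiberEquiv_map (f := fun x : T => g x) (g := fun x : T => f x)
    (fun l => (hfib l).some) ⟨x, hx⟩).symm

/-! ## The Bruhat order -/

/-- A `down` and an `up` are swapped so that the `down` moves to the right. -/
def SwapStep (f g : Labelling) : Prop :=
  ∃ i j : ℤ, i < j ∧ f i = Label.down ∧ f j = Label.up ∧
    g = Function.update (Function.update f i Label.up) j Label.down

theorem prefixSum_sub (A : Finset ℤ) (f g : Labelling) (m : ℤ) :
    prefixSum A f m - prefixSum A g m = ∑ x ∈ A with x < m, ((f x).sign - (g x).sign) :=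
  (Finset.sum_sub_distrib _ _).symm

theorem prefixSum_update {A : Finset ℤ} {f : Labelling} {i j : ℤ} (hij : i < j)
    (hi : f i = Label.down) (hj : f j = Label.up) (hiA : i ∈ A) (hjA : j ∈ A) (m : ℤ) :
    prefixSum A (Function.update (Function.update f i Label.up) j Label.down) m =
      prefixSum A f m - if i < m ∧ m ≤ j then 2 else 0 := by
  have h := prefixSum_sub A (Function.update (Function.update f i Label.up) j Label.down) f m
  have hterm : ∀ x, (Function.update (Function.update f i Label.up) j Label.down x).sign -
      (f x).sign = (if x = i then -2 else 0) + if x = j then 2 else 0 := by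
    intro x
    by_cases h1 : x = j
    · subst h1
      rw [Function.update_self, hj, if_neg hij.ne', if_pos rfl]
      rfl
    · rw [Function.update_of_ne h1, if_neg h1]
      by_cases h2 : x = i
      · subst h2
        rw [Function.update_self, hi, if_pos rfl]
        rfl
      · rw [Function.update_of_ne h2, if_neg h2, sub_self, add_zero]
  simp only [hterm] at h
  rw [Finset.sum_add_distrib, Finset.sum_ite_eq', Finset.sum_ite_eq'] at h
  simp only [Finset.mem_filter, hiA, hjA, true_and] at h
  split_ifs at h ⊢ <;> omega

/-- Induction on the number of disagreements. Swap the leftmost vertex `j` where `f` is `up` and `g`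
is `down` with a vertex `i` to its left where it is the other way round. Two disagreements disappear
and the domination of prefix sums survives. If there is no such `j`, all differences of signs are
nonnegative with sum zero. -/
theorem swapSteps_of_prefixSum_le {T : Finset ℤ} : ∀ (n : ℕ) {f g : Labelling},
    (T.filter fun x => f x ≠ g x).card ≤ n → (∀ x ∈ T, (f x).IsArrow) →
    (∀ x ∈ T, (g x).IsArrow) → (∀ x, x ∉ T → f x = g x) →
    ∑ x ∈ T, (f x).sign = ∑ x ∈ T, (g x).sign →
    (∀ m, prefixSum T g m ≤ prefixSum T f m) → Relation.ReflTransGen SwapStep f g := by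
  intro n
  induction n with
  | zero =>
    intro f g hn _ _ hoff _ _
    have : f = g := by
      funext x
      by_cases hx : x ∈ T
      · by_contra hne
        rw [Nat.le_zero, Finset.card_eq_zero, Finset.filter_eq_empty_iff] at hn
        exact hn hx hne
      · exact hoff x hx
    rw [this]
  | succ n ih =>
    intro f g hn hf hg hoff hsum hle
    have hterm : ∀ x ∈ T, ¬ (f x = Label.up ∧ g x = Label.down) →
        0 ≤ (f x).sign - (g x).sign := by
      intro x hx h
      rcases hf x hx with e1 | e1 <;> rcases hg x hx with e2 | e2 <;>
        simp_all [Label.sign]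
    let S := T.filter fun x => f x = Label.up ∧ g x = Label.down
    by_cases hS : S.Nonempty
    · have hjS := S.min'_mem hS
      set j := S.min' hS with hj
      obtain ⟨hjT, hfj, hgj⟩ := Finset.mem_filter.1 hjS
      have hmin : ∀ x ∈ T, x < j → 0 ≤ (f x).sign - (g x).sign := by
        intro x hx hxj
        refine hterm x hx fun h => ?_
        exact absurd hxj (not_lt.2 (S.min'_le x (Finset.mem_filter.2 ⟨hx, h⟩)))
      -- Otherwise `f` and `g` agree to the left of `j`, and the prefix sums up to and including `j`
      -- violate the hypothesis.
      have hex : ∃ i ∈ T, i < j ∧ f i = Label.down ∧ g i = Label.up := by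
        by_contra hcon
        have hzero : ∀ x ∈ T, x < j → (f x).sign - (g x).sign = 0 := by
          intro x hx hxj
          have h1 := hmin x hx hxj
          rcases hf x hx with e1 | e1 <;> rcases hg x hx with e2 | e2
          · rw [e1, e2]; rfl
          · exact absurd ⟨x, hx, hxj, e1, e2⟩ hcon
          · rw [e1, e2] at h1
            exact absurd h1 (by decide)
          · rw [e1, e2]; rfl
        have h1 := hle (j + 1)
        have h2 := prefixSum_sub T f g (j + 1)
        rw [Finset.sum_eq_single_of_mem j (Finset.mem_filter.2 ⟨hjT, by omega⟩), hfj, hgj] at h2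
        · simp only [Label.sign] at h2
          omega
        · intro x hx hne
          rw [Finset.mem_filter] at hx
          exact hzero x hx.1 (by omega)
      obtain ⟨i, hiT, hij, hfi, hgi⟩ := hex
      refine Relation.ReflTransGen.head ⟨i, j, hij, hfi, hfj, rfl⟩ (ih ?_ ?_ hg ?_ ?_ ?_)
      · refine Nat.le_of_lt_succ (lt_of_lt_of_le (Finset.card_lt_card ?_) hn)
        refine Finset.ssubset_iff_subset_ne.2 ⟨fun x hx => ?_, fun h => ?_⟩
        · rw [Finset.mem_filter] at hx ⊢
          refine ⟨hx.1, fun h => hx.2 ?_⟩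
          have h1 : x ≠ j := by
            rintro rfl
            rw [hfj, hgj] at h
            cases h
          have h2 : x ≠ i := by
            rintro rfl
            rw [hfi, hgi] at h
            cases h
          rw [Function.update_of_ne h1, Function.update_of_ne h2, h]
        · have : j ∈ T.filter fun x => f x ≠ g x :=
            Finset.mem_filter.2 ⟨hjT, by rw [hfj, hgj]; exact fun h => by cases h⟩
          rw [← h, Finset.mem_filter, Function.update_self, hgj] at this
          exact this.2 rfl
      · intro x hx
        by_cases h1 : x = j
        · rw [h1, Function.update_self]
          exact Or.inl rfl
        · rw [Function.update_of_ne h1]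
          by_cases h2 : x = i
          · rw [h2, Function.update_self]
            exact Or.inr rfl
          · rw [Function.update_of_ne h2]
            exact hf x hx
      · intro x hx
        have h1 : x ≠ j := fun h => hx (h ▸ hjT)
        have h2 : x ≠ i := fun h => hx (h ▸ hiT)
        rw [Function.update_of_ne h1, Function.update_of_ne h2]
        exact hoff x hx
      · rw [← hsum]
        obtain ⟨m, hm⟩ := T.finite_toSet.bddAbove
        have hfull : ∀ h : Labelling, prefixSum T h (max m j + 1) = ∑ x ∈ T, (h x).sign := by
          intro h
          rw [prefixSum, Finset.filter_true_of_mem]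
          intro x hx
          have := hm hx
          omega
        rw [← hfull, ← hfull, prefixSum_update hij hfi hfj hiT hjT, if_neg (by omega), sub_zero]
      · intro m
        rw [prefixSum_update hij hfi hfj hiT hjT]
        split_ifs with hm
        -- The swap lowers the prefix sum by two for `m` in `(i, j]`. There the difference was at
        -- least two: `i` contributes two, and nothing to the left of `j` is negative.
        · have h2 := prefixSum_sub T f g m
          have h3 := Finset.single_le_sum (f := fun x => (f x).sign - (g x).sign)
            (s := T.filter fun x => x < m) (fun x hx => by
              rw [Finset.mem_filter] at hx
              exact hmin x hx.1 (by omega)) (Finset.mem_filter.2 ⟨hiT, hm.1⟩)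
          simp only [← h2, hfi, hgi] at h3
          have h4 : Label.down.sign - Label.up.sign = 2 := rfl
          omega
        · rw [sub_zero]
          exact hle m
    · have hzero := (Finset.sum_eq_zero_iff_of_nonneg (s := T)
        (f := fun x => (f x).sign - (g x).sign) (fun x hx => hterm x hx fun h =>
          hS ⟨x, Finset.mem_filter.2 ⟨hx, h⟩⟩)).1 (by rw [Finset.sum_sub_distrib, hsum, sub_self])
      have : f = g := by
        funext x
        by_cases hx : x ∈ T
        · exact (hf x hx).sign_inj (hg x hx) (sub_eq_zero.1 (hzero x hx))
        · exact hoff x hx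
      rw [this]

/-- Each intermediate labelling has to be realised by a weight; a finite permutation of the arrows
keeps the finiteness condition. -/
theorem Weight.bruhatLE_of_swapSteps {lam : Weight} {g : Labelling}
    (h : Relation.ReflTransGen SwapStep lam.lab g) :
    ∃ mu : Weight, lam.BruhatLE mu ∧ mu.line = lam.line ∧ mu.lab = g := by
  induction h with
  | refl => exact ⟨lam, Relation.ReflTransGen.refl, rfl, rfl⟩
  | tail _ hstep ih =>
    obtain ⟨mu, h1, h2, rfl⟩ := ih
    obtain ⟨i, j, hij, hi, hj, rfl⟩ := hstep
    have hlab : (mu.swap (Or.inl hi) (Or.inr hj)).lab =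
        Function.update (Function.update mu.lab i Label.up) j Label.down := by
      funext x
      change mu.lab (Equiv.swap i j x) = _
      by_cases h1 : x = j
      · rw [h1, Equiv.swap_apply_right, Function.update_self, hi]
      · rw [Function.update_of_ne h1]
        by_cases h2 : x = i
        · rw [h2, Equiv.swap_apply_left, Function.update_self, hj]
        · rw [Function.update_of_ne h2, Equiv.swap_apply_of_ne_of_ne h2 h1]
    exact ⟨mu.swap (Or.inl hi) (Or.inr hj), h1.tail ⟨rfl, i, j, hij, hi, hj, hlab⟩, h2, hlab⟩

theorem Weight.BruhatStep.equivalent {lam mu : Weight} (h : lam.BruhatStep mu) :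
    lam.Equivalent mu := by
  obtain ⟨h0, i, j, hij, hi, hj, h⟩ := h
  have h1 := lam.equivalent_swap (Or.inl hi) (Or.inr hj)
  have : mu = lam.swap (Or.inl hi) (Or.inr hj) := by
    refine Weight.ext h0.symm ?_
    rw [h]
    funext x
    change _ = lam.lab (Equiv.swap i j x)
    by_cases h1 : x = j
    · rw [h1, Equiv.swap_apply_right, Function.update_self, hi]
    · rw [Function.update_of_ne h1]
      by_cases h2 : x = i
      · rw [h2, Equiv.swap_apply_left, Function.update_self, hj]
      · rw [Function.update_of_ne h2, Equiv.swap_apply_of_ne_of_ne h2 h1]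
  rw [this]
  exact h1


/-! ## Closures -/

/-- The labelling obtained by adding `p` vertices labelled `down` to the left end of the interval
from `m` to `M`, and `q` vertices labelled `up` to its right end. -/
def padded (m M : ℤ) (p q : ℕ) (f : Labelling) : Labelling := fun x =>
  if m ≤ x ∧ x ≤ M then f x
  else if m - p ≤ x ∧ x < m then Label.down
  else if M < x ∧ x ≤ M + q then Label.up
  else Label.nought

section Padded

variable {m M : ℤ} {p q : ℕ} {f g : Labelling}

theorem padded_of_mem {x : ℤ} (h1 : m ≤ x) (h2 : x ≤ M) : padded m M p q f x = f x :=
  if_pos ⟨h1, h2⟩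

theorem padded_left {x : ℤ} (h1 : m - p ≤ x) (h2 : x < m) :
    padded m M p q f x = Label.down := by
  rw [padded, if_neg (by omega), if_pos ⟨h1, h2⟩]

theorem padded_right (hmM : m ≤ M + 1) {x : ℤ} (h1 : M < x) (h2 : x ≤ M + q) :
    padded m M p q f x = Label.up := by
  rw [padded, if_neg (by omega), if_neg (by omega), if_pos ⟨h1, h2⟩]

theorem padded_congr {x : ℤ} (h : ¬ (m ≤ x ∧ x ≤ M)) :
    padded m M p q f x = padded m M p q g x := by
  rw [padded, padded, if_neg h, if_neg h]

theorem mem_of_padded_isArrow {x : ℤ} (h : (padded m M p q f x).IsArrow) (hmM : m ≤ M + 1) :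
    m - p ≤ x ∧ x ≤ M + q := by
  unfold padded at h
  split_ifs at h
  · omega
  · omega
  · omega
  · rcases h with h | h <;> cases h

theorem closureOn_eq_padded (hmM : m ≤ M + 1)
    (hp : ((Finset.Icc m M).filter fun x => f x = Label.up).card = p)
    (hq : ((Finset.Icc m M).filter fun x => f x = Label.down).card = q) :
    closureOn (Set.Icc m M) f = padded m M p q f := by
  classical
  have hcard : ∀ l, {i | i ∈ Set.Icc m M ∧ f i = l}.ncard =
      ((Finset.Icc m M).filter fun x => f x = l).card := by
    intro l
    rw [← Set.ncard_coe_finset]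
    congr 1
    ext x
    simp
  funext x
  unfold closureOn padded
  rw [hcard, hcard, hp, hq]
  have h1 : ((∃ y ∈ Set.Icc m M, x < y) ∧ ∃ y ∈ Set.Icc m M, y ≤ x + (p : ℤ)) ↔
      m ≤ M ∧ x < M ∧ m - p ≤ x := by
    constructor
    · rintro ⟨⟨y, ⟨h1, h2⟩, h3⟩, z, ⟨h4, h5⟩, h6⟩
      omega
    · rintro ⟨h1, h2, h3⟩
      exact ⟨⟨M, ⟨h1, le_rfl⟩, h2⟩, m, ⟨le_rfl, h1⟩, by omega⟩
  have h2 : ((∃ y ∈ Set.Icc m M, y < x) ∧ ∃ y ∈ Set.Icc m M, x ≤ y + (q : ℤ)) ↔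
      m ≤ M ∧ m < x ∧ x ≤ M + q := by
    constructor
    · rintro ⟨⟨y, ⟨h1, h2⟩, h3⟩, z, ⟨h4, h5⟩, h6⟩
      omega
    · rintro ⟨h1, h2, h3⟩
      exact ⟨⟨m, ⟨le_rfl, h1⟩, h2⟩, M, ⟨h1, le_rfl⟩, by omega⟩
  rw [if_congr h1 rfl rfl, if_congr h2 rfl rfl, Set.mem_Icc]
  by_cases hle : m ≤ M
  · split_ifs <;> first | rfl | omega
  -- For an empty window there are no arrows to balance, so nothing is added.
  · have hp0 : p = 0 := by
      rw [← hp, Finset.Icc_eq_empty hle]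
      rfl
    have hq0 : q = 0 := by
      rw [← hq, Finset.Icc_eq_empty hle]
      rfl
    subst hp0 hq0
    split_ifs <;> first | rfl | omega

theorem excess_padded_left {k : ℤ} (h1 : m - p - 1 ≤ k) (h2 : k ≤ m - 1) :
    excess (padded m M p q f) (m - p - 1) k = k - (m - p - 1) := by
  rw [excess_eq_sum, Finset.sum_congr rfl (g := fun _ => 1)]
  · rw [Finset.sum_const, Int.card_Ioc, nsmul_eq_mul, mul_one]
    omega
  · intro x hx
    rw [Finset.mem_Ioc] at hx
    rw [padded_left (by omega) (by omega)]
    rfl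

theorem excess_padded_right (hmM : m ≤ M + 1) {k : ℤ} (h1 : M ≤ k) (h2 : k ≤ M + q) :
    excess (padded m M p q f) M k = -(k - M) := by
  rw [excess_eq_sum, Finset.sum_congr rfl (g := fun _ => -1)]
  · rw [Finset.sum_const, Int.card_Ioc, nsmul_eq_mul]
    omega
  · intro x hx
    rw [Finset.mem_Ioc] at hx
    rw [padded_right hmM (by omega) (by omega)]
    rfl

theorem excess_interval (hp : ((Finset.Icc m M).filter fun x => f x = Label.up).card = p)
    (hq : ((Finset.Icc m M).filter fun x => f x = Label.down).card = q) :
    excess f (m - 1) M = q - p := by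
  have : Finset.Ioc (m - 1) M = Finset.Icc m M := by
    ext x
    rw [Finset.mem_Ioc, Finset.mem_Icc]
    omega
  rw [excess, this, hp, hq]

/-- The `p` added `down`'s raise the excess to `p`; the window contains only `p` labels `up` and
leaves it at `q`; the added `up`'s then lower it by at most `q`. The excess starts at `m - p - 1`
because it ignores its left end point. -/
theorem excess_padded_nonneg (hmM : m ≤ M + 1)
    (hp : ((Finset.Icc m M).filter fun x => f x = Label.up).card = p)
    (hq : ((Finset.Icc m M).filter fun x => f x = Label.down).card = q) {k : ℤ}
    (h1 : m - p - 1 ≤ k) (h2 : k ≤ M + q) :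
    0 ≤ excess (padded m M p q f) (m - p - 1) k := by
  have hmid : ∀ k ≤ M, excess (padded m M p q f) (m - 1) k = excess f (m - 1) k := fun k hk =>
    excess_congr fun x h1 h2 => padded_of_mem (by omega) (by omega)
  have hleft := excess_padded_left (m := m) (M := M) (p := p) (q := q) (f := f) (k := m - 1)
    (by omega) le_rfl
  rcases le_or_gt k (m - 1) with h3 | h3
  · rw [excess_padded_left h1 h3]
    omega
  rcases le_or_gt k M with h4 | h4
  · rw [excess_add _ (by omega : m - p - 1 ≤ m - 1) h3.le, hleft, hmid k h4]
    have hsub : ((Finset.Ioc (m - 1) k).filter fun x => f x = Label.up).card ≤ p := by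
      rw [← hp]
      refine Finset.card_le_card fun x hx => ?_
      rw [Finset.mem_filter, Finset.mem_Ioc] at hx
      rw [Finset.mem_filter, Finset.mem_Icc]
      exact ⟨by omega, hx.2⟩
    rw [excess]
    omega
  · rw [excess_add _ (by omega : m - p - 1 ≤ M) h4.le,
      excess_add _ (by omega : m - p - 1 ≤ m - 1) (by omega : m - 1 ≤ M), hleft,
      hmid M le_rfl, excess_interval hp hq, excess_padded_right hmM h4.le h2]
    omega

theorem excess_padded_total (hmM : m ≤ M + 1)
    (hp : ((Finset.Icc m M).filter fun x => f x = Label.up).card = p)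
    (hq : ((Finset.Icc m M).filter fun x => f x = Label.down).card = q) :
    excess (padded m M p q f) (m - p - 1) (M + q) = 0 := by
  have hmid : excess (padded m M p q f) (m - 1) M = excess f (m - 1) M :=
    excess_congr fun x h1 h2 => padded_of_mem (by omega) (by omega)
  rw [excess_add _ (by omega : m - p - 1 ≤ M) (by omega : M ≤ M + q),
      excess_add _ (by omega : m - p - 1 ≤ m - 1) (by omega : m - 1 ≤ M),
      excess_padded_left (by omega) le_rfl, hmid, excess_interval hp hq,
      excess_padded_right hmM (by omega) le_rfl]
  omega

/-- The cup diagram of a closure has no rays. -/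
theorem closedOn_padded (hmM : m ≤ M + 1)
    (hp : ((Finset.Icc m M).filter fun x => f x = Label.up).card = p)
    (hq : ((Finset.Icc m M).filter fun x => f x = Label.down).card = q) {A : Finset ℤ}
    (hA : ∀ x, (padded m M p q f x).IsArrow ↔ x ∈ A) : ClosedOn A (padded m M p q f) := by
  refine ⟨hA, fun i hi => ?_⟩
  have hmem := mem_of_padded_isArrow ((hA i).2 hi) hmM
  have hnonneg : ∀ k, m - p - 1 ≤ k → k ≤ M + q → 0 ≤ excess (padded m M p q f) (m - p - 1) k :=
    fun k => excess_padded_nonneg hmM hp hq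
  rcases (hA i).2 hi with h | h
  -- The total excess is zero. An unmatched `down` at `i` would give at least zero before `i`, one
  -- at `i`, and at least zero afterwards.
  · by_contra hn
    have h1 := excess_nonneg_of_unmatched h (fun ⟨j, hj⟩ => hn ⟨j, Or.inl hj⟩) (M + q) hmem.2
    have h2 := excess_padded_total hmM hp hq
    rw [excess_add _ (by omega : m - p - 1 ≤ i) hmem.2, excess_last _ (by omega), h,
      if_pos rfl] at h2
    have h3 := hnonneg (i - 1) (by omega) (by omega)
    omega
  -- Up to an unmatched `up` the excess would be at most zero, hence negative after it.
  · by_contra hn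
    have h1 := excess_nonpos_of_unmatched h (fun ⟨j, hj⟩ => hn ⟨j, Or.inr hj⟩) (m - p - 1)
      (by omega)
    have h2 := hnonneg i (by omega) hmem.2
    rw [excess_last _ (by omega), h, if_neg (by decide), if_pos rfl] at h2
    omega

end Padded

/-- The window of a block, written as an interval, together with the numbers of `up`'s and
`down`'s that the weights of the block have in the window. -/
structure IsFrame (L : Set Weight) (m M : ℤ) (p q : ℕ) : Prop where
  block : IsBlock L
  window : IsWindow L (Set.Icc m M)
  le : m ≤ M + 1
  ups : ∀ lam ∈ L, ((Finset.Icc m M).filter fun x => lam.lab x = Label.up).card = p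
  downs : ∀ lam ∈ L, ((Finset.Icc m M).filter fun x => lam.lab x = Label.down).card = q

theorem exists_eq_Icc {J : Set ℤ} (hf : J.Finite) (hc : J.OrdConnected) :
    ∃ m M : ℤ, m ≤ M + 1 ∧ J = Set.Icc m M := by
  rcases J.eq_empty_or_nonempty with rfl | hne
  -- The empty window is the interval with `m = M + 1`, the extreme case that `IsFrame` admits.
  · exact ⟨0, -1, by norm_num, by simp⟩
  · have hne' : hf.toFinset.Nonempty := hf.toFinset_nonempty.2 hne
    refine ⟨hf.toFinset.min' hne', hf.toFinset.max' hne', ?_, ?_⟩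
    · have := hf.toFinset.min'_le_max' hne'
      omega
    · refine Set.Subset.antisymm (fun x hx => ⟨?_, ?_⟩) (hc.out ?_ ?_)
      · exact Finset.min'_le _ _ (hf.mem_toFinset.2 hx)
      · exact Finset.le_max' _ _ (hf.mem_toFinset.2 hx)
      · exact hf.mem_toFinset.1 (Finset.min'_mem _ _)
      · exact hf.mem_toFinset.1 (Finset.max'_mem _ _)

/-- The window is enlarged by the support of the permutation. On the enlarged set both weights have
each label equally often, and outside of the window they agree. -/
theorem card_window_eq {L : Set Weight} {m M : ℤ} (hL : IsBlock L)
    (hJ : IsWindow L (Set.Icc m M)) {lam mu : Weight} (h : lam ∈ L) (h' : mu ∈ L) (l : Label) :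
    ((Finset.Icc m M).filter fun x => mu.lab x = l).card =
      ((Finset.Icc m M).filter fun x => lam.lab x = l).card := by
  classical
  obtain ⟨-, s, hs, -, hs'⟩ := hL.equivalent h h'
  let F := Finset.Icc m M ∪ hs.toFinset
  have hF : ∀ x, s x ∈ F ↔ x ∈ F := by
    intro x
    simp only [F, Finset.mem_union, Set.Finite.mem_toFinset, Set.mem_ofPred_eq]
    by_cases hx : s x = x
    · simp [hx]
    · exact iff_of_true (Or.inr fun h => hx (s.injective h)) (Or.inr hx)
  have h1 : (F.filter fun x => mu.lab x = l).card = (F.filter fun x => lam.lab x = l).card := by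
    refine Finset.card_equiv s fun x => ?_
    rw [Finset.mem_filter, Finset.mem_filter, hF, hs']
  have hsplit : ∀ f : Labelling, (F.filter fun x => f x = l).card =
      ((Finset.Icc m M).filter fun x => f x = l).card +
        ((F \ Finset.Icc m M).filter fun x => f x = l).card := by
    intro f
    rw [← Finset.card_union_of_disjoint, ← Finset.filter_union,
      Finset.union_sdiff_of_subset Finset.subset_union_left]
    exact Finset.disjoint_filter_filter Finset.disjoint_sdiff
  have hoff : ((F \ Finset.Icc m M).filter fun x => mu.lab x = l) =
      (F \ Finset.Icc m M).filter fun x => lam.lab x = l := by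
    refine Finset.filter_congr fun x hx => ?_
    rw [Finset.mem_sdiff, Finset.mem_Icc] at hx
    rw [hJ.agree mu h' lam h x hx.2]
  rw [hsplit, hsplit, hoff] at h1
  omega

theorem exists_isFrame {L : Set Weight} {J : Set ℤ} (hL : IsBlock L) (hJ : IsWindow L J) :
    ∃ m M p q, J = Set.Icc m M ∧ IsFrame L m M p q := by
  obtain ⟨m, M, hle, rfl⟩ := exists_eq_Icc hJ.finite hJ.ordConnected
  obtain ⟨lam, h⟩ := hL.nonempty
  exact ⟨m, M, _, _, rfl, hL, hJ, hle, fun mu h' => card_window_eq hL hJ h h' _,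
    fun mu h' => card_window_eq hL hJ h h' _⟩

/-! ### Comparison of the weights of a block with their closures. -/

namespace IsFrame

variable {L : Set Weight} {m M : ℤ} {p q : ℕ}

theorem closureOn_eq (hF : IsFrame L m M p q) {lam : Weight} (h : lam ∈ L) :
    closureOn (Set.Icc m M) lam.lab = padded m M p q lam.lab :=
  closureOn_eq_padded hF.le (hF.ups lam h) (hF.downs lam h)

theorem isArrow_iff (hF : IsFrame L m M p q) {lam mu : Weight} (h : lam ∈ L) (h' : mu ∈ L)
    (x : ℤ) : (padded m M p q mu.lab x).IsArrow ↔ (padded m M p q lam.lab x).IsArrow := by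
  by_cases hx : m ≤ x ∧ x ≤ M
  · rw [padded_of_mem hx.1 hx.2, padded_of_mem hx.1 hx.2]
    exact (hF.block.equivalent h h').isArrow_iff x
  · rw [padded_congr hx]

theorem eq_of_not_isArrow (hF : IsFrame L m M p q) {lam mu : Weight} (h : lam ∈ L) (h' : mu ∈ L)
    {x : ℤ} (hx : ¬ (padded m M p q lam.lab x).IsArrow) :
    padded m M p q mu.lab x = padded m M p q lam.lab x := by
  by_cases hxJ : m ≤ x ∧ x ≤ M
  · rw [padded_of_mem hxJ.1 hxJ.2] at hx
    rw [padded_of_mem hxJ.1 hxJ.2, padded_of_mem hxJ.1 hxJ.2]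
    exact (hF.block.equivalent h h').eq_of_not_isArrow hx
  · rw [padded_congr hxJ]

theorem cup_mem (hF : IsFrame L m M p q) {lam : Weight} (h : lam ∈ L) {i j : ℤ}
    (hij : IsCup lam.lab i j) : m ≤ i ∧ j ≤ M := by
  obtain ⟨h1, h2⟩ := hF.window.mem_of_down_up hF.block h hij.2.1 hij.2.2.1
  exact ⟨h1.1, h2.2⟩

theorem cup_iff {f : Labelling} {i j : ℤ} (hi : m ≤ i) (hj : j ≤ M) :
    IsCup (padded m M p q f) i j ↔ IsCup f i j :=
  ⟨fun h => h.congr fun x h1 h2 => padded_of_mem (by omega) (by omega),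
    fun h => h.congr fun x h1 h2 => (padded_of_mem (by omega) (by omega)).symm⟩

theorem sum_interval (hF : IsFrame L m M p q) {lam : Weight} (h : lam ∈ L) :
    ∑ x ∈ Finset.Icc m M, (lam.lab x).sign = q - p := by
  rw [← excess_interval (hF.ups lam h) (hF.downs lam h), excess_eq_sum]
  refine Finset.sum_congr ?_ fun _ _ => rfl
  ext x
  rw [Finset.mem_Ioc, Finset.mem_Icc]
  omega

/-- If `α ⊂ λ`, then `α` and `λ` have the same labels at the rays of `α` in the window. -/
theorem ray_eq (hF : IsFrame L m M p q) {alpha lam : Weight} (ha : alpha ∈ L) (hl : lam ∈ L)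
    (h : CupOriented alpha.lab lam.lab) {x : ℤ} (hx : IsRay alpha.lab x) (h1 : m ≤ x)
    (h2 : x ≤ M) : alpha.lab x = lam.lab x := by
  classical
  let R := (Finset.Icc m M).filter fun x => IsRay alpha.lab x
  -- The ends of a cup cancel in sign and all cups of the block lie in the window. So the signs at
  -- the rays add up to the sum over the window, which is `q - p` for both weights.
  have hsum : ∀ g : Labelling, (∀ i, ¬ (alpha.lab i).IsArrow → ¬ (g i).IsArrow) →
      Fits alpha.lab g → ∑ x ∈ R, (g x).sign = ∑ x ∈ Finset.Icc m M, (g x).sign := by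
    intro g hg hfit
    rw [← Finset.sum_filter_add_sum_filter_not (Finset.Icc m M) (fun x => IsRay alpha.lab x)]
    rw [left_eq_add,
      ← Finset.sum_filter_add_sum_filter_not _ (fun x => (alpha.lab x).IsArrow),
      sum_sign_eq_zero (f := alpha.lab) (g := g) _ hfit, zero_add]
    · refine Finset.sum_eq_zero fun x hx => ?_
      exact sign_eq_zero (hg x (Finset.mem_filter.1 hx).2)
    · intro x hx
      rw [Finset.mem_filter, Finset.mem_filter, Finset.mem_Icc] at hx
      obtain ⟨⟨hxI, hxr⟩, hxa⟩ := hx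
      have hex : ∃ j, IsCup alpha.lab x j ∨ IsCup alpha.lab j x := by
        by_contra hn
        exact hxr ⟨hxa, hn⟩
      refine ⟨hex, ?_⟩
      rw [Finset.mem_filter, Finset.mem_filter, Finset.mem_Icc]
      rcases cup_mate hex with hc | hc
      · have hm := hF.cup_mem ha hc
        have := hc.1
        exact ⟨⟨⟨by omega, by omega⟩, fun hr => hr.2 ⟨x, Or.inr hc⟩⟩, hc.isArrow_right⟩
      · have hm := hF.cup_mem ha hc
        have := hc.1
        exact ⟨⟨⟨by omega, by omega⟩, fun hr => hr.2 ⟨x, Or.inl hc⟩⟩, hc.isArrow_left⟩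
  have hR : ∀ y ∈ R, IsRay alpha.lab y := fun y hy => (Finset.mem_filter.1 hy).2
  refine eq_on_of_sorted (R := R) (fun y hy => (hR y hy).1) (fun y hy => h.ray y (hR y hy))
    (fun y hy z hz => not_rays_down_up _ (hR y hy) (hR z hz))
    (fun y hy z hz => h.rays_sorted y z (hR y hy) (hR z hz)) ?_ x
    (Finset.mem_filter.2 ⟨Finset.mem_Icc.2 ⟨h1, h2⟩, hx⟩)
  rw [hsum _ (fun _ h => h) (fits_self _), hsum _ h.free h.cup, hF.sum_interval ha,
    hF.sum_interval hl]

/-- A cup of the closure that leaves the window ends at a vertex that cannot have had a partner in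
the original weight, as cups inside the window are the same for both. -/
theorem isRay_of_cup (hF : IsFrame L m M p q) {alpha : Weight} (ha : alpha ∈ L) {i j : ℤ}
    (h : IsCup (padded m M p q alpha.lab) i j) :
    (m ≤ i → i ≤ M → M < j → IsRay alpha.lab i) ∧
      (m ≤ j → j ≤ M → i < m → IsRay alpha.lab j) := by
  constructor
  · intro h1 h2 h3
    refine ⟨?_, ?_⟩
    · rw [← padded_of_mem (f := alpha.lab) (p := p) (q := q) h1 h2]
      exact h.isArrow_left
    · rintro ⟨l, hl | hl⟩
      · have hm := hF.cup_mem ha hl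
        have := h.right_unique ((cup_iff hm.1 hm.2).2 hl)
        omega
      · have hm := hF.cup_mem ha hl
        exact ((cup_iff hm.1 hm.2).2 hl).not_cup_left h
  · intro h1 h2 h3
    refine ⟨?_, ?_⟩
    · rw [← padded_of_mem (f := alpha.lab) (p := p) (q := q) h1 h2]
      exact h.isArrow_right
    · rintro ⟨l, hl | hl⟩
      · have hm := hF.cup_mem ha hl
        exact h.not_cup_left ((cup_iff hm.1 hm.2).2 hl)
      · have hm := hF.cup_mem ha hl
        have := h.left_unique ((cup_iff hm.1 hm.2).2 hl)
        omega

/-- A cup of the closure is a cup in the window, or joins two added vertices, or ends at a ray,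
where `ray_eq` says that the labels of both weights agree. Conversely, rays at `i < j` labelled
`down`, `up` would have to be closed up by an added `up` and an added `down`, and these two cups
would cross. -/
theorem sub_iff (hF : IsFrame L m M p q) {alpha lam : Weight} (ha : alpha ∈ L) (hl : lam ∈ L) :
    alpha.Sub lam ↔ Fits (padded m M p q alpha.lab) (padded m M p q lam.lab) := by
  have hle := hF.le
  have heq := hF.block.equivalent ha hl
  constructor
  · rintro ⟨-, h⟩ i j hij
    have hi := mem_of_padded_isArrow hij.isArrow_left hF.le
    have hj := mem_of_padded_isArrow hij.isArrow_right hF.le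
    have hlt := hij.1
    have hup : ∀ {x}, M < x → padded m M p q alpha.lab x ≠ Label.down := by
      intro x hx hd
      rw [padded, if_neg (by omega), if_neg (by omega)] at hd
      split_ifs at hd
    have hdown : ∀ {x}, x < m → padded m M p q alpha.lab x ≠ Label.up := by
      intro x hx hd
      rw [padded, if_neg (by omega)] at hd
      split_ifs at hd with h1 h2
      omega
    have hiM : i ≤ M := by
      by_contra hn
      exact hup (not_le.1 hn) hij.2.1
    have hmj : m ≤ j := by
      by_contra hn
      exact hdown (not_le.1 hn) hij.2.2.1
    rcases lt_or_ge i m with him | him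
    · refine Or.inl ⟨padded_left hi.1 him, ?_⟩
      rcases lt_or_ge M j with hjM | hjM
      · exact padded_right hle hjM hj.2
      · rw [padded_of_mem hmj hjM, ← hF.ray_eq ha hl h ((hF.isRay_of_cup ha hij).2 hmj hjM him)
          hmj hjM, ← padded_of_mem (f := alpha.lab) (p := p) (q := q) hmj hjM]
        exact hij.2.2.1
    · rcases lt_or_ge M j with hjM | hjM
      · refine Or.inl ⟨?_, padded_right hle hjM hj.2⟩
        rw [padded_of_mem him hiM, ← hF.ray_eq ha hl h ((hF.isRay_of_cup ha hij).1 him hiM hjM)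
          him hiM, ← padded_of_mem (f := alpha.lab) (p := p) (q := q) him hiM]
        exact hij.2.1
      · rw [padded_of_mem him hiM, padded_of_mem hmj hjM]
        exact h.cup i j ((cup_iff him hjM).1 hij)
  · intro h
    refine ⟨heq, fun i hi => mt (heq.isArrow_iff i).1 hi, fun i j hij => ?_,
      fun i hi => (heq.isArrow_iff i).2 hi.1, ?_⟩
    · have hm := hF.cup_mem ha hij
      have hlt := hij.1
      have := h i j ((cup_iff hm.1 hm.2).2 hij)
      rwa [padded_of_mem (by omega) (by omega), padded_of_mem (by omega) (by omega)] at this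
    · rintro i j hi hj hij ⟨hd, hu⟩
      obtain ⟨him, hjm⟩ := hF.window.mem_of_down_up hF.block hl hd hu
      rw [Set.mem_Icc] at him hjm
      classical
      have hA := closedOn_padded hF.le (hF.ups alpha ha) (hF.downs alpha ha)
        (A := (Finset.Icc (m - p) (M + q)).filter
          fun x => (padded m M p q alpha.lab x).IsArrow) (by
            intro x
            rw [Finset.mem_filter, Finset.mem_Icc]
            exact ⟨fun h => ⟨mem_of_padded_isArrow h hF.le, h⟩, fun h => h.2⟩)
      have hmatch : ∀ x, IsRay alpha.lab x → m ≤ x → x ≤ M →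
          ∃ y, IsCup (padded m M p q alpha.lab) x y ∨ IsCup (padded m M p q alpha.lab) y x := by
        intro x hx h1 h2
        refine hA.matched x ((hA.arrow x).1 ?_)
        rw [padded_of_mem h1 h2]
        exact hx.1
      have hnot : ∀ x y, IsRay alpha.lab x → m ≤ x → x ≤ M →
          (IsCup (padded m M p q alpha.lab) x y → M < y) ∧
          (IsCup (padded m M p q alpha.lab) y x → y < m) := by
        intro x y hx h1 h2
        constructor
        · intro hc
          by_contra hn
          exact hx.2 ⟨y, Or.inl ((cup_iff h1 (not_lt.1 hn)).1 hc)⟩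
        · intro hc
          by_contra hn
          exact hx.2 ⟨y, Or.inr ((cup_iff (not_lt.1 hn) h2).1 hc)⟩
      obtain ⟨k, hk | hk⟩ := hmatch i hi him.1 him.2
      · have hkM := (hnot i k hi him.1 him.2).1 hk
        obtain ⟨l, hl' | hl'⟩ := hmatch j hj hjm.1 hjm.2
        · have hlM := (hnot j l hj hjm.1 hjm.2).1 hl'
          have := h j l hl'
          rw [padded_of_mem hjm.1 hjm.2, hu, padded_right hle hlM
            (mem_of_padded_isArrow hl'.isArrow_right hle).2] at this
          rcases this with ⟨h', -⟩ | ⟨-, h'⟩ <;> cases h'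
        · have hlm := (hnot j l hj hjm.1 hjm.2).2 hl'
          -- The crossing: the cup from `l < m` to `j` would have to contain the cup from `i` to `k
          -- > M`.
          have := hl'.right_lt_right hk (by omega) (by omega)
          omega
      · have hkm := (hnot i k hi him.1 him.2).2 hk
        have := h k i hk
        rw [padded_of_mem him.1 him.2, hd, padded_left
          (mem_of_padded_isArrow hk.isArrow_left hle).1 hkm] at this
        rcases this with ⟨-, h'⟩ | ⟨h', -⟩ <;> cases h'

theorem padded_injective (hF : IsFrame L m M p q) {lam mu : Weight} (hl : lam ∈ L) (hm : mu ∈ L)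
    (h : padded m M p q lam.lab = padded m M p q mu.lab) : lam = mu := by
  refine Weight.ext (hF.block.equivalent hl hm).1 (funext fun x => ?_)
  by_cases hx : m ≤ x ∧ x ≤ M
  · have := congrFun h x
    rwa [padded_of_mem hx.1 hx.2, padded_of_mem hx.1 hx.2] at this
  · exact hF.window.agree lam hl mu hm x hx

end IsFrame

/-- The properties of the closures of the weights of a finite block. -/
structure IsClosure (L : Set Weight) (cl : Weight → Labelling) (A : Finset ℤ)
    (base : Labelling) : Prop where
  closed : ∀ lam ∈ L, ClosedOn A (cl lam)
  off : ∀ lam ∈ L, ∀ i, i ∉ A → cl lam i = base i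
  sub_iff : ∀ alpha ∈ L, ∀ lam ∈ L, alpha.Sub lam ↔ Fits (cl alpha) (cl lam)
  injective : ∀ lam ∈ L, ∀ mu ∈ L, cl lam = cl mu → lam = mu
  exists_eq : ∀ alpha ∈ L, ∀ f : Labelling, Fits (cl alpha) f → (∀ i, i ∉ A → f i = base i) →
    ∀ rho ∈ L, (∀ m, prefixSum A (cl rho) m ≤ prefixSum A f m) → ∃ lam ∈ L, cl lam = f
  le_iff : ∀ lam ∈ L, ∀ mu ∈ L, lam.BruhatLE mu ↔
    ∀ m, prefixSum A (cl mu) m ≤ prefixSum A (cl lam) m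

theorem all_down_of_sum_le {T : Finset ℤ} {f g : Labelling} (hf : ∀ x ∈ T, f x = Label.down)
    (h : ∑ x ∈ T, (f x).sign ≤ ∑ x ∈ T, (g x).sign) : ∀ x ∈ T, g x = Label.down := by
  have hle : ∀ x ∈ T, (g x).sign ≤ (f x).sign := fun x hx => by
    rw [hf x hx]
    exact (g x).sign_le_one
  have := (Finset.sum_eq_sum_iff_of_le hle).1 (le_antisymm (Finset.sum_le_sum hle) h)
  intro x hx
  rw [← Label.sign_eq_one_iff, this x hx, hf x hx]
  rfl

theorem all_up_of_sum_le {T : Finset ℤ} {f g : Labelling} (hf : ∀ x ∈ T, f x = Label.up)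
    (h : ∑ x ∈ T, (g x).sign ≤ ∑ x ∈ T, (f x).sign) : ∀ x ∈ T, g x = Label.up := by
  have hle : ∀ x ∈ T, (f x).sign ≤ (g x).sign := fun x hx => by
    rw [hf x hx]
    exact (g x).neg_one_le_sign
  have := (Finset.sum_eq_sum_iff_of_le hle).1 (le_antisymm (Finset.sum_le_sum hle) h)
  intro x hx
  rw [← Label.sign_eq_neg_one_iff, ← this x hx, hf x hx]
  rfl

namespace IsFrame

variable {L : Set Weight} {m M : ℤ} {p q : ℕ} {A : Finset ℤ}

/-- The left padding of a closure has the largest possible prefix sum, so domination forces the same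
labels for `f` there. As all totals are zero, domination also forces the right padding. Inside the
window `f` then has as many arrows of each kind as `rho`, so it is obtained from `rho` by a
permutation. -/
theorem exists_padded_eq (hF : IsFrame L m M p q)
    (hA : ∀ lam ∈ L, ClosedOn A (padded m M p q lam.lab)) {alpha rho : Weight}
    (ha : alpha ∈ L) (hr : rho ∈ L) {f : Labelling} (hfit : Fits (padded m M p q alpha.lab) f)
    (hoff : ∀ i, i ∉ A → f i = padded m M p q rho.lab i)
    (hle : ∀ x, prefixSum A (padded m M p q rho.lab) x ≤ prefixSum A f x) :
    ∃ lam ∈ L, padded m M p q lam.lab = f := by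
  classical
  have hmM := hF.le
  set g := padded m M p q rho.lab with hg
  have hfA : ∀ x ∈ A, (f x).IsArrow := fun x hx => hfit.isArrow (hA alpha ha) hx
  have hgA : ∀ x ∈ A, (g x).IsArrow := fun x hx => ((hA rho hr).arrow x).2 hx
  have hmem : ∀ x ∈ A, m - p ≤ x ∧ x ≤ M + q := fun x hx =>
    mem_of_padded_isArrow (hgA x hx) hmM
  have htot : ∑ x ∈ A, (f x).sign = ∑ x ∈ A, (g x).sign := by
    rw [(hA alpha ha).sum_sign hfit, (hA rho hr).sum_sign (fits_self _)]
  have hleft : ∀ x ∈ A, x < m → f x = g x := by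
    have h1 : ∀ x ∈ A.filter (· < m), g x = Label.down := by
      intro x hx
      rw [Finset.mem_filter] at hx
      exact padded_left (hmem x hx.1).1 hx.2
    intro x hx hxm
    have hx' : x ∈ A.filter (· < m) := Finset.mem_filter.2 ⟨hx, hxm⟩
    rw [h1 x hx', all_down_of_sum_le h1 (hle m) x hx']
  have hright : ∀ x ∈ A, M < x → f x = g x := by
    have h1 : ∀ x ∈ A.filter (fun x => ¬ x < M + 1), g x = Label.up := by
      intro x hx
      rw [Finset.mem_filter] at hx
      exact padded_right hmM (by omega) (hmem x hx.1).2
    intro x hx hxm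
    have hx' : x ∈ A.filter (fun x => ¬ x < M + 1) := Finset.mem_filter.2 ⟨hx, by omega⟩
    rw [h1 x hx']
    refine all_up_of_sum_le h1 ?_ x hx'
    have h2 := hle (M + 1)
    have h3 := Finset.sum_filter_add_sum_filter_not A (fun x => x < M + 1) fun x => (f x).sign
    have h4 := Finset.sum_filter_add_sum_filter_not A (fun x => x < M + 1) fun x => (g x).sign
    unfold prefixSum at h2
    omega
  let T := A.filter fun x => m ≤ x ∧ x ≤ M
  have hfT : ∀ x, x ∉ T → f x = g x := by
    intro x hx
    by_cases hxA : x ∈ A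
    · by_cases h1 : x < m
      · exact hleft x hxA h1
      · refine hright x hxA ?_
        by_contra h2
        exact hx (Finset.mem_filter.2 ⟨hxA, by omega, by omega⟩)
    · exact hoff x hxA
  have hgrho : ∀ x ∈ T, g x = rho.lab x := fun x hx =>
    padded_of_mem (Finset.mem_filter.1 hx).2.1 (Finset.mem_filter.1 hx).2.2
  have hsumT : ∑ x ∈ T, (rho.lab x).sign = ∑ x ∈ T, (f x).sign := by
    have h3 := Finset.sum_filter_add_sum_filter_not A (fun x => m ≤ x ∧ x ≤ M)
      fun x => (f x).sign
    have h4 := Finset.sum_filter_add_sum_filter_not A (fun x => m ≤ x ∧ x ≤ M)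
      fun x => (g x).sign
    have h5 : ∑ x ∈ A with ¬ (m ≤ x ∧ x ≤ M), (f x).sign =
        ∑ x ∈ A with ¬ (m ≤ x ∧ x ≤ M), (g x).sign := by
      refine Finset.sum_congr rfl fun x hx => ?_
      rw [hfT x fun h => (Finset.mem_filter.1 hx).2 (Finset.mem_filter.1 h).2]
    have h6 : ∑ x ∈ T, (g x).sign = ∑ x ∈ T, (rho.lab x).sign :=
      Finset.sum_congr rfl fun x hx => by rw [hgrho x hx]
    have h7 : ∑ x ∈ T, (f x).sign + ∑ x ∈ A with ¬ (m ≤ x ∧ x ≤ M), (f x).sign =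
      ∑ x ∈ A, (f x).sign := h3
    have h8 : ∑ x ∈ T, (g x).sign + ∑ x ∈ A with ¬ (m ≤ x ∧ x ≤ M), (g x).sign =
      ∑ x ∈ A, (g x).sign := h4
    omega
  have hrhoT : ∀ x ∈ T, (rho.lab x).IsArrow := fun x hx => by
    rw [← hgrho x hx]
    exact hgA x (Finset.mem_filter.1 hx).1
  obtain ⟨s, hs1, hs2⟩ := exists_perm_of_sum_eq hrhoT
    (fun x hx => hfA x (Finset.mem_filter.1 hx).1) hsumT
  have hsfin : {i | s i ≠ i}.Finite := T.finite_toSet.subset fun x hx => by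
    by_contra hn
    exact hx (hs1 x hn)
  have hsarrow : ∀ i, ¬ (rho.lab i).IsArrow → s i = i := fun i hi =>
    hs1 i fun h => hi (hrhoT i h)
  refine ⟨rho.permute s hsfin hsarrow,
    hF.block.mem_of_equivalent hr (rho.equivalent_permute s hsfin hsarrow), funext fun x => ?_⟩
  by_cases hxT : x ∈ T
  · rw [padded_of_mem (Finset.mem_filter.1 hxT).2.1 (Finset.mem_filter.1 hxT).2.2, hs2 x hxT]
    rfl
  · rw [hfT x hxT, hg]
    by_cases hx : m ≤ x ∧ x ≤ M
    · rw [padded_of_mem hx.1 hx.2, padded_of_mem hx.1 hx.2]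
      change rho.lab (s x) = rho.lab x
      rw [hs1 x hxT]
    · exact padded_congr hx

/-- A basic step lowers the prefix sums between the two swapped vertices by two and changes no
other. The converse is `swapSteps_of_prefixSum_le` on the arrows in the window, since the paddings
of the two closures cancel. -/
theorem bruhatLE_iff (hF : IsFrame L m M p q)
    (hA : ∀ lam ∈ L, ClosedOn A (padded m M p q lam.lab)) {lam mu : Weight}
    (hl : lam ∈ L) (hm : mu ∈ L) : lam.BruhatLE mu ↔ ∀ x,
      prefixSum A (padded m M p q mu.lab) x ≤ prefixSum A (padded m M p q lam.lab) x := by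
  classical
  constructor
  · intro h
    suffices mu ∈ L ∧ ∀ x, prefixSum A (padded m M p q mu.lab) x ≤
      prefixSum A (padded m M p q lam.lab) x from this.2
    clear hm
    induction h with
    | refl => exact ⟨hl, fun _ => le_rfl⟩
    | @tail mu nu _ hstep ih =>
      obtain ⟨hm, ih⟩ := ih
      refine ⟨hF.block.mem_of_equivalent hm hstep.equivalent, fun x => le_trans ?_ (ih x)⟩
      obtain ⟨-, i, j, hij, hi, hj, hlab⟩ := hstep
      obtain ⟨hiJ, hjJ⟩ := hF.window.mem_of_down_up hF.block hm hi hj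
      rw [Set.mem_Icc] at hiJ hjJ
      have hi' : padded m M p q mu.lab i = Label.down := by rw [padded_of_mem hiJ.1 hiJ.2, hi]
      have hj' : padded m M p q mu.lab j = Label.up := by rw [padded_of_mem hjJ.1 hjJ.2, hj]
      have heq : padded m M p q nu.lab = Function.update (Function.update
          (padded m M p q mu.lab) i Label.up) j Label.down := by
        funext y
        by_cases h1 : y = j
        · rw [h1, Function.update_self, padded_of_mem hjJ.1 hjJ.2, hlab, Function.update_self]
        rw [Function.update_of_ne h1]
        by_cases h2 : y = i
        · rw [h2, Function.update_self, padded_of_mem hiJ.1 hiJ.2, hlab,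
            Function.update_of_ne hij.ne, Function.update_self]
        rw [Function.update_of_ne h2]
        by_cases hy : m ≤ y ∧ y ≤ M
        · rw [padded_of_mem hy.1 hy.2, padded_of_mem hy.1 hy.2, hlab,
            Function.update_of_ne h1, Function.update_of_ne h2]
        · exact padded_congr hy
      rw [heq, prefixSum_update hij hi' hj' (((hA mu hm).arrow i).1 (Or.inl hi'))
        (((hA mu hm).arrow j).1 (Or.inr hj'))]
      split_ifs <;> omega
  · intro h
    let T := A.filter fun x => m ≤ x ∧ x ≤ M
    have hlab : ∀ nu ∈ L, ∀ x ∈ T, padded m M p q nu.lab x = nu.lab x := fun nu _ x hx =>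
      padded_of_mem (Finset.mem_filter.1 hx).2.1 (Finset.mem_filter.1 hx).2.2
    have harrow : ∀ nu ∈ L, ∀ x ∈ T, (nu.lab x).IsArrow := fun nu hn x hx => by
      rw [← hlab nu hn x hx]
      exact ((hA nu hn).arrow x).2 (Finset.mem_filter.1 hx).1
    have hsplit : ∀ (P : ℤ → Prop) [DecidablePred P], ∑ x ∈ A with P x,
        (padded m M p q lam.lab x).sign - ∑ x ∈ A with P x, (padded m M p q mu.lab x).sign =
        ∑ x ∈ T with P x, (lam.lab x).sign - ∑ x ∈ T with P x, (mu.lab x).sign := by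
      intro P _
      rw [← Finset.sum_sub_distrib, ← Finset.sum_sub_distrib]
      symm
      refine Finset.sum_subset_zero_on_sdiff
        (Finset.filter_subset_filter _ (Finset.filter_subset _ _)) ?_ ?_
      · intro x hx
        simp only [T, Finset.mem_sdiff, Finset.mem_filter] at hx
        rw [padded_congr (g := mu.lab) (f := lam.lab) fun h' => hx.2 ⟨⟨hx.1.1, h'⟩, hx.1.2⟩,
          sub_self]
      · intro x hx
        rw [hlab lam hl x (Finset.mem_filter.1 hx).1, hlab mu hm x (Finset.mem_filter.1 hx).1]
    have hsteps : Relation.ReflTransGen SwapStep lam.lab mu.lab := by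
      refine swapSteps_of_prefixSum_le (T := T) _ le_rfl (harrow lam hl) (harrow mu hm) ?_ ?_ ?_
      · intro x hx
        by_cases hxJ : m ≤ x ∧ x ≤ M
        · have hxA : x ∉ A := fun h => hx (Finset.mem_filter.2 ⟨h, hxJ⟩)
          have := mt ((hA lam hl).arrow x).1 hxA
          rw [padded_of_mem hxJ.1 hxJ.2] at this
          exact ((hF.block.equivalent hl hm).eq_of_not_isArrow this).symm
        · exact hF.window.agree lam hl mu hm x hxJ
      · have := hsplit (fun _ => True)
        simp only [Finset.filter_true] at this
        rw [(hA lam hl).sum_sign (fits_self _), (hA mu hm).sum_sign (fits_self _)] at this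
        omega
      · intro x
        have h1 := hsplit (· < x)
        have h2 := h x
        unfold prefixSum at h2 ⊢
        omega
    obtain ⟨nu, h1, h2, h3⟩ := Weight.bruhatLE_of_swapSteps hsteps
    have : nu = mu := Weight.ext (h2.trans (hF.block.equivalent hl hm).1) h3
    exact this ▸ h1

end IsFrame

theorem exists_isClosure {L : Set Weight} {J : Set ℤ} (hL : IsBlock L) (hJ : IsWindow L J) :
    ∃ A base, IsClosure L (fun lam => closureOn J lam.lab) A base := by
  classical
  obtain ⟨m, M, p, q, rfl, hF⟩ := exists_isFrame hL hJ
  obtain ⟨lam₀, h₀⟩ := hL.nonempty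
  let A := (Finset.Icc (m - p) (M + q)).filter fun x => (padded m M p q lam₀.lab x).IsArrow
  have hA : ∀ lam ∈ L, ClosedOn A (padded m M p q lam.lab) := by
    intro lam h
    refine closedOn_padded hF.le (hF.ups lam h) (hF.downs lam h) fun x => ?_
    rw [Finset.mem_filter, Finset.mem_Icc, hF.isArrow_iff h₀ h]
    exact ⟨fun h => ⟨mem_of_padded_isArrow h hF.le, h⟩, fun h => h.2⟩
  have hoff : ∀ lam ∈ L, ∀ i, i ∉ A → padded m M p q lam.lab i = padded m M p q lam₀.lab i :=
    fun lam h i hi => hF.eq_of_not_isArrow h₀ h (mt ((hA lam₀ h₀).arrow i).1 hi)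
  refine ⟨A, padded m M p q lam₀.lab, fun lam h => ?_, fun lam h => ?_, fun alpha ha lam h => ?_,
    fun lam h mu h' => ?_, fun alpha ha f hf hfoff rho hr hle => ?_, fun lam h mu h' => ?_⟩
  · rw [hF.closureOn_eq h]
    exact hA lam h
  · rw [hF.closureOn_eq h]
    exact hoff lam h
  · rw [hF.closureOn_eq h, hF.closureOn_eq ha]
    exact hF.sub_iff ha h
  · rw [hF.closureOn_eq h, hF.closureOn_eq h']
    exact hF.padded_injective h h'
  · rw [hF.closureOn_eq ha] at hf
    rw [hF.closureOn_eq hr] at hle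
    obtain ⟨lam, h1, h2⟩ := hF.exists_padded_eq hA ha hr hf
      (fun i hi => (hfoff i hi).trans (hoff rho hr i hi).symm) hle
    exact ⟨lam, h1, (hF.closureOn_eq h1).trans h2⟩
  · rw [hF.closureOn_eq h, hF.closureOn_eq h']
    exact hF.bruhatLE_iff hA h h'


/-! ## The algebra of a finite block -/

section Coefficients

variable (k : Type*) [Field k] {L : Set Weight}

/-- The coefficient of a basis vector. -/
noncomputable def coeffAt (u : CircleDiagram L) : KAlg k L →ₗ[k] k :=
  (Finsupp.lapply u : (CircleDiagram L →₀ k) →ₗ[k] k)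

variable {k}

theorem coeffAt_basisVec_self (s : CircleDiagram L) : coeffAt k s (basisVec k s) = 1 :=
  Finsupp.single_eq_same

theorem coeffAt_basisVec_of_ne {s u : CircleDiagram L} (h : s ≠ u) :
    coeffAt k u (basisVec k s) = 0 :=
  Finsupp.single_eq_of_ne h.symm

theorem KAlg.ext_coeff {x y : KAlg k L} (h : ∀ u, coeffAt k u x = coeffAt k u y) : x = y :=
  Finsupp.ext h

theorem KAlg.induction {P : KAlg k L → Prop} (h0 : P 0) (hadd : ∀ x y, P x → P y → P (x + y))
    (hsmul : ∀ (c : k) s, P (c • basisVec k s)) (x : KAlg k L) : P x :=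
  Finsupp.induction_linear x h0 hadd fun s c => by
    have : (Finsupp.single s c : CircleDiagram L →₀ k) = c • Finsupp.single s 1 := by
      rw [Finsupp.smul_single, smul_eq_mul, mul_one]
    rw [this]
    exact hsmul c s

theorem basisVec_linearIndependent : LinearIndependent k (basisVec k (L := L)) :=
  Finsupp.linearIndependent_single_one k (CircleDiagram L)

theorem basisVec_injective : Function.Injective (basisVec k (L := L)) :=
  Finsupp.single_left_injective one_ne_zero

/-- The span of the basis vectors with the property `P`. -/
noncomputable def diagSpan (k : Type*) [Field k] {L : Set Weight} (P : CircleDiagram L → Prop) :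
    Submodule k (KAlg k L) := Submodule.span k (basisVec k '' {s | P s})

theorem mem_span_single_iff {X : Type*} {S : Set X} {x : X →₀ k} :
    x ∈ Submodule.span k ((fun i => Finsupp.single i (1 : k)) '' S) ↔ ∀ u, x u ≠ 0 → u ∈ S := by
  rw [← Finsupp.supported_eq_span_single, Finsupp.mem_supported]
  constructor
  · exact fun h u hu => h (Finsupp.mem_support_iff.2 hu)
  · exact fun h u hu => h u (Finsupp.mem_support_iff.1 hu)

theorem mem_diagSpan_iff {P : CircleDiagram L → Prop} {x : KAlg k L} :
    x ∈ diagSpan k P ↔ ∀ u, coeffAt k u x ≠ 0 → P u := mem_span_single_iff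

theorem basisVec_mem_diagSpan {P : CircleDiagram L → Prop} {s : CircleDiagram L} (h : P s) :
    basisVec k s ∈ diagSpan k P := Submodule.subset_span ⟨s, h, rfl⟩

theorem KAlg.smul_mul (c : k) (x y : KAlg k L) : (c • x) * y = c • (x * y) := by
  change mulMap k L (c • x) y = c • mulMap k L x y
  rw [map_smul, LinearMap.smul_apply]

theorem KAlg.mul_smul (c : k) (x y : KAlg k L) : x * (c • y) = c • (x * y) :=
  (mulMap k L x).map_smul c y

theorem KAlg.mul_sum {ι : Type*} (S : Finset ι) (x : KAlg k L) (f : ι → KAlg k L) :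
    x * ∑ i ∈ S, f i = ∑ i ∈ S, x * f i := map_sum (mulMap k L x) f S

theorem KAlg.sum_mul {ι : Type*} (S : Finset ι) (x : KAlg k L) (f : ι → KAlg k L) :
    (∑ i ∈ S, f i) * x = ∑ i ∈ S, f i * x := map_sum ((mulMap k L).flip x) f S

theorem lift_single {X M : Type*} [AddCommGroup M] [Module k M] (F : X → M) (s : X) :
    Finsupp.lift M k X F (Finsupp.single s 1) = F s := by
  rw [Finsupp.lift_apply]
  exact (Finsupp.sum_single_index (h := fun x r => r • F x) (zero_smul k _)).trans (one_smul k _)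

theorem basisVec_mul (s t : CircleDiagram L) :
    basisVec k s * basisVec k t = mulBasis k s t :=
  (LinearMap.congr_fun (lift_single (k := k) (fun s : CircleDiagram L =>
    (Finsupp.lift (KAlg k L) k (CircleDiagram L) fun t => mulBasis k s t :
      KAlg k L →ₗ[k] KAlg k L)) s) (basisVec k t)).trans
    (lift_single (k := k) (fun t : CircleDiagram L => mulBasis k s t) t)

theorem finite_circleDiagram (hfin : L.Finite) : Finite (CircleDiagram L) := by
  have := hfin.to_subtype
  refine Finite.of_injective (β := L × L × L) (fun s =>
    (⟨s.left, s.left_mem⟩, ⟨s.mid, s.mid_mem⟩, ⟨s.right, s.right_mem⟩)) ?_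
  intro s t h
  simp only [Prod.mk.injEq, Subtype.mk.injEq] at h
  exact CircleDiagram.ext h.1 h.2.1 h.2.2

theorem coeffAt_sum_basisVec {ι : Type*} {S : Finset ι} {c : ι → k} {f : ι → CircleDiagram L}
    {i : ι} (hi : i ∈ S) (hf : ∀ j ∈ S, f j = f i → j = i) :
    coeffAt k (f i) (∑ j ∈ S, c j • basisVec k (f j)) = c i := by
  rw [map_sum, Finset.sum_eq_single_of_mem i hi, map_smul, coeffAt_basisVec_self, smul_eq_mul,
    mul_one]
  intro j hj hne
  rw [map_smul, coeffAt_basisVec_of_ne fun h => hne (hf j hj h), smul_zero]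

theorem coeffAt_sum_basisVec_of_ne {ι : Type*} {S : Finset ι} {c : ι → k}
    {f : ι → CircleDiagram L} {u : CircleDiagram L} (hu : ∀ j ∈ S, f j ≠ u) :
    coeffAt k u (∑ j ∈ S, c j • basisVec k (f j)) = 0 := by
  rw [map_sum]
  refine Finset.sum_eq_zero fun j hj => ?_
  rw [map_smul, coeffAt_basisVec_of_ne (hu j hj), smul_zero]

theorem basisVec_mul_of_ne {s t : CircleDiagram L} (h : s.right ≠ t.left) :
    basisVec k s * basisVec k t = 0 := by
  rw [basisVec_mul, mulBasis, if_neg h]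

section

variable [Finite (CircleDiagram L)]

/-- The diagrams with the given cup and cap diagrams. -/
noncomputable def diagramsBetween (L : Set Weight) [Finite (CircleDiagram L)] (a c : Weight) :
    Finset (CircleDiagram L) :=
  (Set.toFinite {u : CircleDiagram L | u.left = a ∧ u.right = c}).toFinset

theorem mem_diagramsBetween {a c : Weight} {u : CircleDiagram L} :
    u ∈ diagramsBetween L a c ↔ u.left = a ∧ u.right = c :=
  Set.Finite.mem_toFinset _

theorem basisVec_mul_eq_sum {s t : CircleDiagram L} (h : s.right = t.left) :
    basisVec k s * basisVec k t =
      ∑ u ∈ diagramsBetween L s.left t.right, structureCoeff k s t u • basisVec k u := by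
  classical
  rw [basisVec_mul, mulBasis, if_pos h]
  exact finsum_mem_eq_finite_toFinset_sum _ _

theorem coeffAt_mul {s t u : CircleDiagram L} (h : s.right = t.left) (h1 : u.left = s.left)
    (h2 : u.right = t.right) :
    coeffAt k u (basisVec k s * basisVec k t) = structureCoeff k s t u := by
  classical
  rw [basisVec_mul_eq_sum h]
  exact coeffAt_sum_basisVec (f := fun u => u) (mem_diagramsBetween.2 ⟨h1, h2⟩)
    fun _ _ h => h

theorem of_coeffAt_mul_ne_zero {s t u : CircleDiagram L}
    (h : coeffAt k u (basisVec k s * basisVec k t) ≠ 0) :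
    s.right = t.left ∧ u.left = s.left ∧ u.right = t.right := by
  classical
  have h0 : s.right = t.left := by
    by_contra hne
    rw [basisVec_mul_of_ne hne, map_zero] at h
    exact h rfl
  refine ⟨h0, ?_⟩
  by_contra hne
  rw [basisVec_mul_eq_sum h0] at h
  refine h (coeffAt_sum_basisVec_of_ne (f := fun u => u) fun j hj he => hne ?_)
  rw [← he]
  exact mem_diagramsBetween.1 hj

end

theorem starMap_basisVec (s : CircleDiagram L) :
    starMap k L (basisVec k s) = basisVec k s.mirror :=
  Finsupp.mapDomain_single

theorem starMap_starMap (x : KAlg k L) : starMap k L (starMap k L x) = x := by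
  induction x using KAlg.induction with
  | h0 => rw [map_zero, map_zero]
  | hadd x y hx hy => rw [map_add, map_add, hx, hy]
  | hsmul c s => rw [map_smul, map_smul, starMap_basisVec, starMap_basisVec]; rfl

theorem coeffAt_starMap (x : KAlg k L) (u : CircleDiagram L) :
    coeffAt k u (starMap k L x) = coeffAt k u.mirror x := by
  induction x using KAlg.induction with
  | h0 => rw [map_zero, map_zero, map_zero]
  | hadd x y hx hy => rw [map_add, map_add, map_add, hx, hy]
  | hsmul c s =>
    rw [map_smul, map_smul, map_smul, starMap_basisVec]
    by_cases h : s.mirror = u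
    · rw [← h, coeffAt_basisVec_self]
      exact congrArg (c • ·) (coeffAt_basisVec_self s).symm
    · rw [coeffAt_basisVec_of_ne h, coeffAt_basisVec_of_ne]
      rintro rfl
      exact h rfl

end Coefficients

/-- The structure constants of the algebra of a finite block are those of the algebra of closed
diagrams, for a suitable notion of closure. -/
structure IsModel (k : Type*) [Field k] (L : Set Weight) (cl : Weight → Labelling)
    (A : Finset ℤ) (base : Labelling) : Prop extends IsClosure L cl A base where
  finite : Finite (CircleDiagram L)
  structureCoeff_eq : ∀ s t u : CircleDiagram L, structureCoeff k s t u =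
    closedCoeff k (cl s.left) (cl s.right) (cl t.right) (cl s.mid) (cl t.mid) (cl u.mid)

/-- The block is finite, so all products are computed on one common window, and the test in
`structureCoeff` always succeeds. -/
theorem exists_isModel (k : Type*) [Field k] {L : Set Weight} (hL : IsBlock L)
    (hfin : L.Finite) : ∃ cl A base, IsModel k L cl A base := by
  obtain ⟨J, hJ, hw⟩ := exists_window_eq hL hfin
  obtain ⟨A, base, hC⟩ := exists_isClosure hL hJ
  refine ⟨_, A, base, hC, finite_circleDiagram hfin, fun s t u => ?_⟩
  dsimp only [structureCoeff]
  rw [hw _ s.mid s.mid_mem]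
  refine if_pos (hJ.mono ?_)
  rintro lam (rfl | rfl | rfl | rfl | rfl | rfl)
  · exact u.mid_mem
  · exact s.left_mem
  · exact s.mid_mem
  · exact s.right_mem
  · exact t.mid_mem
  · exact t.right_mem

/-! ### Associativity, mirror symmetry and idempotents for a finite block. -/

namespace IsModel

variable {k : Type*} [Field k] {L : Set Weight} {cl : Weight → Labelling} {A : Finset ℤ}
  {base : Labelling}

theorem mem_oriented (H : IsModel k L cl A base) (s : CircleDiagram L) :
    cl s.mid ∈ Oriented A (cl s.left) (cl s.right) base :=
  ⟨(H.sub_iff _ s.left_mem _ s.mid_mem).1 s.left_sub,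
    (H.sub_iff _ s.right_mem _ s.mid_mem).1 s.right_sub, H.off _ s.mid_mem⟩

theorem le_antisymm (H : IsModel k L cl A base) {lam mu : Weight} (hl : lam ∈ L) (hm : mu ∈ L)
    (h1 : lam.BruhatLE mu) (h2 : mu.BruhatLE lam) : lam = mu := by
  rw [H.le_iff _ hl _ hm] at h1
  rw [H.le_iff _ hm _ hl] at h2
  refine H.injective _ hl _ hm (funext fun x => ?_)
  by_cases hx : x ∈ A
  · exact eq_of_prefixSum_eq (fun y hy => ((H.closed _ hl).arrow y).2 hy)
      (fun y hy => ((H.closed _ hm).arrow y).2 hy) (fun m => _root_.le_antisymm (h2 m) (h1 m)) x hx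
  · rw [H.off _ hl x hx, H.off _ hm x hx]

/-- The weights in a product are at least as big as those of the factors. -/
theorem le_of_coeffAt_mul_ne_zero (H : IsModel k L cl A base) {s t u : CircleDiagram L}
    (h : coeffAt k u (basisVec k s * basisVec k t) ≠ 0) :
    s.mid.BruhatLE u.mid ∧ t.mid.BruhatLE u.mid := by
  have := H.finite
  obtain ⟨h0, h1, h2⟩ := of_coeffAt_mul_ne_zero h
  rw [coeffAt_mul h0 h1 h2, H.structureCoeff_eq] at h
  have hs := H.mem_oriented s
  have ht := H.mem_oriented t
  rw [← h0] at ht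
  have hle := prefixSum_le_of_closedCoeff_ne_zero (H.closed _ s.left_mem)
    (H.closed _ s.right_mem) (H.closed _ t.right_mem) hs.1 hs.2.1 ht.1 ht.2.1 h
  exact ⟨(H.le_iff _ s.mid_mem _ u.mid_mem).2 fun m => (hle m).1,
    (H.le_iff _ t.mid_mem _ u.mid_mem).2 fun m => (hle m).2⟩

/-- A sum over all closed diagrams which is supported on closures of diagrams of the block. -/
theorem sum_oriented (H : IsModel k L cl A base) [Finite (CircleDiagram L)] {a c : Weight}
    (ha : a ∈ L) (hc : c ∈ L) {F : Labelling → k}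
    (hF : ∀ f ∈ Oriented A (cl a) (cl c) base, F f ≠ 0 →
      ∃ rho ∈ L, ∀ m, prefixSum A (cl rho) m ≤ prefixSum A f m) :
    ∑ f ∈ (finite_oriented A (cl a) (cl c) base).toFinset, F f = ∑ u ∈ diagramsBetween L a c, F (cl u.mid) := by
  symm
  refine Finset.sum_of_injOn (fun u => cl u.mid) ?_ ?_ ?_ fun _ _ => rfl
  · intro u hu v hv h
    obtain ⟨h1, h2⟩ := mem_diagramsBetween.1 hu
    obtain ⟨h3, h4⟩ := mem_diagramsBetween.1 hv
    exact CircleDiagram.ext (h1.trans h3.symm) (H.injective _ u.mid_mem _ v.mid_mem h)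
      (h2.trans h4.symm)
  · intro u hu
    obtain ⟨h1, h2⟩ := mem_diagramsBetween.1 hu
    rw [Finset.mem_coe, Set.Finite.mem_toFinset, ← h1, ← h2]
    exact H.mem_oriented u
  · intro f hf hnot
    rw [Set.Finite.mem_toFinset] at hf
    by_contra hne
    obtain ⟨rho, hrho, hle⟩ := hF f hf hne
    obtain ⟨lam, hl, rfl⟩ := H.exists_eq a ha f hf.1 hf.2.2 rho hrho hle
    exact hnot ⟨⟨a, lam, c, ha, hl, hc, (H.sub_iff _ ha _ hl).2 hf.1,
      (H.sub_iff _ hc _ hl).2 hf.2.1⟩, mem_diagramsBetween.2 ⟨rfl, rfl⟩, rfl⟩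

/-- The associativity of closed diagrams sums over all intermediate labellings, the block only over
closures. An intermediate labelling that leads on to the closure of `w.mid` dominates it in prefix
sums, hence is a closure itself, so by `sum_oriented` both sums agree. -/
theorem basisVec_mul_assoc (H : IsModel k L cl A base) (s t v : CircleDiagram L) :
    basisVec k s * basisVec k t * basisVec k v =
      basisVec k s * (basisVec k t * basisVec k v) := by
  classical
  have := H.finite
  by_cases h1 : s.right = t.left
  swap
  · rw [basisVec_mul_of_ne h1, zero_mul]
    by_cases h2 : t.right = v.left
    · rw [basisVec_mul_eq_sum h2, KAlg.mul_sum, Finset.sum_eq_zero]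
      intro u hu
      rw [mem_diagramsBetween] at hu
      rw [KAlg.mul_smul, basisVec_mul_of_ne (hu.1 ▸ h1), smul_zero]
    · rw [basisVec_mul_of_ne h2, mul_zero]
  by_cases h2 : t.right = v.left
  swap
  · rw [basisVec_mul_of_ne h2, mul_zero, basisVec_mul_eq_sum h1, KAlg.sum_mul,
      Finset.sum_eq_zero]
    intro u hu
    rw [mem_diagramsBetween] at hu
    rw [KAlg.smul_mul, basisVec_mul_of_ne (hu.2 ▸ h2), smul_zero]
  rw [basisVec_mul_eq_sum h1, basisVec_mul_eq_sum h2, KAlg.sum_mul, KAlg.mul_sum]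
  simp only [KAlg.smul_mul, KAlg.mul_smul]
  refine KAlg.ext_coeff fun w => ?_
  simp only [map_sum, map_smul, smul_eq_mul]
  by_cases h3 : w.left = s.left ∧ w.right = v.right
  swap
  · rw [Finset.sum_eq_zero, Finset.sum_eq_zero]
    · intro u hu
      rw [mem_diagramsBetween] at hu
      by_contra hne
      have := of_coeffAt_mul_ne_zero (right_ne_zero_of_mul hne)
      exact h3 ⟨this.2.1, this.2.2.trans hu.2⟩
    · intro u hu
      rw [mem_diagramsBetween] at hu
      by_contra hne
      have := of_coeffAt_mul_ne_zero (right_ne_zero_of_mul hne)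
      exact h3 ⟨this.2.1.trans hu.1, this.2.2⟩
  obtain ⟨h3, h4⟩ := h3
  have ha := H.closed _ s.left_mem
  have hb := H.closed _ s.right_mem
  have hc := H.closed _ t.right_mem
  have hd := H.closed _ v.right_mem
  have hs := H.mem_oriented s
  have ht := H.mem_oriented t
  have hv := H.mem_oriented v
  have hw := H.mem_oriented w
  rw [← h1] at ht
  rw [← h2] at hv
  rw [h3, h4] at hw
  have key := closedCoeff_assoc (k := k) ha hb hc hd hs ht hv hw
  have e1 := H.sum_oriented s.left_mem t.right_mem (F := fun f =>
    closedCoeff k (cl s.left) (cl s.right) (cl t.right) (cl s.mid) (cl t.mid) f *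
      closedCoeff k (cl s.left) (cl t.right) (cl v.right) f (cl v.mid) (cl w.mid))
    fun f hfo hf => ⟨w.mid, w.mid_mem, fun m => (prefixSum_le_of_closedCoeff_ne_zero ha hc hd
      hfo.1 hfo.2.1 hv.1 hv.2.1 (right_ne_zero_of_mul hf) m).1⟩
  have e2 := H.sum_oriented s.right_mem v.right_mem (F := fun f =>
    closedCoeff k (cl s.right) (cl t.right) (cl v.right) (cl t.mid) (cl v.mid) f *
      closedCoeff k (cl s.left) (cl s.right) (cl v.right) (cl s.mid) f (cl w.mid))
    fun f hfo hf => ⟨w.mid, w.mid_mem, fun m => (prefixSum_le_of_closedCoeff_ne_zero ha hb hd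
      hs.1 hs.2.1 hfo.1 hfo.2.1 (right_ne_zero_of_mul hf) m).2⟩
  rw [e1, e2] at key
  rw [← h1]
  refine Eq.trans (Finset.sum_congr rfl fun u hu => ?_) (key.trans
    (Finset.sum_congr rfl fun u hu => ?_))
  · rw [mem_diagramsBetween] at hu
    rw [coeffAt_mul (hu.2.trans h2) (h3.trans hu.1.symm) h4, H.structureCoeff_eq,
      H.structureCoeff_eq, hu.1, hu.2]
  · rw [mem_diagramsBetween] at hu
    rw [coeffAt_mul hu.1.symm h3 (h4.trans hu.2.symm),
      H.structureCoeff_eq, H.structureCoeff_eq, hu.2, h1]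

theorem mul_assoc (H : IsModel k L cl A base) (x y z : KAlg k L) : x * y * z = x * (y * z) := by
  induction x using KAlg.induction with
  | h0 => rw [zero_mul, zero_mul, zero_mul]
  | hadd x x' hx hx' => rw [add_mul, add_mul, add_mul, hx, hx']
  | hsmul c s =>
    rw [KAlg.smul_mul, KAlg.smul_mul, KAlg.smul_mul]
    congr 1
    induction y using KAlg.induction with
    | h0 => simp only [zero_mul, mul_zero]
    | hadd y y' hy hy' => rw [add_mul, mul_add, mul_add, add_mul, hy, hy']
    | hsmul c t =>
      rw [KAlg.smul_mul, KAlg.mul_smul, KAlg.mul_smul, KAlg.smul_mul]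
      congr 1
      induction z using KAlg.induction with
      | h0 => rw [mul_zero, mul_zero, mul_zero]
      | hadd z z' hz hz' => rw [mul_add, mul_add, mul_add, hz, hz']
      | hsmul c v => rw [KAlg.mul_smul, KAlg.mul_smul, KAlg.mul_smul, H.basisVec_mul_assoc]

theorem starMap_mul (H : IsModel k L cl A base) (x y : KAlg k L) :
    starMap k L (x * y) = starMap k L y * starMap k L x := by
  have := H.finite
  induction x using KAlg.induction with
  | h0 => rw [zero_mul, map_zero, mul_zero]
  | hadd x x' hx hx' => rw [add_mul, map_add, map_add, mul_add, hx, hx']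
  | hsmul c s =>
    rw [KAlg.smul_mul, map_smul, map_smul, KAlg.mul_smul]
    congr 1
    induction y using KAlg.induction with
    | h0 => rw [mul_zero, map_zero, zero_mul]
    | hadd y y' hy hy' => rw [mul_add, map_add, map_add, add_mul, hy, hy']
    | hsmul c t =>
      rw [KAlg.mul_smul, map_smul, map_smul, KAlg.smul_mul, starMap_basisVec, starMap_basisVec]
      congr 1
      refine KAlg.ext_coeff fun u => ?_
      rw [coeffAt_starMap]
      by_cases h : s.right = t.left ∧ u.left = t.right ∧ u.right = s.left
      · obtain ⟨h1, h2, h3⟩ := h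
        rw [coeffAt_mul h1 h3 h2, coeffAt_mul (s := t.mirror) (t := s.mirror) h1.symm h2 h3,
          H.structureCoeff_eq, H.structureCoeff_eq]
        have hs := H.mem_oriented s
        have ht := H.mem_oriented t
        have hu := H.mem_oriented u.mirror
        rw [← h1] at ht
        change cl u.mid ∈ Oriented A (cl u.right) (cl u.left) base at hu
        rw [h2, h3] at hu
        change _ = closedCoeff k (cl t.right) (cl t.left) (cl s.left) (cl t.mid) (cl s.mid)
          (cl u.mid)
        rw [← h1]
        exact closedCoeff_mirror (H.closed _ s.left_mem) (H.closed _ s.right_mem)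
          (H.closed _ t.right_mem) hs ht hu
      · by_contra hne
        by_cases h0 : coeffAt k u.mirror (basisVec k s * basisVec k t) = 0
        · rw [h0] at hne
          obtain ⟨h1, h2, h3⟩ := of_coeffAt_mul_ne_zero (Ne.symm hne)
          exact h ⟨h1.symm, h2, h3⟩
        · obtain ⟨h1, h2, h3⟩ := of_coeffAt_mul_ne_zero h0
          exact h ⟨h1, h3, h2⟩

/-- The diagram of the idempotent of a weight. -/
def idemDiagram (α : Weight) (hα : α ∈ L) : CircleDiagram L :=
  ⟨α, α, α, hα, hα, hα, α.sub_refl, α.sub_refl⟩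

theorem idem_mul (H : IsModel k L cl A base) (s : CircleDiagram L) :
    idem k s.left s.left_mem * basisVec k s = basisVec k s := by
  classical
  have := H.finite
  refine KAlg.ext_coeff fun u => ?_
  by_cases h : u.left = s.left ∧ u.right = s.right
  · obtain ⟨h1, h2⟩ := h
    change coeffAt k u (basisVec k (idemDiagram s.left s.left_mem) * basisVec k s) = _
    rw [coeffAt_mul (s := idemDiagram s.left s.left_mem) rfl h1 h2, H.structureCoeff_eq]
    change closedCoeff k (cl s.left) (cl s.left) (cl s.right) (cl s.left) (cl s.mid) (cl u.mid) = _
    have hu := H.mem_oriented u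
    rw [h1, h2] at hu
    rw [closedCoeff_self (H.closed _ s.left_mem) (H.closed _ s.right_mem) (H.off _ s.left_mem)
      (H.mem_oriented s) hu]
    split_ifs with h3
    · have : u = s := CircleDiagram.ext h1 (H.injective _ u.mid_mem _ s.mid_mem h3) h2
      rw [this, coeffAt_basisVec_self]
    · rw [coeffAt_basisVec_of_ne]
      rintro rfl
      exact h3 rfl
  · rw [coeffAt_basisVec_of_ne (fun h' => h (by rw [← h']; exact ⟨rfl, rfl⟩))]
    by_contra hne
    obtain ⟨-, h1, h2⟩ := of_coeffAt_mul_ne_zero hne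
    exact h ⟨h1, h2⟩

theorem idem_mul_of_ne {α : Weight} (hα : α ∈ L)
    {s : CircleDiagram L} (h : α ≠ s.left) : idem k α hα * basisVec k s = 0 :=
  basisVec_mul_of_ne h

theorem starMap_idem {α : Weight} (hα : α ∈ L) :
    starMap k L (idem k α hα) = idem k α hα := starMap_basisVec _

theorem mul_idem (H : IsModel k L cl A base) (s : CircleDiagram L) :
    basisVec k s * idem k s.right s.right_mem = basisVec k s := by
  have h := congrArg (starMap k L) (H.idem_mul s.mirror)
  rw [H.starMap_mul, starMap_idem, starMap_basisVec] at h
  exact h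

theorem mul_idem_of_ne {α : Weight} (hα : α ∈ L)
    {s : CircleDiagram L} (h : s.right ≠ α) : basisVec k s * idem k α hα = 0 :=
  basisVec_mul_of_ne h

end IsModel


/-! ## The cellular structure -/

/-- The cup and the cap diagram have the maximal number of cups. -/
def CircleDiagram.IsMaximal {L : Set Weight} (s : CircleDiagram L) : Prop :=
  s.left ∈ maxDefect L ∧ s.right ∈ maxDefect L

/-- The weight of the diagram is strictly bigger than `mu`. -/
def CircleDiagram.Above {L : Set Weight} (mu : Weight) (s : CircleDiagram L) : Prop :=
  mu.BruhatLE s.mid ∧ mu ≠ s.mid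

section CellDiagrams

variable {L : Set Weight} {mu : L}

/-- The diagram of the vector `C^μ_{γ,δ}`. -/
def cellDiagram (mu : L) (γ δ : CellIndex L mu) : CircleDiagram L :=
  ⟨γ.1, mu.1, δ.1, γ.2.1.1, mu.2, δ.2.1.1, γ.2.2, δ.2.2⟩

/-- The diagram with cup diagram `γ`, and with weight and cap diagram `μ`. -/
def leftHalf (mu : L) (γ : CellIndex L mu) : CircleDiagram L :=
  ⟨γ.1, mu.1, mu.1, γ.2.1.1, mu.2, mu.2, γ.2.2, mu.1.sub_refl⟩

/-- The diagram with cup diagram and weight `μ`, and with cap diagram `δ`. -/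
def rightHalf (mu : L) (δ : CellIndex L mu) : CircleDiagram L :=
  ⟨mu.1, mu.1, δ.1, mu.2, mu.2, δ.2.1.1, mu.1.sub_refl, δ.2.2⟩

theorem cellVec_eq (k : Type*) [Field k] (γ δ : CellIndex L mu) :
    cellVec k L mu γ δ = basisVec k (cellDiagram mu γ δ) := rfl

theorem cellDiagram_isMaximal (γ δ : CellIndex L mu) : (cellDiagram mu γ δ).IsMaximal :=
  ⟨γ.2.1, δ.2.1⟩

theorem exists_cellDiagram_eq {s : CircleDiagram L} (hs : s.IsMaximal) :
    ∃ γ δ : CellIndex L ⟨s.mid, s.mid_mem⟩, cellDiagram ⟨s.mid, s.mid_mem⟩ γ δ = s :=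
  ⟨⟨s.left, hs.1, s.left_sub⟩, ⟨s.right, hs.2, s.right_sub⟩, rfl⟩

theorem cellDiagram_injective : Function.Injective
    fun t : (Σ mu : L, CellIndex L mu × CellIndex L mu) => cellDiagram t.1 t.2.1 t.2.2 := by
  rintro ⟨⟨mu, hmu⟩, ⟨γ, hγ⟩, ⟨δ, hδ⟩⟩ ⟨⟨mu', hmu'⟩, ⟨γ', hγ'⟩, ⟨δ', hδ'⟩⟩ h
  have h1 : γ = γ' := congrArg CircleDiagram.left h
  have h2 : mu = mu' := congrArg CircleDiagram.mid h
  have h3 : δ = δ' := congrArg CircleDiagram.right h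
  subst h1 h2 h3
  rfl

theorem finite_cellIndex (hfin : L.Finite) (mu : L) : Finite (CellIndex L mu) :=
  (hfin.subset fun _ h => h.1.1 : {α : Weight | α ∈ maxDefect L ∧ α.Sub mu.1}.Finite).to_subtype

end CellDiagrams

section DiagSpan

variable {k : Type*} [Field k] {L : Set Weight}

theorem diagSpan_mul {P Q R : CircleDiagram L → Prop}
    (h : ∀ s t u, P s → Q t → coeffAt k u (basisVec k s * basisVec k t) ≠ 0 → R u)
    {x y : KAlg k L} (hx : x ∈ diagSpan k P) (hy : y ∈ diagSpan k Q) :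
    x * y ∈ diagSpan k R := by
  induction hx using Submodule.span_induction with
  | mem x hx =>
    obtain ⟨s, hs, rfl⟩ := hx
    induction hy using Submodule.span_induction with
    | mem y hy =>
      obtain ⟨t, ht, rfl⟩ := hy
      exact mem_diagSpan_iff.2 fun u => h s t u hs ht
    | zero => rw [mul_zero]; exact zero_mem _
    | add y y' _ _ hy hy' => rw [mul_add]; exact add_mem hy hy'
    | smul c y _ hy => rw [KAlg.mul_smul]; exact Submodule.smul_mem _ c hy
  | zero => rw [zero_mul]; exact zero_mem _
  | add x x' _ _ hx hx' => rw [add_mul]; exact add_mem hx hx'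
  | smul c x _ hx => rw [KAlg.smul_mul]; exact Submodule.smul_mem _ c hx

theorem mem_diagSpan_true (x : KAlg k L) : x ∈ diagSpan k fun _ : CircleDiagram L => True :=
  mem_diagSpan_iff.2 fun _ _ => trivial

/-- Supports are computed in the whole algebra; this brings the resulting span statements back into
the subalgebra. -/
theorem mem_span_of_mem_diagSpan {B : NonUnitalSubalgebra k (KAlg k L)}
    {P : CircleDiagram L → Prop} {S : Set B}
    (hS : ∀ s, P s → ∃ h : basisVec k s ∈ B, (⟨basisVec k s, h⟩ : B) ∈ Submodule.span k S)
    {x : KAlg k L} (hx : x ∈ diagSpan k P) (hxB : x ∈ B) :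
    (⟨x, hxB⟩ : B) ∈ Submodule.span k S := by
  suffices ∃ h : x ∈ B, (⟨x, h⟩ : B) ∈ Submodule.span k S from this.2
  clear hxB
  induction hx using Submodule.span_induction with
  | mem x hx =>
    obtain ⟨s, hs, rfl⟩ := hx
    exact hS s hs
  | zero => exact ⟨zero_mem _, zero_mem (Submodule.span k S)⟩
  | add x y _ _ hx hy =>
    obtain ⟨hx, hx'⟩ := hx
    obtain ⟨hy, hy'⟩ := hy
    exact ⟨add_mem hx hy, add_mem hx' hy'⟩
  | smul c x _ hx =>
    obtain ⟨hx, hx'⟩ := hx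
    exact ⟨B.smul_mem' c hx, Submodule.smul_mem _ c hx'⟩

theorem starMap_mem {x : KAlg k L} (hx : x ∈ diagSpan k (L := L) CircleDiagram.IsMaximal) :
    starMap k L x ∈ diagSpan k (L := L) CircleDiagram.IsMaximal := by
  rw [mem_diagSpan_iff] at hx ⊢
  intro u hu
  rw [coeffAt_starMap] at hu
  exact (hx _ hu).symm

end DiagSpan

namespace IsModel

variable {k : Type*} [Field k] {L : Set Weight} {cl : Weight → Labelling} {A : Finset ℤ}
  {base : Labelling}

/-- Multiplying by the two idempotents keeps exactly the basis diagrams with the prescribed cup and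
cap diagrams. -/
theorem khovanovAlg_eq (H : IsModel k L cl A base) :
    khovanovAlg k L = diagSpan k CircleDiagram.IsMaximal := by
  refine _root_.le_antisymm (iSup_le ?_) (Submodule.span_le.2 ?_)
  · rintro ⟨α, hα⟩
    refine iSup_le ?_
    rintro ⟨β, hβ⟩
    refine Submodule.span_le.2 ?_
    rintro _ ⟨x, rfl⟩
    change idem k α hα.1 * x * idem k β hβ.1 ∈ diagSpan k CircleDiagram.IsMaximal
    induction x using KAlg.induction with
    | h0 => rw [mul_zero, zero_mul]; exact zero_mem _
    | hadd x y hx hy => rw [mul_add, add_mul]; exact add_mem hx hy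
    | hsmul c s =>
      rw [KAlg.mul_smul, KAlg.smul_mul]
      refine Submodule.smul_mem _ c ?_
      by_cases h1 : α = s.left
      · subst h1
        rw [H.idem_mul]
        by_cases h2 : s.right = β
        · subst h2
          rw [H.mul_idem]
          exact basisVec_mem_diagSpan ⟨hα, hβ⟩
        · rw [mul_idem_of_ne _ h2]
          exact zero_mem _
      · rw [idem_mul_of_ne _ h1, zero_mul]
        exact zero_mem _
  · rintro _ ⟨s, hs, rfl⟩
    refine Submodule.mem_iSup_of_mem ⟨s.left, hs.1⟩
      (Submodule.mem_iSup_of_mem ⟨s.right, hs.2⟩ (Submodule.subset_span ⟨basisVec k s, ?_⟩))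
    change idem k s.left s.left_mem * basisVec k s * idem k s.right s.right_mem = _
    rw [H.idem_mul, H.mul_idem]

theorem mul_mem (H : IsModel k L cl A base) {x y : KAlg k L}
    (hx : x ∈ diagSpan k (L := L) CircleDiagram.IsMaximal)
    (hy : y ∈ diagSpan k (L := L) CircleDiagram.IsMaximal) :
    x * y ∈ diagSpan k (L := L) CircleDiagram.IsMaximal := by
  have := H.finite
  refine diagSpan_mul (fun s t u hs ht h => ?_) hx hy
  obtain ⟨-, h1, h2⟩ := of_coeffAt_mul_ne_zero h
  exact ⟨h1 ▸ hs.1, h2 ▸ ht.2⟩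

theorem exists_unit (H : IsModel k L cl A base) (hfin : L.Finite) :
    ∃ e ∈ diagSpan k (L := L) CircleDiagram.IsMaximal,
      ∀ x ∈ diagSpan k (L := L) CircleDiagram.IsMaximal, e * x = x ∧ x * e = x := by
  have : Finite (maxDefect L) := (hfin.subset fun _ h => h.1 : (maxDefect L).Finite).to_subtype
  have := Fintype.ofFinite (maxDefect L)
  refine ⟨∑ α : maxDefect L, idem k α.1 α.2.1,
    sum_mem fun α _ => basisVec_mem_diagSpan ⟨α.2, α.2⟩, fun x hx => ?_⟩
  induction hx using Submodule.span_induction with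
  | mem x hx =>
    obtain ⟨s, hs, rfl⟩ := hx
    rw [KAlg.sum_mul, KAlg.mul_sum]
    constructor
    · rw [Finset.sum_eq_single_of_mem (⟨s.left, hs.1⟩ : maxDefect L) (Finset.mem_univ _)]
      · exact H.idem_mul s
      · exact fun α _ hne => idem_mul_of_ne _ fun h => hne (Subtype.ext h)
    · rw [Finset.sum_eq_single_of_mem (⟨s.right, hs.2⟩ : maxDefect L) (Finset.mem_univ _)]
      · exact H.mul_idem s
      · exact fun α _ hne => mul_idem_of_ne _ fun h => hne (Subtype.ext h.symm)
  | zero => exact ⟨mul_zero _, zero_mul _⟩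
  | add x y _ _ hx hy =>
    exact ⟨by rw [mul_add, hx.1, hy.1], by rw [add_mul, hx.2, hy.2]⟩
  | smul c x _ hx =>
    exact ⟨by rw [KAlg.mul_smul, hx.1], by rw [KAlg.smul_mul, hx.2]⟩

/-- Strictness survives by the antisymmetry of the Bruhat order, so the diagrams above `mu` span a
two-sided ideal. -/
theorem above_mono (H : IsModel k L cl A base) {mu : Weight} (hmu : mu ∈ L)
    {s u : CircleDiagram L} (hs : s.Above mu) (h : s.mid.BruhatLE u.mid) : u.Above mu := by
  refine ⟨hs.1.trans h, fun he => hs.2 ?_⟩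
  exact H.le_antisymm hmu s.mid_mem hs.1 (he ▸ h)

theorem mul_mem_above_left (H : IsModel k L cl A base) {mu : Weight} (hmu : mu ∈ L)
    {x : KAlg k L} (hx : x ∈ diagSpan k (CircleDiagram.Above (L := L) mu)) (y : KAlg k L) :
    x * y ∈ diagSpan k (CircleDiagram.Above (L := L) mu) :=
  diagSpan_mul (fun _ _ _ hs _ h => H.above_mono hmu hs (H.le_of_coeffAt_mul_ne_zero h).1) hx
    (mem_diagSpan_true y)

theorem mul_mem_above_right (H : IsModel k L cl A base) {mu : Weight} (hmu : mu ∈ L)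
    {x : KAlg k L} (hx : x ∈ diagSpan k (CircleDiagram.Above (L := L) mu)) (y : KAlg k L) :
    y * x ∈ diagSpan k (CircleDiagram.Above (L := L) mu) :=
  diagSpan_mul (fun _ _ _ _ ht h => H.above_mono hmu ht (H.le_of_coeffAt_mul_ne_zero h).2)
    (mem_diagSpan_true y) hx

/-- A cell vector is a product of two half diagrams, up to terms with bigger weights. -/
theorem half_mul_half (H : IsModel k L cl A base) {mu : L} (γ δ : CellIndex L mu) :
    basisVec k (leftHalf mu γ) * basisVec k (rightHalf mu δ) - cellVec k L mu γ δ ∈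
      diagSpan k (CircleDiagram.Above (L := L) mu.1) := by
  have := H.finite
  refine mem_diagSpan_iff.2 fun u hu => ?_
  rw [map_sub, cellVec_eq] at hu
  by_cases h : cellDiagram mu γ δ = u
  · subst h
    rw [coeffAt_basisVec_self, coeffAt_mul (s := leftHalf mu γ) (t := rightHalf mu δ)
      (u := cellDiagram mu γ δ) rfl rfl rfl,
      H.structureCoeff_eq] at hu
    refine absurd ?_ hu
    rw [sub_eq_zero]
    exact closedCoeff_middle (H.closed _ γ.2.1.1) (H.closed _ mu.2) (H.closed _ δ.2.1.1)
      ((H.sub_iff _ γ.2.1.1 _ mu.2).1 γ.2.2) ((H.sub_iff _ δ.2.1.1 _ mu.2).1 δ.2.2)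
  · rw [coeffAt_basisVec_of_ne h, sub_zero] at hu
    obtain ⟨-, h1, h2⟩ := of_coeffAt_mul_ne_zero hu
    exact ⟨(H.le_of_coeffAt_mul_ne_zero hu).1,
      fun he => h (CircleDiagram.ext h1.symm he h2.symm)⟩

/-- All terms of the product have cap diagram `mu` and weight at least `mu`. Those of weight exactly
`mu` are again left halves, and the rest lies above. -/
theorem mul_leftHalf (H : IsModel k L cl A base) {mu : L} [Fintype (CellIndex L mu)]
    {x : KAlg k L} (hx : x ∈ diagSpan k (L := L) CircleDiagram.IsMaximal) (γ : CellIndex L mu) :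
    x * basisVec k (leftHalf mu γ) - ∑ γ' : CellIndex L mu,
      coeffAt k (leftHalf mu γ') (x * basisVec k (leftHalf mu γ)) •
        basisVec k (leftHalf mu γ') ∈ diagSpan k (CircleDiagram.Above (L := L) mu.1) := by
  have := H.finite
  have hy : x * basisVec k (leftHalf mu γ) ∈ diagSpan k (fun u : CircleDiagram L =>
      u.left ∈ maxDefect L ∧ u.right = mu.1 ∧ mu.1.BruhatLE u.mid) := by
    refine diagSpan_mul (Q := fun t => t = leftHalf mu γ) (fun s t u hs ht h => ?_) hx
      (basisVec_mem_diagSpan rfl)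
    subst ht
    obtain ⟨-, h1, h2⟩ := of_coeffAt_mul_ne_zero h
    exact ⟨h1 ▸ hs.1, h2, (H.le_of_coeffAt_mul_ne_zero h).2⟩
  rw [mem_diagSpan_iff] at hy
  refine mem_diagSpan_iff.2 fun u hu => ?_
  rw [map_sub] at hu
  by_cases h : ∃ γ', leftHalf mu γ' = u
  · obtain ⟨γ', rfl⟩ := h
    rw [coeffAt_sum_basisVec (f := leftHalf mu) (Finset.mem_univ γ'), sub_self] at hu
    · exact absurd rfl hu
    · exact fun j _ hj => Subtype.ext (congrArg CircleDiagram.left hj)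
  · rw [coeffAt_sum_basisVec_of_ne fun j _ hj => h ⟨j, hj⟩, sub_zero] at hu
    obtain ⟨h1, h2, h3⟩ := hy u hu
    refine ⟨h3, fun he => h ⟨⟨u.left, h1, ?_⟩, CircleDiagram.ext rfl he h2.symm⟩⟩
    rw [he]
    exact u.left_sub

/-- Modulo bigger weights the cell vector is a left half times a right half. By associativity `x`
acts on the left half alone, so the coefficients depend only on `γ` and `γ'`. -/
theorem mul_cellVec (H : IsModel k L cl A base) {mu : L} [Fintype (CellIndex L mu)]
    {x : KAlg k L} (hx : x ∈ diagSpan k (L := L) CircleDiagram.IsMaximal)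
    (γ δ : CellIndex L mu) :
    x * cellVec k L mu γ δ - ∑ γ' : CellIndex L mu,
      coeffAt k (leftHalf mu γ') (x * basisVec k (leftHalf mu γ)) • cellVec k L mu γ' δ ∈
        diagSpan k (fun u : CircleDiagram L => u.Above mu.1 ∧ u.IsMaximal) := by
  have h1 : x * cellVec k L mu γ δ - ∑ γ' : CellIndex L mu,
      coeffAt k (leftHalf mu γ') (x * basisVec k (leftHalf mu γ)) • cellVec k L mu γ' δ ∈
        diagSpan k (CircleDiagram.Above (L := L) mu.1) := by
    have e1 := H.mul_mem_above_right mu.2 (H.half_mul_half γ δ) x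
    have e2 := H.mul_mem_above_left mu.2 (H.mul_leftHalf hx γ) (basisVec k (rightHalf mu δ))
    have e3 : ∑ γ' : CellIndex L mu,
        coeffAt k (leftHalf mu γ') (x * basisVec k (leftHalf mu γ)) •
          (basisVec k (leftHalf mu γ') * basisVec k (rightHalf mu δ) - cellVec k L mu γ' δ) ∈
        diagSpan k (CircleDiagram.Above (L := L) mu.1) :=
      sum_mem fun γ' _ => Submodule.smul_mem _ _ (H.half_mul_half γ' δ)
    rw [mul_sub, ← H.mul_assoc] at e1
    rw [sub_mul, KAlg.sum_mul] at e2
    simp only [KAlg.smul_mul] at e2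
    simp only [smul_sub, Finset.sum_sub_distrib] at e3
    convert add_mem (sub_mem e2 e1) e3 using 1
    abel
  -- The half diagrams need not lie in the subalgebra, since `mu` itself may have smaller defect.
  -- The error term does lie in it, and a support condition may be intersected with another.
  have h2 : x * cellVec k L mu γ δ - ∑ γ' : CellIndex L mu,
      coeffAt k (leftHalf mu γ') (x * basisVec k (leftHalf mu γ)) • cellVec k L mu γ' δ ∈
        diagSpan k (L := L) CircleDiagram.IsMaximal :=
    sub_mem (H.mul_mem hx (basisVec_mem_diagSpan (cellDiagram_isMaximal γ δ)))
      (sum_mem fun γ' _ => Submodule.smul_mem _ _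
        (basisVec_mem_diagSpan (cellDiagram_isMaximal γ' δ)))
  rw [mem_diagSpan_iff] at h1 h2 ⊢
  exact fun u hu => ⟨h1 u hu, h2 u hu⟩

/-- The generalised Khovanov algebra as a subalgebra. -/
def subalgebra (H : IsModel k L cl A base) : NonUnitalSubalgebra k (KAlg k L) where
  carrier := diagSpan k (L := L) CircleDiagram.IsMaximal
  add_mem' := add_mem
  zero_mem' := zero_mem _
  mul_mem' := H.mul_mem
  smul_mem' c _ hx := Submodule.smul_mem _ c hx

theorem cellVec_mem (H : IsModel k L cl A base) (lam : L) (α β : CellIndex L lam) :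
    cellVec k L lam α β ∈ H.subalgebra :=
  basisVec_mem_diagSpan (cellDiagram_isMaximal α β)

theorem isCellularAlgebra (H : IsModel k L cl A base) (hfin : L.Finite) :
    IsCellularAlgebra k H.subalgebra
      (fun lam mu : L => Weight.BruhatLE lam.1 mu.1) (CellIndex L)
      (fun lam α β => ⟨cellVec k L lam α β, H.cellVec_mem lam α β⟩)
      (fun x => ⟨starMap k L x.1, starMap_mem x.2⟩) where
  mul_assoc x y z := Subtype.ext (H.mul_assoc x.1 y.1 z.1)
  smul_mul c x y := Subtype.ext (KAlg.smul_mul c x.1 y.1)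
  mul_smul c x y := Subtype.ext (KAlg.mul_smul c x.1 y.1)
  unital := by
    obtain ⟨e, he, h⟩ := H.exists_unit hfin
    exact ⟨⟨e, he⟩, fun x => ⟨Subtype.ext (h x.1 x.2).1, Subtype.ext (h x.1 x.2).2⟩⟩
  le_refl _ := Relation.ReflTransGen.refl
  le_trans _ _ _ h h' := Relation.ReflTransGen.trans h h'
  le_antisymm lam mu h h' := Subtype.ext (H.le_antisymm lam.2 mu.2 h h')
  finite := finite_cellIndex hfin
  injective := fun _ _ h => cellDiagram_injective (basisVec_injective (congrArg Subtype.val h))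
  linearIndependent := by
    refine LinearIndependent.of_comp H.subalgebra.toSubmodule.subtype ?_
    exact (basisVec_linearIndependent (k := k)).comp _ cellDiagram_injective
  span_eq_top := by
    refine eq_top_iff.2 fun x _ => ?_
    refine mem_span_of_mem_diagSpan (P := CircleDiagram.IsMaximal) (fun s hs => ?_) x.2 x.2
    obtain ⟨γ, δ, h⟩ := exists_cellDiagram_eq hs
    exact ⟨basisVec_mem_diagSpan hs,
      Submodule.subset_span ⟨⟨_, γ, δ⟩, Subtype.ext (congrArg (basisVec k) h)⟩⟩
  star_add x y := Subtype.ext ((starMap k L).map_add x.1 y.1)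
  star_smul c x := Subtype.ext ((starMap k L).map_smul c x.1)
  star_mul x y := Subtype.ext (H.starMap_mul x.1 y.1)
  star_bijective := Function.Involutive.bijective fun x => Subtype.ext (starMap_starMap x.1)
  star_C lam α β := Subtype.ext (starMap_basisVec _)
  mul_C x mu := by
    have := finite_cellIndex hfin mu
    have := Fintype.ofFinite (CellIndex L mu)
    refine ⟨fun γ' γ => coeffAt k (leftHalf mu γ') (x.1 * basisVec k (leftHalf mu γ)),
      fun γ δ => ?_⟩
    rw [finsum_eq_sum_of_fintype]
    have hval : (x * ⟨cellVec k L mu γ δ, H.cellVec_mem mu γ δ⟩ - ∑ γ' : CellIndex L mu,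
        coeffAt k (leftHalf mu γ') (x.1 * basisVec k (leftHalf mu γ)) •
          (⟨cellVec k L mu γ' δ, H.cellVec_mem mu γ' δ⟩ : H.subalgebra)).1 =
        x.1 * cellVec k L mu γ δ - ∑ γ' : CellIndex L mu,
          coeffAt k (leftHalf mu γ') (x.1 * basisVec k (leftHalf mu γ)) •
            cellVec k L mu γ' δ := by
      rw [AddSubgroupClass.coe_sub, AddSubmonoidClass.coe_finsetSum]
      rfl
    have hmem := H.mul_cellVec x.2 γ δ
    rw [← hval] at hmem
    refine mem_span_of_mem_diagSpan (fun s hs => ?_) hmem (Subtype.prop _)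
    obtain ⟨γ', δ', h⟩ := exists_cellDiagram_eq hs.2
    exact ⟨basisVec_mem_diagSpan hs.2, Submodule.subset_span ⟨⟨s.mid, s.mid_mem⟩, hs.1.1,
      fun he => hs.1.2 (congrArg Subtype.val he), γ', δ',
      Subtype.ext (congrArg (basisVec k) h.symm)⟩⟩

end IsModel

end ArcAlgebra

theorem theorem6p2 (k : Type*) [Field k] (L : Set ArcAlgebra.Weight) (hL : ArcAlgebra.IsBlock L)
    (hfin : L.Finite) :
    ∃ H : NonUnitalSubalgebra k (ArcAlgebra.KAlg k L),
      H.toSubmodule = ArcAlgebra.khovanovAlg k L ∧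
      ∃ (hC : ∀ (lam : L) (α β : ArcAlgebra.CellIndex L lam),
          ArcAlgebra.cellVec k L lam α β ∈ H)
        (hstar : ∀ x ∈ H, ArcAlgebra.starMap k L x ∈ H),
        ArcAlgebra.IsCellularAlgebra k H
          (fun lam mu : L => ArcAlgebra.Weight.BruhatLE lam.1 mu.1)
          (ArcAlgebra.CellIndex L)
          (fun lam α β => ⟨ArcAlgebra.cellVec k L lam α β, hC lam α β⟩)
          (fun x => ⟨ArcAlgebra.starMap k L x.1, hstar x.1 x.2⟩) := by
  obtain ⟨cl, A, base, H⟩ := ArcAlgebra.exists_isModel k hL hfin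
  exact ⟨H.subalgebra, H.khovanovAlg_eq.symm, H.cellVec_mem,
    fun x hx => ArcAlgebra.starMap_mem hx, H.isCellularAlgebra hfin⟩
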